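/- Let $q\ge 2$ be an integer, let $H\in(1-\frac1{2q},1)$, and let $B=(B_t)_{t\ge0}$ be a fractional Brownian motion with Hurst index $H$, that is, a centered Gaussian process started from zero with covariance $E[B_sB_t]=R(s,t)=\frac12(t^{2H}+s^{2H}-|t-s|^{2H})$. Let $\mathfrak H$ be the Hilbert space obtained by completing the step functions on $[0,1]$ for the scalar product determined by $\langle \mathbf 1_{[0,s]},\mathbf 1_{[0,t]}\rangle_{\mathfrak H}=R(s,t)$, and let $h\mapsto B(h)$ be the isonormal process on $\mathfrak H$ with $B(\mathbf 1_{[0,t]})=B_t$. Let $\mathfrak H^{\odot q}\subset\mathfrak H^{\otimes q}$ be the symmetric tensor power, with the norm $\|g\|_{\mathfrak H^{\odot q}}=\sqrt{q!}\,\|g\|_{\mathfrak H^{\otimes q}}$, and let $I_q:\mathfrak H^{\odot q}\to L^2$ be the $q$th multiple Wiener–Itô integral with respect to $B$, that is, the continuous linear map with $I_q(h^{\otimes q})=H_q(B(h))$ whenever $\|h\|_{\mathfrak H}=1$, where $H_q(x)=(-1)^qe^{x^2/2}\frac{d^q}{dx^q}e^{-x^2/2}$. For $0<s<t$ let $$K_H(t,s)=c_H\,s^{\frac12-H}\int_s^t(u-s)^{H-\frac32}u^{H-\frac12}\,du,\qquad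 c_H=\Big(\frac{H(2H-1)\,\Gamma(\frac32-H)}{\Gamma(2-2H)\,\Gamma(H-\frac12)}\Big)^{1/2},$$ so that $R(t,s)=\int_0^{s\wedge t}K_H(t,r)K_H(s,r)\,dr$, and let $K_H^*:\mathfrak H\to L^2([0,1])$ be the isometry given on step functions by $(K_H^*\varphi)(s)=K_H(1,s)\varphi(s)+\int_s^1(\varphi(r)-\varphi(s))\,\partial_1K_H(r,s)\,dr$. Let $W_t=B\big((K_H^*)^{-1}\mathbf 1_{[0,t]}\big)$, $t\in[0,1]$, be the associated Wiener process, let $I_q^W$ be the $q$th multiple Wiener–Itô integral with respect to $W$ on the symmetric functions of $L^2([0,1]^q)$ (again with $I_q^W(h^{\otimes q})=H_q(\int_0^1h\,dW)$ for $\|h\|_{L^2}=1$), and let $Z=I_q^W(L_1)$ be the Hermite random variable with kernel $$L_1(y_1,\dots,y_q)=\mathbf 1_{[0,1]^q}(y_1,\dots,y_q)\int_{y_1\vee\dots\vee y_q}^1\partial_1K_H(u,y_1)\cdots\partial_1K_H(u,y_q)\,du .$$ For $n\ge1$ put $$f_n=n^{q-1}\sum_{k=0}^{n-1}\mathbf 1_{[k/n,(k+1)/n]}^{\otimes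 q},\quad S_n=n^{q(1-H)-1}\sum_{k=0}^{n-1}H_q\big(n^H(B_{(k+1)/n}-B_{k/n})\big),\quad Z_n=n^{-(1-q(1-H))}\sum_{k=0}^{n-1}H_q(B_{k+1}-B_k).$$ Then the multiple integrals $I_q$ and $I_q^W$ exist and $L_1\in L^2([0,1]^q)$. For every $n\ge1$ we have $f_n\in\mathfrak H^{\odot q}$, and $S_n=I_q(f_n)$ almost surely has the same law as $Z_n$. The sequence $(f_n)$ converges in $\mathfrak H^{\odot q}$ to a limit $f$, we have $Z=I_q(f)$ almost surely, for every $n\ge1$ $$E|S_n-Z|^2=E|I_q(f_n)-I_q(f)|^2=\|f_n-f\|^2_{\mathfrak H^{\odot q}},$$ and $$\|f_n-f\|^2_{\mathfrak H^{\odot q}}=O\big(n^{2q-1-2qH}\big)\qquad\text{as }n\to\infty .$$ -/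

import Mathlib

open MeasureTheory Set ProbabilityTheory Filter Topology Asymptotics
open scoped NNReal

namespace FBM

noncomputable section

/-! ### The covariance of fractional Brownian motion and its positivity -/

/-- The covariance `R(s,t) = (t^{2H} + s^{2H} - |t-s|^{2H}) / 2` of fractional Brownian motion. -/
def fbmCov (H s t : ℝ) : ℝ := (t ^ (2 * H) + s ^ (2 * H) - |t - s| ^ (2 * H)) / 2

/-- Auxiliary, for the proof that `R` is positive semidefinite: `R(s,t)` is, up to a positive factor,
`∫_0^∞ ((1 - cos sx)(1 - cos tx) + sin sx sin tx) x^{-1-2H} dx`. -/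
def osc (H x : ℝ) : ℝ := (1 - Real.cos x) * x ^ (-1 - 2 * H)

theorem osc_nonneg (H : ℝ) {x : ℝ} (hx : 0 < x) : 0 ≤ osc H x :=
  mul_nonneg (by linarith [Real.cos_le_one x]) (Real.rpow_nonneg hx.le _)

theorem osc_integrable {H : ℝ} (h0 : 0 < H) (h1 : H < 1) : IntegrableOn (osc H) (Ioi 0) := by
  have hmeas : Measurable (osc H) := by unfold osc; fun_prop
  rw [← Ioc_union_Ioi_eq_Ioi (zero_le_one' ℝ)]
  refine IntegrableOn.union ?_ ?_
  · have hi : IntegrableOn (fun x : ℝ => x ^ (1 - 2 * H)) (Ioc 0 1) :=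
      (intervalIntegrable_iff_integrableOn_Ioc_of_le zero_le_one).1
        (intervalIntegral.intervalIntegrable_rpow' (by linarith))
    refine hi.mono' hmeas.aestronglyMeasurable ?_
    filter_upwards [ae_restrict_mem measurableSet_Ioc] with x hx
    rw [Real.norm_of_nonneg (osc_nonneg H hx.1), osc]
    have e : x ^ (1 - 2 * H) = x ^ 2 * x ^ (-1 - 2 * H) := by
      rw [← Real.rpow_natCast, ← Real.rpow_add hx.1]; congr 1; push_cast; ring
    rw [e]
    have := Real.rpow_nonneg hx.1.le (-1 - 2 * H)
    have := Real.one_sub_sq_div_two_le_cos (x := x)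
    gcongr
    nlinarith [sq_nonneg x]
  · have hi : IntegrableOn (fun x : ℝ => 2 * x ^ (-1 - 2 * H)) (Ioi 1) :=
      (integrableOn_Ioi_rpow_of_lt (by linarith) zero_lt_one).const_mul 2
    refine hi.mono' hmeas.aestronglyMeasurable ?_
    filter_upwards [ae_restrict_mem measurableSet_Ioi] with x hx
    have hx0 : 0 < x := zero_lt_one.trans hx
    rw [Real.norm_of_nonneg (osc_nonneg H hx0), osc]
    have := Real.rpow_nonneg hx0.le (-1 - 2 * H)
    gcongr
    linarith [Real.neg_one_le_cos x]

theorem osc_integral_pos {H : ℝ} (h0 : 0 < H) (h1 : H < 1) : 0 < ∫ x in Ioi 0, osc H x := by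
  refine (setIntegral_pos_iff_support_of_nonneg_ae ?_ (osc_integrable h0 h1)).2 ?_
  · filter_upwards [ae_restrict_mem measurableSet_Ioi] with x hx using osc_nonneg H hx
  · have hsub : Ioo (0 : ℝ) 1 ⊆ Function.support (osc H) ∩ Ioi 0 := by
      intro x hx
      refine ⟨?_, hx.1⟩
      have hc : Real.cos x < 1 := by
        have := Real.cos_lt_cos_of_nonneg_of_le_pi le_rfl (by linarith [Real.pi_gt_three, hx.2]) hx.1
        simpa using this
      exact (mul_pos (by linarith) (Real.rpow_pos_of_pos hx.1 _)).ne'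
    refine lt_of_lt_of_le ?_ (measure_mono hsub)
    simp

theorem osc_scale_eq {H t x : ℝ} (ht : 0 < t) (hx : 0 < x) :
    (1 - Real.cos (t * x)) * x ^ (-1 - 2 * H) = t ^ (1 + 2 * H) * osc H (t * x) := by
  rw [osc, Real.mul_rpow ht.le hx.le]
  have : t ^ (1 + 2 * H) * t ^ (-1 - 2 * H) = 1 := by
    rw [← Real.rpow_add ht]; ring_nf; simp
  linear_combination (-(1 - Real.cos (t * x)) * x ^ (-1 - 2 * H)) * this

theorem osc_scaled {H : ℝ} (h0 : 0 < H) (h1 : H < 1) (t : ℝ) :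
    IntegrableOn (fun x => (1 - Real.cos (t * x)) * x ^ (-1 - 2 * H)) (Ioi 0) ∧
      ∫ x in Ioi 0, (1 - Real.cos (t * x)) * x ^ (-1 - 2 * H) =
        |t| ^ (2 * H) * ∫ x in Ioi 0, osc H x := by
  wlog ht : 0 < t generalizing t
  · rcases (not_lt.1 ht).lt_or_eq with h | h
    · simpa [Real.cos_neg] using this (-t) (by linarith)
    · subst h; simp [Real.zero_rpow (by linarith : 2 * H ≠ 0)]
  have hc : EqOn (fun x => (1 - Real.cos (t * x)) * x ^ (-1 - 2 * H))
      (fun x => t ^ (1 + 2 * H) * osc H (t * x)) (Ioi 0) := fun x hx => osc_scale_eq ht hx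
  constructor
  · rw [integrableOn_congr_fun hc measurableSet_Ioi]
    have := (integrableOn_Ioi_comp_mul_left_iff (osc H) 0 ht).2
      (by simpa using osc_integrable h0 h1)
    exact this.const_mul _
  · rw [setIntegral_congr_fun measurableSet_Ioi hc, integral_const_mul,
      integral_comp_mul_left_Ioi _ _ ht, mul_zero, abs_of_pos ht, smul_eq_mul, ← mul_assoc]
    congr 1
    rw [add_comm, Real.rpow_add ht, Real.rpow_one]
    field_simp

theorem fbmCov_posSemidef {H : ℝ} (h0 : 0 < H) (h1 : H < 1) {ι : Type*} (s : Finset ι)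
    (τ : ι → ℝ) (hτ : ∀ i, 0 ≤ τ i) (a : ι → ℝ) :
    0 ≤ ∑ u ∈ s, ∑ v ∈ s, a u * (a v * fbmCov H (τ u) (τ v)) := by
  have key : (∑ u ∈ s, ∑ v ∈ s, a u * (a v * fbmCov H (τ u) (τ v))) * (2 * ∫ x in Ioi 0, osc H x) =
      ∫ x in Ioi 0, ((∑ u ∈ s, a u * (1 - Real.cos (τ u * x))) ^ 2 +
        (∑ u ∈ s, a u * Real.sin (τ u * x)) ^ 2) * x ^ (-1 - 2 * H) := by
    have hI : ∀ u v : ι, IntegrableOn (fun x => a u * a v *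
        ((1 - Real.cos (τ v * x)) * x ^ (-1 - 2 * H) + (1 - Real.cos (τ u * x)) * x ^ (-1 - 2 * H)
          - (1 - Real.cos ((τ v - τ u) * x)) * x ^ (-1 - 2 * H))) (Ioi 0) := fun u v =>
      ((((osc_scaled h0 h1 (τ v)).1.add (osc_scaled h0 h1 (τ u)).1).sub
        (osc_scaled h0 h1 (τ v - τ u)).1).const_mul (a u * a v))
    have hA : ∀ u v : ι, IntegrableOn (fun x => (1 - Real.cos (τ v * x)) * x ^ (-1 - 2 * H) +
        (1 - Real.cos (τ u * x)) * x ^ (-1 - 2 * H)) (Ioi 0) := fun u v =>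
      (osc_scaled h0 h1 (τ v)).1.add (osc_scaled h0 h1 (τ u)).1
    have hR : ∀ u v, a u * (a v * fbmCov H (τ u) (τ v)) * (2 * ∫ x in Ioi 0, osc H x) =
        ∫ x in Ioi 0, a u * a v *
        ((1 - Real.cos (τ v * x)) * x ^ (-1 - 2 * H) + (1 - Real.cos (τ u * x)) * x ^ (-1 - 2 * H)
          - (1 - Real.cos ((τ v - τ u) * x)) * x ^ (-1 - 2 * H)) := by
      intro u v
      rw [integral_const_mul, integral_sub (hA u v)
        (osc_scaled h0 h1 (τ v - τ u)).1, integral_add (osc_scaled h0 h1 (τ v)).1 (osc_scaled h0 h1 (τ u)).1,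
        (osc_scaled h0 h1 (τ v)).2, (osc_scaled h0 h1 (τ u)).2, (osc_scaled h0 h1 (τ v - τ u)).2, fbmCov,
        abs_of_nonneg (hτ u), abs_of_nonneg (hτ v)]
      ring
    rw [Finset.sum_mul]
    simp_rw [Finset.sum_mul]
    rw [Finset.sum_congr rfl fun u _ => Finset.sum_congr rfl fun v _ => hR u v]
    rw [Finset.sum_congr rfl fun u _ => (integral_finsetSum s fun v _ => hI u v).symm,
      ← integral_finsetSum s fun u _ => integrable_finsetSum s fun v _ => hI u v]
    congr 1
    ext x
    rw [sq, sq, Finset.sum_mul_sum, Finset.sum_mul_sum, ← Finset.sum_add_distrib, Finset.sum_mul]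
    refine Finset.sum_congr rfl fun u _ => ?_
    rw [← Finset.sum_add_distrib, Finset.sum_mul]
    refine Finset.sum_congr rfl fun v _ => ?_
    rw [sub_mul (τ v) (τ u) x, Real.cos_sub]
    ring
  have hpos : 0 < 2 * ∫ x in Ioi 0, osc H x := by linarith [osc_integral_pos h0 h1]
  refine nonneg_of_mul_nonneg_left (b := 2 * ∫ x in Ioi 0, osc H x) ?_ hpos
  rw [key]
  refine setIntegral_nonneg measurableSet_Ioi fun x hx => ?_
  exact mul_nonneg (by positivity) (Real.rpow_nonneg (le_of_lt hx) _)

/-! ### The Hilbert space of fractional Brownian motion on `[0,1]` -/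

/-- The step function `1_{[0,t]}`, for `t ∈ [0,1]`. -/
def stepInd (t : Icc (0 : ℝ) 1) : ℝ → ℝ := (Icc (0 : ℝ) t).indicator 1

theorem linearIndependent_stepInd : LinearIndependent ℝ stepInd := by
  rw [linearIndependent_iff]
  intro l hl
  by_contra hne
  have hs : l.support.Nonempty := Finsupp.support_nonempty_iff.2 hne
  set m := l.support.max' hs with hm
  have hmem : m ∈ l.support := l.support.max'_mem hs
  have h := congrFun hl (m : ℝ)
  rw [Finsupp.linearCombination_apply, Finsupp.sum, Finset.sum_apply,
    Finset.sum_eq_single_of_mem m hmem] at h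
  · simp [stepInd, m.2.1] at h
    exact (Finsupp.mem_support_iff.1 hmem) h
  · intro t ht htm
    have hlt : (t : ℝ) < m := lt_of_le_of_ne (l.support.le_max' t ht) (fun e => htm (Subtype.ext e))
    simp [stepInd, (show t < m from hlt)]

/-- The step functions on `[0,1]`: the linear span of the functions `1_{[0,t]}`, `t ∈ [0,1]`.
The type carries `H` because its inner product depends on `H`. -/
def StepFun (_H : Ioo (0 : ℝ) 1) : Type := Submodule.span ℝ (range stepInd)

instance (H : Ioo (0 : ℝ) 1) : AddCommGroup (StepFun H) :=
  inferInstanceAs (AddCommGroup (Submodule.span ℝ (range stepInd)))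

instance (H : Ioo (0 : ℝ) 1) : Module ℝ (StepFun H) :=
  inferInstanceAs (Module ℝ (Submodule.span ℝ (range stepInd)))

/-- The functions `1_{[0,t]}` as a basis of the space of step functions. -/
def stepBasis (H : Ioo (0 : ℝ) 1) : Module.Basis (Icc (0 : ℝ) 1) ℝ (StepFun H) :=
  Module.Basis.span linearIndependent_stepInd

/-- The bilinear form on step functions with `⟨1_{[0,s]}, 1_{[0,t]}⟩ = R(s,t)`. -/
def stepForm (H : Ioo (0 : ℝ) 1) : StepFun H →ₗ[ℝ] StepFun H →ₗ[ℝ] ℝ :=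
  (stepBasis H).constr ℝ fun s => (stepBasis H).constr ℝ fun t => fbmCov H s t

theorem fbmCov_comm (H s t : ℝ) : fbmCov H s t = fbmCov H t s := by
  rw [fbmCov, fbmCov, abs_sub_comm]; ring

instance (H : Ioo (0 : ℝ) 1) : PreInnerProductSpace.Core ℝ (StepFun H) where
  inner φ ψ := stepForm H φ ψ
  conj_inner_symm φ ψ := by
    have h : (stepForm H).flip = stepForm H := by
      refine (stepBasis H).ext fun s => (stepBasis H).ext fun t => ?_
      simp only [LinearMap.flip_apply, stepForm, Module.Basis.constr_basis]
      exact fbmCov_comm _ _ _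
    exact LinearMap.congr_fun₂ h φ ψ
  re_inner_nonneg φ := by
    have h := fbmCov_posSemidef H.2.1 H.2.2 ((stepBasis H).repr φ).support
      (fun t : Icc (0 : ℝ) 1 => (t : ℝ)) (fun t => t.2.1) ((stepBasis H).repr φ)
    simpa [stepForm, Module.Basis.constr_apply, Finsupp.sum, Finset.mul_sum] using h
  add_left _ _ _ := by simp
  smul_left _ _ _ := by simp

instance (H : Ioo (0 : ℝ) 1) : SeminormedAddCommGroup (StepFun H) :=
  InnerProductSpace.Core.toSeminormedAddCommGroup (𝕜 := ℝ)

instance (H : Ioo (0 : ℝ) 1) : InnerProductSpace ℝ (StepFun H) := .ofCore _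

/-- The Hilbert space of fractional Brownian motion on `[0,1]`: the (separated) completion of the
step functions for the scalar product `⟨1_{[0,s]}, 1_{[0,t]}⟩ = R(s,t)`. -/
abbrev FBMSpace (H : Ioo (0 : ℝ) 1) : Type := UniformSpace.Completion (StepFun H)

/-- `1_{[0,t]}` as an element of the Hilbert space. -/
def ind (H : Ioo (0 : ℝ) 1) (t : Icc (0 : ℝ) 1) : FBMSpace H :=
  ((stepBasis H t : StepFun H) : FBMSpace H)

theorem inner_ind (H : Ioo (0 : ℝ) 1) (s t : Icc (0 : ℝ) 1) :
    inner ℝ (ind H s) (ind H t) = fbmCov H s t := by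
  rw [ind, ind, UniformSpace.Completion.inner_coe]
  change stepForm H _ _ = _
  simp [stepForm]

/-! ### Hilbert tensor powers -/

section Tensor

open TensorProduct

variable (E : Type*) [NormedAddCommGroup E] [InnerProductSpace ℝ E] (q : ℕ)

/-- The algebraic tensor power, with the inner product determined by
`⟨x₁ ⊗ ⋯ ⊗ x_q, y₁ ⊗ ⋯ ⊗ y_q⟩ = ∏ ⟨x_i, y_i⟩`. -/
def PreTensorPower : Type _ := ⨂[ℝ] _ : Fin q, E

instance : AddCommGroup (PreTensorPower E q) :=
  inferInstanceAs (AddCommGroup (⨂[ℝ] _ : Fin q, E))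

instance : Module ℝ (PreTensorPower E q) :=
  inferInstanceAs (Module ℝ (⨂[ℝ] _ : Fin q, E))

/-- The bilinear form with `⟨x₁ ⊗ ⋯ ⊗ x_q, y₁ ⊗ ⋯ ⊗ y_q⟩ = ∏ ⟨x_i, y_i⟩`. -/
def tensorForm : (⨂[ℝ] _ : Fin q, E) →ₗ[ℝ] (⨂[ℝ] _ : Fin q, E) →ₗ[ℝ] ℝ :=
  PiTensorProduct.dualDistrib ∘ₗ PiTensorProduct.map fun _ => innerₗ E

theorem tensorForm_tprod (x y : Fin q → E) :
    tensorForm E q (PiTensorProduct.tprod ℝ x) (PiTensorProduct.tprod ℝ y) =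
      ∏ i, inner ℝ (x i) (y i) := by
  simp [tensorForm]

theorem posSemidef_prod_inner (s : Finset (Fin q)) :
    (Matrix.of fun x y : Fin q → E => ∏ i ∈ s, inner ℝ (x i) (y i)).PosSemidef := by
  classical
  induction s using Finset.induction_on with
  | empty =>
    refine ⟨by ext; simp, fun c => ?_⟩
    simp only [Finset.prod_empty, Matrix.of_apply, star_trivial, mul_one, Finsupp.sum]
    rw [← Finset.sum_mul_sum]
    exact mul_self_nonneg _
  | insert i s hi ih =>
    have hg : (Matrix.of fun x y : Fin q → E => inner ℝ (x i) (y i)).PosSemidef := by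
      refine ⟨by ext x y; simp [real_inner_comm], fun c => ?_⟩
      have h0 : 0 ≤ inner ℝ (∑ x ∈ c.support, c x • x i) (∑ x ∈ c.support, c x • x i) :=
        real_inner_self_nonneg
      simp only [sum_inner, inner_sum, real_inner_smul_left, real_inner_smul_right] at h0
      simp only [Matrix.of_apply, star_trivial, Finsupp.sum]
      refine h0.trans_eq (Finset.sum_congr rfl fun x _ => Finset.sum_congr rfl fun y _ => ?_)
      rw [real_inner_comm]; ring
    have e : (Matrix.of fun x y : Fin q → E => ∏ j ∈ insert i s, inner ℝ (x j) (y j)) =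
        Matrix.hadamard (Matrix.of fun x y : Fin q → E => inner ℝ (x i) (y i))
          (Matrix.of fun x y : Fin q → E => ∏ j ∈ s, inner ℝ (x j) (y j)) := by
      ext x y
      simp [Finset.prod_insert hi, Matrix.hadamard]
    rw [e]
    exact hg.hadamard ih

theorem tensorForm_comm (x y : ⨂[ℝ] _ : Fin q, E) : tensorForm E q y x = tensorForm E q x y := by
  have h : (tensorForm E q).flip = tensorForm E q := by
    refine PiTensorProduct.ext (MultilinearMap.ext fun x => PiTensorProduct.ext
      (MultilinearMap.ext fun y => ?_))
    simp only [LinearMap.compMultilinearMap_apply, LinearMap.flip_apply, tensorForm_tprod]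
    exact Finset.prod_congr rfl fun i _ => real_inner_comm _ _
  exact LinearMap.congr_fun₂ h x y

theorem tensorForm_nonneg (x : ⨂[ℝ] _ : Fin q, E) : 0 ≤ tensorForm E q x x := by
  have hx : x ∈ Submodule.span ℝ (range (PiTensorProduct.tprod ℝ (s := fun _ : Fin q => E))) := by
    rw [PiTensorProduct.span_tprod_eq_top]; trivial
  obtain ⟨c, rfl⟩ := Finsupp.mem_span_range_iff_exists_finsupp.1 hx
  refine ((posSemidef_prod_inner E q Finset.univ).2 c).trans_eq ?_
  simp only [Finsupp.sum, map_sum, map_smul, LinearMap.sum_apply, LinearMap.smul_apply,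
    tensorForm_tprod, smul_eq_mul, star_trivial, Finset.mul_sum, Matrix.of_apply]
  rw [Finset.sum_comm]
  exact Finset.sum_congr rfl fun _ _ => Finset.sum_congr rfl fun _ _ => by ring

instance : PreInnerProductSpace.Core ℝ (PreTensorPower E q) where
  inner x y := tensorForm E q x y
  conj_inner_symm x y := tensorForm_comm E q x y
  re_inner_nonneg x := tensorForm_nonneg E q x
  add_left x y z := LinearMap.map_add₂ (tensorForm E q) x y z
  smul_left x y r := LinearMap.map_smul₂ (tensorForm E q) r x y

instance : SeminormedAddCommGroup (PreTensorPower E q) :=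
  InnerProductSpace.Core.toSeminormedAddCommGroup (𝕜 := ℝ)

instance : InnerProductSpace ℝ (PreTensorPower E q) := .ofCore _

/-- The Hilbert space tensor power `E^{⊗q}`. -/
abbrev TensorPower : Type _ := UniformSpace.Completion (PreTensorPower E q)

variable {E} in
/-- `h^{⊗q}` in the algebraic tensor power. -/
def preTpow (h : E) : PreTensorPower E q := PiTensorProduct.tprod ℝ (fun _ : Fin q => h)

variable {E} in
/-- `h^{⊗q}` in the Hilbert space tensor power. -/
def tpow (h : E) : TensorPower E q := (preTpow q h : TensorPower E q)

theorem inner_tpow (g h : E) : inner ℝ (tpow q g) (tpow q h) = (inner ℝ g h) ^ q := by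
  rw [tpow, tpow, UniformSpace.Completion.inner_coe]
  change tensorForm E q _ _ = _
  rw [preTpow, preTpow, tensorForm_tprod]
  simp

/-- The symmetric tensor power `E^{⊙q}`, as a closed subspace of `E^{⊗q}`: the closed linear span of
the powers `h^{⊗q}` (by polarization these span the symmetric tensors). -/
def symTensorPower : Submodule ℝ (TensorPower E q) :=
  (Submodule.span ℝ (range (tpow q : E → TensorPower E q))).topologicalClosure

variable {E} in
/-- The norm `‖g‖_{E^{⊙q}} = √(q!) ‖g‖_{E^{⊗q}}` used on `E^{⊙q}`, for which multiple Wiener-Itô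
integrals are isometries. -/
def symNorm (g : TensorPower E q) : ℝ := √(q.factorial : ℝ) * ‖g‖

end Tensor

/-! ### Continuous linear maps determined by their values on a family -/

section Extension

variable {ι E F : Type*} [NormedAddCommGroup E] [InnerProductSpace ℝ E]
  [NormedAddCommGroup F] [NormedSpace ℝ F]

/-- `T` is the continuous linear map with `T (u i) = v i` that vanishes on the orthogonal
complement of the `u i`. -/
def IsExtension (u : ι → E) (v : ι → F) (T : E →L[ℝ] F) : Prop :=
  (∀ i, T (u i) = v i) ∧ ∀ x ∈ (Submodule.span ℝ (range u))ᗮ, T x = 0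

theorem IsExtension.unique [CompleteSpace E] {u : ι → E} {v : ι → F} {T T' : E →L[ℝ] F}
    (h : IsExtension u v T) (h' : IsExtension u v T') : T = T' := by
  have h1 : Submodule.span ℝ (range u) ≤ (T - T').ker := by
    rw [Submodule.span_le]
    rintro _ ⟨i, rfl⟩
    simp [h.1 i, h'.1 i]
  have h2 : (Submodule.span ℝ (range u)).topologicalClosure ≤ (T - T').ker :=
    Submodule.topologicalClosure_minimal _ h1 (T - T').isClosed_ker
  have h3 : ((Submodule.span ℝ (range u)).topologicalClosure)ᗮ ≤ (T - T').ker := by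
    intro x hx
    rw [Submodule.orthogonal_closure] at hx
    simp [h.2 x hx, h'.2 x hx]
  have h4 : (⊤ : Submodule ℝ E) ≤ (T - T').ker := by
    have : CompleteSpace (Submodule.span ℝ (range u)).topologicalClosure :=
      (Submodule.isClosed_topologicalClosure _).completeSpace_coe
    rw [← Submodule.sup_orthogonal_of_hasOrthogonalProjection
      (K := (Submodule.span ℝ (range u)).topologicalClosure)]
    exact sup_le h2 h3
  ext x
  have := h4 (Submodule.mem_top (x := x))
  simpa [sub_eq_zero] using this

open Classical in
/-- The unique `T` with `IsExtension u v T` (and `0` if there is none). -/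
def extension (u : ι → E) (v : ι → F) : E →L[ℝ] F :=
  if h : ∃ T, IsExtension u v T then h.choose else 0

end Extension

open Classical in
/-- The class of `f` in `L²(μ)` (and `0` if `f` is not square integrable). -/
def toL2 {α : Type*} {mα : MeasurableSpace α} (μ : Measure α) (f : α → ℝ) : Lp ℝ 2 μ :=
  if h : MemLp f 2 μ then h.toLp f else 0

/-! ### Fractional Brownian motion, the isonormal process and multiple integrals -/

section Probability

variable {Ω : Type*} {mΩ : MeasurableSpace Ω}

/-- `B` is a fractional Brownian motion on `[0,∞)` with Hurst index `H`: a centered Gaussian process,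
started from zero, with covariance `R`. -/
structure IsFBM (H : ℝ) (B : ℝ≥0 → Ω → ℝ) (P : Measure Ω) : Prop where
  isGaussianProcess : IsGaussianProcess B P
  start : ∀ᵐ ω ∂P, B 0 ω = 0
  centered : ∀ t, ∫ ω, B t ω ∂P = 0
  covariance : ∀ s t, ∫ ω, B s ω * B t ω ∂P = fbmCov H s t

/-- The isonormal process `h ↦ B(h) ∈ L²(P)`, determined by `B(1_{[0,t]}) = B_t`. -/
def isonormal (H : Ioo (0 : ℝ) 1) (P : Measure Ω) (B : ℝ≥0 → Ω → ℝ) :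
    FBMSpace H →L[ℝ] Lp ℝ 2 P :=
  extension (ind H) fun t => toL2 P (B ⟨t, t.2.1⟩)

/-- The Hermite polynomial `H_q(x) = (-1)^q e^{x²/2} (d/dx)^q e^{-x²/2}`. -/
def hermiteFun (q : ℕ) (x : ℝ) : ℝ := Polynomial.aeval x (Polynomial.hermite q)

variable {E T : Type*} [NormedAddCommGroup E] [NormedAddCommGroup T] [InnerProductSpace ℝ T]

/-- `I` is the `q`-th multiple Wiener-Itô integral with respect to the isonormal process
`X : E → L²(P)`: the continuous linear map with `I(h^{⊗q}) = H_q(X(h))` whenever `‖h‖ = 1`. Here `T`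
is the Hilbert space in which the tensor power is realized and `pow h = h^{⊗q}`. As usual, `I` is
defined on all tensors through `I(g) = I(sym g)`, that is, it vanishes on the orthogonal complement
of the symmetric tensors. -/
def IsMultipleIntegral {P : Measure Ω} (q : ℕ) (pow : E → T) (X : E → Lp ℝ 2 P)
    (I : T →L[ℝ] Lp ℝ 2 P) : Prop :=
  IsExtension (fun h : Metric.sphere (0 : E) 1 => pow h)
    (fun h => toL2 P fun ω => hermiteFun q (X h ω)) I

/-- The multiple Wiener-Itô integral: the unique `I` with `IsMultipleIntegral q pow X I`. -/
def multipleIntegral {P : Measure Ω} (q : ℕ) (pow : E → T) (X : E → Lp ℝ 2 P) :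
    T →L[ℝ] Lp ℝ 2 P :=
  extension (fun h : Metric.sphere (0 : E) 1 => pow h)
    (fun h => toL2 P fun ω => hermiteFun q (X h ω))

/-- The multiple integral `I_q` with respect to `B`, on the tensor power of the Hilbert space of
fractional Brownian motion. -/
def fbmIntegral (H : Ioo (0 : ℝ) 1) (q : ℕ) (P : Measure Ω) (B : ℝ≥0 → Ω → ℝ) :
    TensorPower (FBMSpace H) q →L[ℝ] Lp ℝ 2 P :=
  multipleIntegral q (tpow q) (isonormal H P B)

/-- `f_n = n^{q-1} ∑_{k<n} 1_{[k/n,(k+1)/n]}^{⊗q}`. -/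
def kernelSeq (H : Ioo (0 : ℝ) 1) (q n : ℕ) : TensorPower (FBMSpace H) q :=
  (n : ℝ) ^ (q - 1) • ∑ k ∈ Finset.range n,
    tpow q (ind H (projIcc 0 1 zero_le_one (((k : ℝ) + 1) / n)) -
      ind H (projIcc 0 1 zero_le_one ((k : ℝ) / n)))

/-- `S_n = n^{q(1-H)-1} ∑_{k<n} H_q(n^H (B_{(k+1)/n} - B_{k/n}))`. -/
def S (H : ℝ) (q : ℕ) (B : ℝ≥0 → Ω → ℝ) (n : ℕ) (ω : Ω) : ℝ :=
  (n : ℝ) ^ (q * (1 - H) - 1) * ∑ k ∈ Finset.range n,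
    hermiteFun q ((n : ℝ) ^ H * (B (((k : ℝ≥0) + 1) / n) ω - B ((k : ℝ≥0) / n) ω))

/-- `Z_n = n^{-(1-q(1-H))} ∑_{k<n} H_q(B_{k+1} - B_k)`. -/
def hermiteVariation (H : ℝ) (q : ℕ) (B : ℝ≥0 → Ω → ℝ) (n : ℕ) (ω : Ω) : ℝ :=
  (∑ k ∈ Finset.range n, hermiteFun q (B ((k : ℝ≥0) + 1) ω - B (k : ℝ≥0) ω)) /
    (n : ℝ) ^ (1 - q * (1 - H))

/-! ### The Hermite random variable -/

/-- The kernel `K_H`, for `H > 1/2`: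
`K_H(t,s) = c_H s^{1/2-H} ∫_s^t (u-s)^{H-3/2} u^{H-1/2} du` for `0 < s < t`, where
`c_H² = H(2H-1)/β(2-2H, H-1/2)`. It equals
`c_H (H-1/2)⁻¹ (t-s)^{H-1/2} F(H-1/2, 1/2-H, H+1/2, 1-t/s)`, with the normalization for which
`R(t,s) = ∫_0^{s∧t} K_H(t,r) K_H(s,r) dr`. -/
def kernelK (H t s : ℝ) : ℝ :=
  if s < t then
    √(H * (2 * H - 1) * Real.Gamma (3 / 2 - H) / (Real.Gamma (2 - 2 * H) * Real.Gamma (H - 1 / 2))) *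
      s ^ (1 / 2 - H) * ∫ u in s..t, (u - s) ^ (H - 3 / 2) * u ^ (H - 1 / 2)
  else 0

/-- The partial derivative `∂₁K_H(t,s)`. -/
def derivK (H t s : ℝ) : ℝ := deriv (fun r => kernelK H r s) t

/-- Lebesgue measure on `[0,1]`. -/
def unitMeasure : Measure ℝ := volume.restrict (Icc 0 1)

/-- `(K_H^* φ)(s) = K_H(1,s) φ(s) + ∫_s^1 (φ(r) - φ(s)) ∂₁K_H(r,s) dr`, for a step function `φ`. -/
def starFun (H : ℝ) (φ : ℝ → ℝ) (s : ℝ) : ℝ :=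
  kernelK H 1 s * φ s + ∫ r in s..1, (φ r - φ s) * derivK H r s

/-- The isometry `K_H^*` from the Hilbert space of fractional Brownian motion to `L²([0,1])`. -/
def Kstar (H : Ioo (0 : ℝ) 1) : FBMSpace H →L[ℝ] Lp ℝ 2 unitMeasure :=
  extension (ind H) fun t => toL2 unitMeasure (starFun H (stepInd t))

/-- The Wiener process `W_t = B((K_H^*)⁻¹ 1_{[0,t]})`, `t ∈ [0,1]`. -/
def wiener (H : Ioo (0 : ℝ) 1) (P : Measure Ω) (B : ℝ≥0 → Ω → ℝ) (t : Icc (0 : ℝ) 1) : Lp ℝ 2 P :=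
  isonormal H P B (Function.invFun (Kstar H) (toL2 unitMeasure (stepInd t)))

/-- The Wiener integral `h ↦ W(h) = ∫_0^1 h dW` on `L²([0,1])`, determined by `W(1_{[0,t]}) = W_t`. -/
def wienerIntegral (H : Ioo (0 : ℝ) 1) (P : Measure Ω) (B : ℝ≥0 → Ω → ℝ) :
    Lp ℝ 2 unitMeasure →L[ℝ] Lp ℝ 2 P :=
  extension (fun t : Icc (0 : ℝ) 1 => toL2 unitMeasure (stepInd t)) (wiener H P B)

/-- Lebesgue measure on `[0,1]^q`. -/
def cubeMeasure (q : ℕ) : Measure (Fin q → ℝ) := Measure.pi fun _ => unitMeasure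

/-- `h^{⊗q}(y₁, …, y_q) = h(y₁) ⋯ h(y_q)` in `L²([0,1]^q)`, for `h ∈ L²([0,1])`. -/
def powL2 (q : ℕ) (h : Lp ℝ 2 unitMeasure) : Lp ℝ 2 (cubeMeasure q) :=
  toL2 (cubeMeasure q) fun y => ∏ i, h (y i)

/-- The multiple integral `I_q^W` with respect to `W`, on `L²([0,1]^q)`. -/
def wienerMultipleIntegral (H : Ioo (0 : ℝ) 1) (q : ℕ) (P : Measure Ω) (B : ℝ≥0 → Ω → ℝ) :
    Lp ℝ 2 (cubeMeasure q) →L[ℝ] Lp ℝ 2 P :=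
  multipleIntegral q (powL2 q) (wienerIntegral H P B)

/-- The symmetric kernel
`L_1(y₁, …, y_q) = 1_{[0,1]^q}(y) ∫_{y₁ ∨ ⋯ ∨ y_q}^1 ∂₁K_H(u,y₁) ⋯ ∂₁K_H(u,y_q) du`. There is no
factor `1/q!`, since the Hermite polynomials are normalized to have leading coefficient `1`. -/
def hermiteKernel (H : ℝ) (q : ℕ) : (Fin q → ℝ) → ℝ :=
  {y | ∀ i, y i ∈ Icc (0 : ℝ) 1}.indicator
    fun y => ∫ u in (⨆ i, y i)..1, ∏ i, derivK H u (y i)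

/-- The Hermite random variable `Z = I_q^W(L_1)`. -/
def hermiteRV (H : Ioo (0 : ℝ) 1) (q : ℕ) (P : Measure Ω) (B : ℝ≥0 → Ω → ℝ) : Lp ℝ 2 P :=
  wienerMultipleIntegral H q P B (toL2 (cubeMeasure q) (hermiteKernel H q))

end Probability

end

end FBM

namespace FBM

noncomputable section

open scoped ENNReal

/-! ### Hermite polynomials and the Gaussian measure -/

/-! Everything is moved to L²([0,1]^q). For H > 1/2 the operator K_H^* sends 1_{(a,b]} to ∫_a^b
∂₁K_H(u,·) du and is an isometry onto L²([0,1]), and W(K_H^* h) = B(h). Hence h^{⊗q} ↦ (K_H^*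
h)^{⊗q} is isometric on symmetric tensors and carries I_q to I_q^W (`IsFBM.fbmIntegral_eq`). It maps
f_n to n^{q-1} Σ_k (∫_{cell k} ∂₁K_H(u,·) du)^{⊗q}, while L_1 = Σ_k ∫_{cell k} ∂₁K_H(u,·)^{⊗q} du.
The error is therefore a sum of cell errors e_k, each comparing the power of an average with the
average of a power (`transfer_kernelSeq_sub`).

The computation rests on ∫ ∂₁K_H(u,y) ∂₁K_H(v,y) dy = ρ(u,v) := H(2H-1)|u-v|^{2H-2}
(`lintegral_dK_mul_dK`). By Tonelli, inner products of the terms over cells A and A' are (∬ρ)^q,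
∫(∫ρ)^q or ∬ρ^q. Put β = q(2-2H); the assumption on H says β < 1, so ρ^q, a multiple of |u-v|^{-β},
is integrable. If ρ were constant on A × A', the four terms of ⟨e_k, e_l⟩ would cancel. For cells at
distance m ≥ 2 they cancel up to the oscillation of ρ^q, so ⟨e_k, e_l⟩ is at most a constant times
n^{β-2}((m-1)^{-β} - (m+1)^{-β}). For m ≤ 1, Cauchy-Schwarz gives a constant times n^{β-2}
(`inner_cellError_le`). The sum over m telescopes, each row of the Gram matrix contributes
O(n^{β-2}), and n rows give n^{β-1} = n^{2q-1-2qH}. As β < 1 this tends to 0, so the images of the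
f_n converge to L_1; by isometry (f_n) is Cauchy, and its limit f has I_q(f) = I_q^W(L_1) = Z.

The objects exist for two reasons. Mehler's formula gives E[H_q(X(h)) H_q(X(g))] = q! ⟨h,g⟩^q for
unit vectors, and families with proportional Gram matrices are matched by a continuous linear map
(`exists_isExtension`). For W, the surjectivity of K_H^* comes from inverting an Abel transform
(`eq_zero_of_integral_kernelInt_eq_zero`). That S_n and Z_n have the same law is self-similarity. -/

open Polynomial in
/-- The probabilists' Hermite polynomial with real coefficients. -/
def hermiteR (q : ℕ) : ℝ[X] := (Polynomial.hermite q).map (Int.castRingHom ℝ)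

theorem hermiteFun_eq_eval (q : ℕ) (x : ℝ) : hermiteFun q x = (hermiteR q).eval x := by
  rw [hermiteFun, hermiteR, Polynomial.aeval_def, Polynomial.eval_map]
  rfl

theorem hermiteR_succ (q : ℕ) :
    hermiteR (q + 1) = Polynomial.X * hermiteR q - Polynomial.derivative (hermiteR q) := by
  simp [hermiteR, Polynomial.derivative_map]

/-- Differentiating H_{q+2} = X H_{q+1} - H_{q+1}' and inserting the inductive hypothesis leaves
H_{q+1} + (q+1)(X H_q - H_q'), and the bracket is H_{q+1} again. -/
theorem derivative_hermiteR_succ (q : ℕ) :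
    Polynomial.derivative (hermiteR (q + 1)) = ((q : ℝ) + 1) • hermiteR q := by
  induction q with
  | zero => simp [hermiteR]
  | succ q ih =>
    rw [hermiteR_succ (q + 1), Polynomial.derivative_sub, Polynomial.derivative_mul, ih,
      Polynomial.derivative_X, one_mul, Polynomial.derivative_smul, mul_smul_comm,
      add_sub_assoc, ← smul_sub, ← hermiteR_succ]
    push_cast
    module

theorem measurable_hermiteFun (q : ℕ) : Measurable (hermiteFun q) := by
  simp_rw [funext (hermiteFun_eq_eval q)]
  exact (hermiteR q).continuous.measurable

theorem integrable_eval_gaussianReal (p : Polynomial ℝ) (m : ℝ) (v : ℝ≥0) :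
    Integrable (fun x => p.eval x) (gaussianReal m v) := by
  simp_rw [Polynomial.eval_eq_sum_range]
  refine integrable_finsetSum _ fun i _ => Integrable.const_mul ?_ _
  have h : MemLp (id : ℝ → ℝ) i (gaussianReal m v) := by
    exact_mod_cast memLp_id_gaussianReal (μ := m) (v := v) (i : ℝ≥0)
  have := (h.integrable_norm_pow').mono' (g := fun x => ‖x‖ ^ i) (f := fun x : ℝ => x ^ i)
    (by fun_prop) (by simp)
  exact this

theorem memLp_eval_gaussianReal (p : Polynomial ℝ) (m : ℝ) (v : ℝ≥0) :
    MemLp (fun x => p.eval x) 2 (gaussianReal m v) := by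
  rw [memLp_two_iff_integrable_sq p.continuous.aestronglyMeasurable]
  exact (integrable_eval_gaussianReal (p ^ 2) m v).congr (ae_of_all _ fun x => by simp [Polynomial.eval_pow])

theorem integrable_gaussianReal_iff (f : ℝ → ℝ) (m : ℝ) {v : ℝ≥0} (hv : v ≠ 0) :
    Integrable f (gaussianReal m v) ↔ Integrable fun x => gaussianPDFReal m v x * f x := by
  rw [gaussianReal_of_var_ne_zero m hv, integrable_withDensity_iff_integrable_smul'
    (measurable_gaussianPDF m v) (Eventually.of_forall fun _ => gaussianPDF_lt_top)]
  simp [toReal_gaussianPDF]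

theorem hasDerivAt_gaussianPDFReal (x : ℝ) :
    HasDerivAt (gaussianPDFReal 0 1) (-x * gaussianPDFReal 0 1 x) x := by
  have h : gaussianPDFReal 0 1 = fun x => (√(2 * Real.pi))⁻¹ * Real.exp (-(x ^ 2 / 2)) := by
    ext x; simp [gaussianPDFReal, neg_div]
  rw [h]
  have h1 : HasDerivAt (fun x : ℝ => -(x ^ 2 / 2)) (-x) x := by
    refine ((hasDerivAt_pow 2 x).div_const 2).fun_neg.congr_deriv ?_
    simp
  refine (h1.exp.const_mul (√(2 * Real.pi))⁻¹).congr_deriv ?_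
  ring

/-- Gaussian integration by parts for polynomials. -/
theorem integral_mul_eval_gaussianReal (p : Polynomial ℝ) :
    ∫ x, x * p.eval x ∂gaussianReal 0 1 = ∫ x, p.derivative.eval x ∂gaussianReal 0 1 := by
  have h1 := integrable_eval_gaussianReal (p.derivative - Polynomial.X * p) 0 1
  have h0 := integrable_eval_gaussianReal p 0 1
  rw [integrable_gaussianReal_iff _ _ one_ne_zero] at h0 h1
  -- The integrand is the exact derivative of density times p, because the standard Gaussian density
  -- φ satisfies φ' = -xφ.
  have key : ∫ x, gaussianPDFReal 0 1 x * (p.derivative - Polynomial.X * p).eval x = 0 := by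
    refine integral_eq_zero_of_hasDerivAt_of_integrable
      (f := fun x => gaussianPDFReal 0 1 x * p.eval x) (fun x => ?_) h1 h0
    refine ((hasDerivAt_gaussianPDFReal x).fun_mul (p.hasDerivAt x)).congr_deriv ?_
    rw [Polynomial.eval_sub, Polynomial.eval_mul, Polynomial.eval_X]
    ring
  have h2 : ∫ x, (p.derivative - Polynomial.X * p).eval x ∂gaussianReal 0 1 = 0 := by
    rw [integral_gaussianReal_eq_integral_smul one_ne_zero]
    simpa using key
  simp only [Polynomial.eval_sub, Polynomial.eval_mul, Polynomial.eval_X] at h2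
  rw [integral_sub (integrable_eval_gaussianReal _ _ _)] at h2
  · linarith
  · exact (integrable_eval_gaussianReal (Polynomial.X * p) 0 1).congr
      (ae_of_all _ fun x => by simp [Polynomial.eval_mul])

/-- The action of the Ornstein-Uhlenbeck semigroup on Hermite polynomials (Mehler's formula). -/
theorem integral_hermiteR_mehler {ρ σ : ℝ} (h : ρ ^ 2 + σ ^ 2 = 1) (x : ℝ) (q : ℕ) :
    ∫ w, (hermiteR q).eval (ρ * x + σ * w) ∂gaussianReal 0 1 = ρ ^ q * (hermiteR q).eval x := by
  induction q using Nat.strong_induction_on with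
  | _ q ih =>
    rcases q with _ | q
    · simp [hermiteR]
    have hL : ∀ p : Polynomial ℝ, ∀ w, p.eval (ρ * x + σ * w) =
        (p.comp (Polynomial.C (ρ * x) + Polynomial.C σ * Polynomial.X)).eval w := by
      intro p w; simp
    set L : Polynomial ℝ := Polynomial.C (ρ * x) + Polynomial.C σ * Polynomial.X with hLdef
    have hint : ∀ p : Polynomial ℝ, Integrable (fun w => p.eval (ρ * x + σ * w)) (gaussianReal 0 1) := by
      intro p
      simp_rw [hL p]
      exact integrable_eval_gaussianReal _ _ _
    have hstein : ∫ w, w * (hermiteR q).eval (ρ * x + σ * w) ∂gaussianReal 0 1 =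
        σ * ∫ w, (Polynomial.derivative (hermiteR q)).eval (ρ * x + σ * w) ∂gaussianReal 0 1 := by
      simp_rw [hL]
      rw [integral_mul_eval_gaussianReal, Polynomial.derivative_comp, ← integral_const_mul]
      congr 1; ext w
      simp [hLdef]
    -- H_q' is a multiple of H_{q-1}, for which the induction provides only ρ^{q-1}; the extra
    -- factor ρ restores the power and covers q = 0, where both sides vanish.
    have hd : (∫ w, (Polynomial.derivative (hermiteR q)).eval (ρ * x + σ * w) ∂gaussianReal 0 1) * ρ =
        ρ ^ q * (Polynomial.derivative (hermiteR q)).eval x := by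
      rcases q with _ | q
      · simp [hermiteR]
      · rw [derivative_hermiteR_succ]
        simp only [Polynomial.eval_smul, smul_eq_mul]
        rw [integral_const_mul, ih q (by omega)]
        ring
    have hw : Integrable (fun w => w * (hermiteR q).eval (ρ * x + σ * w)) (gaussianReal 0 1) := by
      simp_rw [hL]
      exact (integrable_eval_gaussianReal (Polynomial.X * (hermiteR q).comp L) 0 1).congr
        (ae_of_all _ fun x => by simp [Polynomial.eval_mul])
    have e : ∀ w, (hermiteR (q + 1)).eval (ρ * x + σ * w) =
        (ρ * x * (hermiteR q).eval (ρ * x + σ * w) + σ * (w * (hermiteR q).eval (ρ * x + σ * w))) -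
          (Polynomial.derivative (hermiteR q)).eval (ρ * x + σ * w) := by
      intro w; rw [hermiteR_succ]; simp; ring
    simp_rw [e]
    have hA : Integrable (fun w => ρ * x * (hermiteR q).eval (ρ * x + σ * w) +
        σ * (w * (hermiteR q).eval (ρ * x + σ * w))) (gaussianReal 0 1) :=
      ((hint _).const_mul _).add (hw.const_mul _)
    rw [integral_sub hA (hint _),
      integral_add ((hint _).const_mul _) (hw.const_mul _), integral_const_mul, integral_const_mul,
      hstein, ih q (by omega), hermiteR_succ]
    simp only [Polynomial.eval_sub, Polynomial.eval_mul, Polynomial.eval_X]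
    set D := ∫ w, (Polynomial.derivative (hermiteR q)).eval (ρ * x + σ * w) ∂gaussianReal 0 1
    -- Here ρ² + σ² = 1 enters: recursion and integration by parts together leave (σ² - 1)D = -ρ²D.
    have hs : σ * (σ * D) = D - ρ * (D * ρ) := by linear_combination D * h
    rw [hs, hd]
    ring

/-- Replace one factor H_{q+1} by xH_q - H_q' and integrate x · H_q H_{q+1} by parts. The H_q'
H_{q+1} terms cancel, and H_q H_{q+1}' = (q+1) H_q² remains. -/
theorem integral_hermiteR_sq (q : ℕ) :
    ∫ x, (hermiteR q).eval x * (hermiteR q).eval x ∂gaussianReal 0 1 = q.factorial := by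
  induction q with
  | zero => simp [hermiteR]
  | succ q ih =>
    have h1 := integral_mul_eval_gaussianReal (hermiteR q * hermiteR (q + 1))
    rw [Polynomial.derivative_mul, derivative_hermiteR_succ] at h1
    have e : ∀ x, (hermiteR (q + 1)).eval x * (hermiteR (q + 1)).eval x =
        x * (hermiteR q * hermiteR (q + 1)).eval x -
          (Polynomial.derivative (hermiteR q) * hermiteR (q + 1)).eval x := by
      intro x
      nth_rewrite 1 [hermiteR_succ]
      simp
      ring
    simp_rw [e]
    rw [integral_sub _ (integrable_eval_gaussianReal _ _ _), h1]
    · simp only [Polynomial.eval_add]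
      rw [integral_add (integrable_eval_gaussianReal _ _ _) (integrable_eval_gaussianReal _ _ _),
        add_sub_cancel_left]
      simp only [Polynomial.eval_mul, Polynomial.eval_smul, smul_eq_mul]
      rw [Nat.factorial_succ]
      push_cast
      rw [← ih, ← integral_const_mul]
      congr 1; ext x; ring
    · exact (integrable_eval_gaussianReal (Polynomial.X * (hermiteR q * hermiteR (q + 1))) 0 1).congr
        (ae_of_all _ fun x => by simp [Polynomial.eval_mul])

/-! ### Extensions of families with proportional Gram matrices -/

section Extension

variable {ι E F : Type*} [NormedAddCommGroup E] [InnerProductSpace ℝ E]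
  [NormedAddCommGroup F] [InnerProductSpace ℝ F]

theorem inner_linearCombination {u : ι → E} {v : ι → F} {c : ℝ}
    (h : ∀ i j, inner ℝ (v i) (v j) = c * inner ℝ (u i) (u j)) (a b : ι →₀ ℝ) :
    inner ℝ (Finsupp.linearCombination ℝ v a) (Finsupp.linearCombination ℝ v b) =
      c * inner ℝ (Finsupp.linearCombination ℝ u a) (Finsupp.linearCombination ℝ u b) := by
  simp only [Finsupp.linearCombination_apply, Finsupp.sum, sum_inner, inner_sum,
    real_inner_smul_left, real_inner_smul_right, h, Finset.mul_sum]
  exact Finset.sum_congr rfl fun _ _ => Finset.sum_congr rfl fun _ _ => by ring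

/-- Proportional Gram matrices give ‖Σ a_i v_i‖ = √c ‖Σ a_i u_i‖, so Σ a_i u_i ↦ Σ a_i v_i is well
defined and bounded. It extends to the closed span and is composed with the orthogonal projection.
This one principle produces the isonormal process, K_H^*, the multiple integrals and the transfer
map. -/
theorem exists_isExtension [CompleteSpace E] [CompleteSpace F] {u : ι → E} {v : ι → F} {c : ℝ}
    (hc : 0 ≤ c) (h : ∀ i j, inner ℝ (v i) (v j) = c * inner ℝ (u i) (u j)) :
    ∃ T : E →L[ℝ] F, IsExtension u v T := by
  set K := (Submodule.span ℝ (range u)).topologicalClosure with hK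
  have hmem : ∀ a, Finsupp.linearCombination ℝ u a ∈ K := fun a =>
    Submodule.le_topologicalClosure _ (by
      rw [← Finsupp.range_linearCombination]; exact LinearMap.mem_range_self _ a)
  let e : (ι →₀ ℝ) →ₗ[ℝ] K := (Finsupp.linearCombination ℝ u).codRestrict K hmem
  have : CompleteSpace K := (Submodule.isClosed_topologicalClosure _).completeSpace_coe
  have hdense : DenseRange e := by
    rw [DenseRange, dense_iff_closure_eq, Topology.IsEmbedding.subtypeVal.closure_eq_preimage_closure_image]
    have : Subtype.val '' range e = (Submodule.span ℝ (range u) : Set E) := by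
      rw [← range_comp, ← Finsupp.range_linearCombination]
      rfl
    rw [this, ← Submodule.topologicalClosure_coe]
    ext x; simp [← hK]
  have hnorm : ∃ C, ∀ a, ‖Finsupp.linearCombination ℝ v a‖ ≤ C * ‖e a‖ := by
    refine ⟨√c, fun a => ?_⟩
    have h1 := inner_linearCombination h a a
    rw [real_inner_self_eq_norm_sq, real_inner_self_eq_norm_sq] at h1
    refine le_of_eq ?_
    rw [← Real.sqrt_sq (norm_nonneg (Finsupp.linearCombination ℝ v a)), h1, Real.sqrt_mul hc,
      Real.sqrt_sq (norm_nonneg _)]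
    rfl
  let T := (Finsupp.linearCombination ℝ v).extendOfNorm e
  refine ⟨T ∘L K.orthogonalProjectionOnto, fun i => ?_, fun x hx => ?_⟩
  · have hi : u i ∈ K := Submodule.le_topologicalClosure _ (Submodule.subset_span ⟨i, rfl⟩)
    have h2 : K.orthogonalProjectionOnto (u i) = e (Finsupp.single i 1) := by
      rw [show u i = ((⟨u i, hi⟩ : K) : E) from rfl, Submodule.orthogonalProjectionOnto_mem_subspace_eq_self]
      ext; simp [e]
    rw [ContinuousLinearMap.comp_apply, h2, LinearMap.extendOfNorm_eq hdense hnorm]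
    simp
  · have : K.orthogonalProjectionOnto x = 0 := by
      apply Submodule.orthogonalProjectionOnto_apply_of_mem_orthogonal
      rwa [hK, Submodule.orthogonal_closure]
    simp [this]

/-- Bilinearity settles the span, and continuity in one argument at a time settles its closure. Off
the closed span nothing similar can hold, since T kills the orthogonal complement. -/
theorem IsExtension.inner_eq {u : ι → E} {v : ι → F} {c : ℝ} {T : E →L[ℝ] F}
    (hT : IsExtension u v T) (h : ∀ i j, inner ℝ (v i) (v j) = c * inner ℝ (u i) (u j)) {x y : E}
    (hx : x ∈ (Submodule.span ℝ (range u)).topologicalClosure)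
    (hy : y ∈ (Submodule.span ℝ (range u)).topologicalClosure) :
    inner ℝ (T x) (T y) = c * inner ℝ x y := by
  have hT' : ∀ a, T (Finsupp.linearCombination ℝ u a) = Finsupp.linearCombination ℝ v a := by
    intro a
    simp [Finsupp.linearCombination_apply, Finsupp.sum, hT.1]
  have h1 : ∀ x ∈ Submodule.span ℝ (range u), ∀ y ∈ Submodule.span ℝ (range u),
      inner ℝ (T x) (T y) = c * inner ℝ x y := by
    intro x hx y hy
    rw [← Finsupp.range_linearCombination] at hx hy
    obtain ⟨a, rfl⟩ := hx
    obtain ⟨b, rfl⟩ := hy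
    rw [hT', hT', inner_linearCombination h]
  have h2 : ∀ x ∈ Submodule.span ℝ (range u), ∀ y ∈ closure (Submodule.span ℝ (range u) : Set E),
      inner ℝ (T x) (T y) = c * inner ℝ x y := by
    intro x hx
    have hcl : IsClosed {y | inner ℝ (T x) (T y) = c * inner ℝ x y} :=
      isClosed_eq (by fun_prop) (by fun_prop)
    exact hcl.closure_subset_iff.2 (h1 x hx)
  have hcl : IsClosed {x | inner ℝ (T x) (T y) = c * inner ℝ x y} :=
    isClosed_eq (by fun_prop) (by fun_prop)
  exact hcl.closure_subset_iff.2 (fun x hx => h2 x hx y hy) hx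

theorem isExtension_extension {u : ι → E} {v : ι → F} (h : ∃ T : E →L[ℝ] F, IsExtension u v T) :
    IsExtension u v (extension u v) := by
  rw [extension, dif_pos h]
  exact h.choose_spec

end Extension

/-! ### Square-integrable functions and their classes -/

section L2

variable {α : Type*} {mα : MeasurableSpace α} {μ : Measure α}

theorem coeFn_toL2 {f : α → ℝ} (hf : MemLp f 2 μ) : toL2 μ f =ᵐ[μ] f := by
  rw [toL2, dif_pos hf]
  exact hf.coeFn_toLp

theorem inner_toL2 {f g : α → ℝ} (hf : MemLp f 2 μ) (hg : MemLp g 2 μ) :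
    inner ℝ (toL2 μ f) (toL2 μ g) = ∫ x, f x * g x ∂μ := by
  rw [L2.inner_def]
  refine integral_congr_ae ?_
  filter_upwards [coeFn_toL2 hf, coeFn_toL2 hg] with x h1 h2
  rw [h1, h2]
  simp [mul_comm]

theorem toL2_congr {f g : α → ℝ} (h : f =ᵐ[μ] g) : toL2 μ f = toL2 μ g := by
  by_cases hf : MemLp f 2 μ
  · rw [toL2, toL2, dif_pos hf, dif_pos ((memLp_congr_ae h).1 hf)]
    exact MemLp.toLp_congr _ _ h
  · rw [toL2, toL2, dif_neg hf, dif_neg (fun hg => hf ((memLp_congr_ae h).2 hg))]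

end L2

/-! ### Isonormal processes and their multiple integrals -/

section Isonormal

variable {Ω : Type*} {mΩ : MeasurableSpace Ω} {P : Measure Ω}
  {E : Type*} [NormedAddCommGroup E] [InnerProductSpace ℝ E]

/-- `X` is an isonormal process: `X(h)` is centered Gaussian with variance `‖h‖²` for all `h`. -/
def IsIsonormal (X : E →L[ℝ] Lp ℝ 2 P) : Prop :=
  ∀ h, P.map (X h) = gaussianReal 0 (‖h‖₊ ^ 2)

theorem IsIsonormal.charFun_map {X : E →L[ℝ] Lp ℝ 2 P} (hX : IsIsonormal X) (h : E) (t : ℝ) :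
    charFun (P.map (X h)) t = Complex.exp (-(‖h‖ ^ 2 * t ^ 2 / 2)) := by
  rw [hX h, charFun_gaussianReal]
  simp

theorem aemeasurable_Lp (f : Lp ℝ 2 P) : AEMeasurable f P :=
  (Lp.aestronglyMeasurable f).aemeasurable

theorem coeFn_map_smul_add_smul (X : E →L[ℝ] Lp ℝ 2 P) (a b : ℝ) (h k : E) :
    X (a • h + b • k) =ᵐ[P] fun ω => a * X h ω + b * X k ω := by
  rw [map_add, map_smul, map_smul]
  filter_upwards [Lp.coeFn_add (a • X h) (b • X k), Lp.coeFn_smul a (X h),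
    Lp.coeFn_smul b (X k)] with ω h1 h2 h3
  rw [h1, Pi.add_apply, h2, h3]
  simp

/-- By linearity, the joint characteristic function of (X(h), X(k)) at (s,t) is that of X(sh + tk)
at 1. Orthogonality splits ‖sh + tk‖² into s²‖h‖² + t²‖k‖², so it factorizes; joint Gaussianity need
not be assumed. -/
theorem IsIsonormal.indepFun [IsProbabilityMeasure P] {X : E →L[ℝ] Lp ℝ 2 P} (hX : IsIsonormal X)
    {h k : E} (hhk : inner ℝ h k = 0) : IndepFun (X h) (X k) P := by
  rw [indepFun_iff_charFun_prod (aemeasurable_Lp _) (aemeasurable_Lp _)]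
  intro t
  have e : charFun (P.map fun ω => WithLp.toLp 2 (X h ω, X k ω)) t =
      charFun (P.map (X (t.ofLp.1 • h + t.ofLp.2 • k))) 1 := by
    have hm : AEMeasurable (fun ω => WithLp.toLp 2 (X h ω, X k ω)) P := by
      have := aemeasurable_Lp (X h)
      have := aemeasurable_Lp (X k)
      fun_prop
    rw [charFun_apply, charFun_apply_real, integral_map hm (by fun_prop),
      integral_map (aemeasurable_Lp _) (by fun_prop)]
    refine integral_congr_ae ?_
    filter_upwards [coeFn_map_smul_add_smul X t.ofLp.1 t.ofLp.2 h k] with ω h1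
    rw [h1]
    simp [WithLp.prod_inner_apply]
  rw [e, hX.charFun_map, hX.charFun_map, hX.charFun_map, ← Complex.exp_add]
  congr 1
  have : ‖t.ofLp.1 • h + t.ofLp.2 • k‖ ^ 2 = t.ofLp.1 ^ 2 * ‖h‖ ^ 2 + t.ofLp.2 ^ 2 * ‖k‖ ^ 2 := by
    rw [norm_add_sq_real, real_inner_smul_left, real_inner_smul_right, hhk, norm_smul, norm_smul,
      mul_pow, mul_pow, Real.norm_eq_abs, Real.norm_eq_abs, sq_abs, sq_abs]
    ring
  have h2 : ((‖t.ofLp.1 • h + t.ofLp.2 • k‖ : ℂ)) ^ 2 =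
      (t.ofLp.1 : ℂ) ^ 2 * (‖h‖ : ℂ) ^ 2 + (t.ofLp.2 : ℂ) ^ 2 * (‖k‖ : ℂ) ^ 2 := by exact_mod_cast this
  rw [h2]
  push_cast
  ring

theorem IsIsonormal.memLp_eval {X : E →L[ℝ] Lp ℝ 2 P} (hX : IsIsonormal X) (h : E)
    (p : Polynomial ℝ) : MemLp (fun ω => p.eval (X h ω)) 2 P := by
  have := memLp_eval_gaussianReal p 0 (‖h‖₊ ^ 2)
  rw [← hX h] at this
  exact this.comp_of_map (aemeasurable_Lp _)

/-- Write g = ρh + σk with k a unit vector orthogonal to h. Integrating out the independent variable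
X(k) turns H_q(X(g)) into ρ^q H_q(X(h)) by Mehler's formula, and E[H_q(X(h))²] = q!. -/
theorem IsIsonormal.integral_hermite [IsProbabilityMeasure P] {X : E →L[ℝ] Lp ℝ 2 P}
    (hX : IsIsonormal X) (q : ℕ) {h g : E} (hh : ‖h‖ = 1) (hg : ‖g‖ = 1) :
    ∫ ω, hermiteFun q (X h ω) * hermiteFun q (X g ω) ∂P = q.factorial * (inner ℝ h g) ^ q := by
  set ρ : ℝ := inner ℝ h g with hρ
  set k' := g - ρ • h with hk'
  have hk'n : ‖k'‖ ^ 2 = 1 - ρ ^ 2 := by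
    rw [hk', norm_sub_sq_real, real_inner_smul_right, norm_smul, real_inner_comm, ← hρ, hg, hh]
    simp; ring
  have hlaw1 : P.map (X h) = gaussianReal 0 1 := by
    rw [hX h]; congr 1; ext; simp [hh]
  simp_rw [hermiteFun_eq_eval]
  have hfin : ∀ (σ : ℝ), ρ ^ 2 + σ ^ 2 = 1 →
      ∫ x, ∫ w, (hermiteR q).eval x * (hermiteR q).eval (ρ * x + σ * w)
        ∂gaussianReal 0 1 ∂gaussianReal 0 1 = q.factorial * ρ ^ q := by
    intro σ hσ
    simp_rw [integral_const_mul, integral_hermiteR_mehler hσ]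
    rw [← integral_hermiteR_sq, ← integral_mul_const]
    congr 1; ext x; ring
  -- When g is a multiple of h there is no direction k; then ρ² = 1 and the same formula is used
  -- with σ = 0.
  by_cases h0 : k' = 0
  · have hρ1 : ρ ^ 2 + (0 : ℝ) ^ 2 = 1 := by rw [h0, norm_zero] at hk'n; linarith
    rw [← hfin 0 hρ1]
    simp only [zero_mul, add_zero, integral_const, smul_eq_mul, probReal_univ, one_mul]
    have hg' : g = ρ • h := by rw [hk'] at h0; exact sub_eq_zero.1 h0
    rw [← hlaw1, integral_map (aemeasurable_Lp _) (by fun_prop)]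
    refine integral_congr_ae ?_
    rw [hg', map_smul]
    filter_upwards [Lp.coeFn_smul ρ (X h)] with ω h1
    simp [h1]
  · set σ := ‖k'‖ with hσ
    have hσ0 : σ ≠ 0 := norm_ne_zero_iff.2 h0
    set k := σ⁻¹ • k' with hk
    have hkn : ‖k‖ = 1 := by
      rw [hk, norm_smul, norm_inv, ← hσ, Real.norm_of_nonneg (norm_nonneg _), inv_mul_cancel₀ hσ0]
    have hlaw2 : P.map (X k) = gaussianReal 0 1 := by
      rw [hX k]; congr 1; ext; simp [hkn]
    have hgk : g = ρ • h + σ • k := by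
      rw [hk, smul_inv_smul₀ hσ0, hk']; abel
    have hort : inner ℝ h k = 0 := by
      rw [hk, real_inner_smul_right, hk', inner_sub_right, real_inner_smul_right,
        real_inner_self_eq_norm_sq, hh, ← hρ]
      simp
    have hind := (indepFun_iff_map_prod_eq_prod_map_map (aemeasurable_Lp (X h))
      (aemeasurable_Lp (X k))).1 (hX.indepFun hort)
    rw [hlaw1, hlaw2] at hind
    have e : ∫ ω, (hermiteR q).eval (X h ω) * (hermiteR q).eval (X g ω) ∂P =
        ∫ z, (hermiteR q).eval z.1 * (hermiteR q).eval (ρ * z.1 + σ * z.2)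
          ∂((gaussianReal 0 1).prod (gaussianReal 0 1)) := by
      rw [← hind, integral_map ((aemeasurable_Lp _).prodMk (aemeasurable_Lp _)) (by fun_prop)]
      refine integral_congr_ae ?_
      rw [hgk]
      filter_upwards [coeFn_map_smul_add_smul X ρ σ h k] with ω h1
      rw [h1]
    have hint : Integrable (fun z : ℝ × ℝ => (hermiteR q).eval z.1 *
        (hermiteR q).eval (ρ * z.1 + σ * z.2)) ((gaussianReal 0 1).prod (gaussianReal 0 1)) := by
      rw [← hind, integrable_map_measure (by fun_prop)
        ((aemeasurable_Lp _).prodMk (aemeasurable_Lp _))]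
      have := (hX.memLp_eval h (hermiteR q)).integrable_mul (hX.memLp_eval g (hermiteR q))
      refine this.congr ?_
      rw [hgk]
      filter_upwards [coeFn_map_smul_add_smul X ρ σ h k] with ω h1
      simp only [Pi.mul_apply, Function.comp_apply]
      rw [h1]
    rw [e, integral_prod _ hint]
    exact hfin σ (by rw [hk'n]; ring)

variable {T : Type*} [NormedAddCommGroup T] [InnerProductSpace ℝ T]

theorem IsIsonormal.inner_hermite [IsProbabilityMeasure P] {X : E →L[ℝ] Lp ℝ 2 P}
    (hX : IsIsonormal X) {q : ℕ} {pow : E → T}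
    (hpow : ∀ g h, inner ℝ (pow g) (pow h) = (inner ℝ g h) ^ q) (g h : Metric.sphere (0 : E) 1) :
    inner ℝ (toL2 P fun ω => hermiteFun q (X g ω)) (toL2 P fun ω => hermiteFun q (X h ω)) =
      q.factorial * inner ℝ (pow g) (pow h) := by
  have hm : ∀ h, MemLp (fun ω => hermiteFun q (X h ω)) 2 P := fun h => by
    simp_rw [hermiteFun_eq_eval]; exact hX.memLp_eval h _
  rw [inner_toL2 (hm _) (hm _), hX.integral_hermite q (by simp) (by simp), hpow]

theorem IsIsonormal.isMultipleIntegral [IsProbabilityMeasure P] [CompleteSpace T]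
    {X : E →L[ℝ] Lp ℝ 2 P} (hX : IsIsonormal X) {q : ℕ} {pow : E → T}
    (hpow : ∀ g h, inner ℝ (pow g) (pow h) = (inner ℝ g h) ^ q) :
    IsMultipleIntegral q pow X (multipleIntegral q pow X) :=
  isExtension_extension (exists_isExtension (c := q.factorial) (by positivity)
    (hX.inner_hermite hpow))

/-- The squared norm of the difference expands, by the Gram identity alone, to 0. Working from the
Gram identity serves the abstract tensor power and L²([0,1]^q) at once. -/
theorem pow_smul_of_inner {q : ℕ} {pow : E → T}
    (hpow : ∀ g h, inner ℝ (pow g) (pow h) = (inner ℝ g h) ^ q) (r : ℝ) (h : E) :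
    pow (r • h) = r ^ q • pow h := by
  rw [← sub_eq_zero, ← inner_self_eq_zero (𝕜 := ℝ)]
  simp only [inner_sub_left, inner_sub_right, real_inner_smul_left, real_inner_smul_right, hpow]
  ring

/-- The multiple integral is prescribed on unit vectors only; homogeneity recovers all other powers.
The condition q ≠ 0 makes the power of the zero vector vanish. -/
theorem span_pow_sphere {q : ℕ} (hq : q ≠ 0) {pow : E → T}
    (hpow : ∀ g h, inner ℝ (pow g) (pow h) = (inner ℝ g h) ^ q) :
    Submodule.span ℝ (range fun h : Metric.sphere (0 : E) 1 => pow h) =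
      Submodule.span ℝ (range pow) := by
  refine le_antisymm (Submodule.span_mono ?_) (Submodule.span_le.2 ?_)
  · rintro _ ⟨h, rfl⟩; exact ⟨h, rfl⟩
  · rintro _ ⟨h, rfl⟩
    by_cases h0 : h = 0
    · have : pow h = 0 := by
        have := pow_smul_of_inner hpow 0 h
        rw [zero_smul, zero_pow hq, zero_smul] at this
        rw [h0, this]
      rw [this]; exact Submodule.zero_mem _
    · have h1 : h = ‖h‖ • (‖h‖⁻¹ • h) := (smul_inv_smul₀ (norm_ne_zero_iff.2 h0) h).symm
      rw [h1, pow_smul_of_inner hpow]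
      refine Submodule.smul_mem _ _ (Submodule.subset_span ⟨⟨‖h‖⁻¹ • h, ?_⟩, rfl⟩)
      simp [norm_smul, h0]

theorem IsIsonormal.inner_multipleIntegral [IsProbabilityMeasure P] [CompleteSpace T]
    {X : E →L[ℝ] Lp ℝ 2 P} (hX : IsIsonormal X) {q : ℕ} (hq : q ≠ 0) {pow : E → T}
    (hpow : ∀ g h, inner ℝ (pow g) (pow h) = (inner ℝ g h) ^ q) {x y : T}
    (hx : x ∈ (Submodule.span ℝ (range pow)).topologicalClosure)
    (hy : y ∈ (Submodule.span ℝ (range pow)).topologicalClosure) :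
    inner ℝ (multipleIntegral q pow X x) (multipleIntegral q pow X y) =
      q.factorial * inner ℝ x y := by
  rw [← span_pow_sphere hq hpow] at hx hy
  exact (hX.isMultipleIntegral hpow).inner_eq (hX.inner_hermite hpow) hx hy

theorem IsIsonormal.multipleIntegral_pow [IsProbabilityMeasure P] [CompleteSpace T]
    {X : E →L[ℝ] Lp ℝ 2 P} (hX : IsIsonormal X) {q : ℕ} {pow : E → T}
    (hpow : ∀ g h, inner ℝ (pow g) (pow h) = (inner ℝ g h) ^ q) {h : E} {r : ℝ} (hr : 0 < r)
    (hh : ‖h‖ = r) :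
    multipleIntegral q pow X (pow h) =ᵐ[P] fun ω => r ^ q * hermiteFun q (r⁻¹ * X h ω) := by
  have h1 : h = r • (r⁻¹ • h) := (smul_inv_smul₀ hr.ne' h).symm
  have h2 : r⁻¹ • h ∈ Metric.sphere (0 : E) 1 := by
    simp [norm_smul, hh, abs_of_pos hr, hr.ne']
  have h3 := (hX.isMultipleIntegral hpow).1 ⟨_, h2⟩
  have hm : MemLp (fun ω => hermiteFun q (X (r⁻¹ • h) ω)) 2 P := by
    simp_rw [hermiteFun_eq_eval]; exact hX.memLp_eval _ _
  rw [show pow h = r ^ q • pow (r⁻¹ • h) by rw [← pow_smul_of_inner hpow, ← h1], map_smul, h3]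
  filter_upwards [Lp.coeFn_smul (r ^ q) (toL2 P fun ω => hermiteFun q (X (r⁻¹ • h) ω)),
    coeFn_toL2 hm, Lp.coeFn_smul r⁻¹ (X h)] with ω e1 e2 e3
  rw [e1, Pi.smul_apply, e2, map_smul, e3]
  simp

end Isonormal

/-! ### The isonormal process of fractional Brownian motion -/

section FBMIsonormal

theorem coe_mem_span_ind (H : Ioo (0 : ℝ) 1) (φ : StepFun H) :
    (φ : FBMSpace H) ∈ Submodule.span ℝ (range (ind H)) := by
  have h : φ ∈ Submodule.span ℝ (range (stepBasis H)) := by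
    rw [(stepBasis H).span_eq]; trivial
  have h2 := Submodule.mem_map_of_mem (f := (UniformSpace.Completion.toComplL :
    StepFun H →L[ℝ] FBMSpace H).toLinearMap) h
  rw [Submodule.map_span, ← range_comp] at h2
  exact h2

theorem topologicalClosure_span_ind (H : Ioo (0 : ℝ) 1) :
    (Submodule.span ℝ (range (ind H))).topologicalClosure = ⊤ := by
  rw [eq_top_iff]
  intro x _
  refine UniformSpace.Completion.induction_on x ?_ fun φ => ?_
  · exact (Submodule.isClosed_topologicalClosure _)
  · exact Submodule.le_topologicalClosure _ (coe_mem_span_ind H φ)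

variable {Ω : Type*} {mΩ : MeasurableSpace Ω} {P : Measure Ω}

/-- A point of `[0,1]` as a nonnegative real number. -/
def timeNN (t : Icc (0 : ℝ) 1) : ℝ≥0 := ⟨t, t.2.1⟩

@[simp]
theorem coe_timeNN (t : Icc (0 : ℝ) 1) : (timeNN t : ℝ) = t := rfl

theorem integral_norm_le_norm [IsProbabilityMeasure P] (f : Lp ℝ 2 P) : ∫ ω, ‖f ω‖ ∂P ≤ ‖f‖ := by
  rw [integral_norm_eq_lintegral_enorm (Lp.aestronglyMeasurable f), Lp.norm_def,
    ← eLpNorm_one_eq_lintegral_enorm]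
  exact ENNReal.toReal_mono (Lp.eLpNorm_ne_top f)
    (eLpNorm_le_eLpNorm_of_exponent_le (by norm_num) (Lp.aestronglyMeasurable f))

theorem norm_exp_mul_I_sub_le (a b : ℝ) :
    ‖Complex.exp (a * Complex.I) - Complex.exp (b * Complex.I)‖ ≤ |a - b| := by
  have h : Complex.exp (a * Complex.I) - Complex.exp (b * Complex.I) =
      Complex.exp (b * Complex.I) * (Complex.exp (Complex.I * ((a - b : ℝ) : ℂ)) - 1) := by
    rw [mul_sub, ← Complex.exp_add, mul_one]
    congr 2
    push_cast
    ring
  rw [h, norm_mul, Complex.norm_exp_ofReal_mul_I, one_mul]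
  exact Real.norm_exp_I_mul_ofReal_sub_one_le

/-- The function x ↦ e^{itx} is |t|-Lipschitz and the L¹ norm is at most the L² norm, so the map is
|t|-Lipschitz. It lets Gaussian laws pass from step functions to the completion. -/
theorem continuous_charFun_map [IsProbabilityMeasure P] (t : ℝ) :
    Continuous fun f : Lp ℝ 2 P => charFun (P.map f) t := by
  have hint : ∀ f : Lp ℝ 2 P, Integrable (fun ω => Complex.exp ((t * f ω : ℝ) * Complex.I)) P := by
    intro f
    have := aemeasurable_Lp f
    refine Integrable.mono' (integrable_const 1)
      (by have := this.aestronglyMeasurable; fun_prop) (ae_of_all _ fun ω => ?_)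
    rw [Complex.norm_exp_ofReal_mul_I]
  have e : ∀ f : Lp ℝ 2 P, charFun (P.map f) t = ∫ ω, Complex.exp ((t * f ω : ℝ) * Complex.I) ∂P := by
    intro f
    rw [charFun_apply_real, integral_map (aemeasurable_Lp _) (by fun_prop)]
    push_cast
    rfl
  refine (LipschitzWith.of_dist_le_mul (K := ‖t‖₊) fun f g => ?_).continuous
  rw [e, e, dist_eq_norm, dist_eq_norm, ← integral_sub (hint f) (hint g)]
  refine (norm_integral_le_integral_norm _).trans ?_
  refine le_trans ?_ (mul_le_mul_of_nonneg_left (integral_norm_le_norm (f - g)) (norm_nonneg t))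
  rw [← integral_const_mul]
  refine integral_mono_ae ((hint f).sub (hint g)).norm
    (((Lp.memLp (f - g)).integrable (by norm_num)).norm.const_mul _) ?_
  filter_upwards [Lp.coeFn_sub f g] with ω h1
  rw [h1]
  refine (norm_exp_mul_I_sub_le _ _).trans_eq ?_
  rw [← mul_sub, abs_mul]
  rfl

variable {H : Ioo (0 : ℝ) 1} {B : ℝ≥0 → Ω → ℝ}

theorem IsFBM.memLp (hB : IsFBM H B P) (t : ℝ≥0) : MemLp (B t) 2 P :=
  (hB.isGaussianProcess.hasGaussianLaw_eval t).memLp_two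

theorem IsFBM.inner_toL2 (hB : IsFBM H B P) (s t : Icc (0 : ℝ) 1) :
    inner ℝ (toL2 P (B (timeNN s))) (toL2 P (B (timeNN t))) = 1 * inner ℝ (ind H s) (ind H t) := by
  rw [FBM.inner_toL2 (hB.memLp _) (hB.memLp _), hB.covariance, inner_ind, one_mul]
  simp only [coe_timeNN]

theorem IsFBM.isExtension_isonormal (hB : IsFBM H B P) :
    IsExtension (ind H) (fun t => toL2 P (B (timeNN t))) (isonormal H P B) :=
  isExtension_extension (exists_isExtension zero_le_one hB.inner_toL2)

theorem IsFBM.isonormal_ind (hB : IsFBM H B P) (t : Icc (0 : ℝ) 1) :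
    isonormal H P B (ind H t) =ᵐ[P] B (timeNN t) := by
  rw [hB.isExtension_isonormal.1 t]
  exact coeFn_toL2 (hB.memLp _)

theorem IsFBM.inner_isonormal (hB : IsFBM H B P) (x y : FBMSpace H) :
    inner ℝ (isonormal H P B x) (isonormal H P B y) = inner ℝ x y := by
  rw [hB.isExtension_isonormal.inner_eq hB.inner_toL2, one_mul] <;>
  simp [topologicalClosure_span_ind]

theorem coeFn_linearCombination {ι : Type*} (f : ι → Lp ℝ 2 P) (g : ι → Ω → ℝ)
    (h : ∀ i, f i =ᵐ[P] g i) (a : ι →₀ ℝ) :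
    (Finsupp.linearCombination ℝ f a : Lp ℝ 2 P) =ᵐ[P] fun ω => ∑ i ∈ a.support, a i * g i ω := by
  classical
  rw [Finsupp.linearCombination_apply, Finsupp.sum]
  induction a.support using Finset.induction_on with
  | empty =>
    simp only [Finset.sum_empty]
    exact Lp.coeFn_zero ℝ 2 P
  | insert i s hi ih =>
    rw [Finset.sum_insert hi]
    filter_upwards [Lp.coeFn_add (a i • f i) (∑ j ∈ s, a j • f j), ih, h i,
      Lp.coeFn_smul (a i) (f i)] with ω h1 h2 h3 h4
    rw [h1, Pi.add_apply, h2, h4, Finset.sum_insert hi]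
    simp [h3]

variable [IsProbabilityMeasure P]

theorem IsFBM.map_isonormal_of_mem_span (hB : IsFBM H B P) {x : FBMSpace H}
    (hx : x ∈ Submodule.span ℝ (range (ind H))) :
    P.map (isonormal H P B x) = gaussianReal 0 (‖x‖₊ ^ 2) := by
  rw [← Finsupp.range_linearCombination] at hx
  obtain ⟨a, rfl⟩ := hx
  set x := Finsupp.linearCombination ℝ (ind H) a with hx
  have hae : isonormal H P B x =ᵐ[P]
      fun ω => ∑ t ∈ a.support, a t * B (timeNN t) ω := by
    have h1 := coeFn_linearCombination (P := P) (fun t => isonormal H P B (ind H t))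
      (fun t : Icc (0 : ℝ) 1 => B (timeNN t)) hB.isonormal_ind a
    have h2 : isonormal H P B x =
        Finsupp.linearCombination ℝ (fun t => isonormal H P B (ind H t)) a := by
      simp [hx, Finsupp.linearCombination_apply, Finsupp.sum]
    rwa [h2]
  have hG : HasGaussianLaw (isonormal H P B x) P := by
    have h1 := ((hB.isGaussianProcess.comp_right
      timeNN).smul a).hasGaussianLaw_fun_sum (I := a.support)
    exact h1.congr hae.symm
  have hmean : ∫ ω, isonormal H P B x ω ∂P = 0 := by
    rw [integral_congr_ae hae, integral_finsetSum]
    · simp [integral_const_mul, hB.centered]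
    · intro t _
      exact ((hB.memLp _).integrable (by norm_num)).const_mul _
  rw [hG.map_eq_gaussianReal, hmean]
  congr 1
  rw [variance_of_integral_eq_zero hG.aemeasurable hmean]
  have h3 := hB.inner_isonormal x x
  rw [L2.inner_def, real_inner_self_eq_norm_sq] at h3
  have h4 : ∫ ω, isonormal H P B x ω ^ 2 ∂P = ‖x‖ ^ 2 := by
    rw [← h3]
    congr 1; ext ω; simp [sq]
  rw [h4]
  ext
  simp

/-- On step functions B(φ) is a finite linear combination of the B_t, hence centered Gaussian, with
variance given by the isometry. Both characteristic functions depend continuously on the vector, and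
step functions are dense. -/
theorem IsFBM.isIsonormal (hB : IsFBM H B P) : IsIsonormal (isonormal H P B) := by
  intro x
  refine Measure.ext_of_charFun (funext fun t => ?_)
  have hcl : IsClosed {x : FBMSpace H | charFun (P.map (isonormal H P B x)) t =
      charFun (gaussianReal 0 (‖x‖₊ ^ 2)) t} := by
    refine isClosed_eq ((continuous_charFun_map t).comp (isonormal H P B).continuous) ?_
    simp_rw [charFun_gaussianReal]
    push_cast
    fun_prop
  refine UniformSpace.Completion.induction_on (p := fun x => charFun (P.map (isonormal H P B x)) t =
      charFun (gaussianReal 0 (‖x‖₊ ^ 2)) t) x hcl fun φ => ?_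
  rw [hB.map_isonormal_of_mem_span (coe_mem_span_ind H φ)]

end FBMIsonormal

/-! ### Self-similarity -/

section SelfSimilar

variable {Ω : Type*} {mΩ : MeasurableSpace Ω} {P : Measure Ω}

/-- A linear functional of a centered Gaussian vector is centered Gaussian with variance read off
from the covariance matrix, so this matrix determines the characteristic function. -/
theorem identDistrib_of_hasGaussianLaw {ι : Type*} [Fintype ι] {X Y : ι → Ω → ℝ}
    (hX : HasGaussianLaw (fun ω i => X i ω) P) (hY : HasGaussianLaw (fun ω i => Y i ω) P)
    (hX0 : ∀ i, ∫ ω, X i ω ∂P = 0) (hY0 : ∀ i, ∫ ω, Y i ω ∂P = 0)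
    (h : ∀ i j, ∫ ω, X i ω * X j ω ∂P = ∫ ω, Y i ω * Y j ω ∂P) :
    IdentDistrib (fun ω i => X i ω) (fun ω i => Y i ω) P P := by
  classical
  refine ⟨hX.aemeasurable, hY.aemeasurable, ?_⟩
  have := hX.isProbabilityMeasure
  have key : ∀ {Z : ι → Ω → ℝ} (hZ : HasGaussianLaw (fun ω i => Z i ω) P)
      (hZ0 : ∀ i, ∫ ω, Z i ω ∂P = 0) (L : StrongDual ℝ (ι → ℝ)),
      charFunDual (P.map fun ω i => Z i ω) L =
        Complex.exp (-((∑ i, ∑ j, L (Pi.single i 1) * L (Pi.single j 1) *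
          ∫ ω, Z i ω * Z j ω ∂P : ℝ) : ℂ) / 2) := by
    intro Z hZ hZ0 L
    have hL : ∀ ω, L (fun i => Z i ω) = ∑ i, L (Pi.single i 1) * Z i ω := by
      intro ω
      have : (fun i => Z i ω) = ∑ i, Z i ω • (Pi.single i 1 : ι → ℝ) := by
        ext j; simp [Finset.sum_apply, Pi.single_apply]
      rw [this, map_sum]
      simp [mul_comm]
    have hmem : ∀ i, MemLp (Z i) 2 P := fun i => (hZ.eval i).memLp_two
    have hG : HasGaussianLaw (fun ω => L (fun i => Z i ω)) P := hZ.map_fun L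
    have hmean : ∫ ω, L (fun i => Z i ω) ∂P = 0 := by
      simp_rw [hL]
      rw [integral_finsetSum _ fun i _ => ((hmem i).integrable (by norm_num)).const_mul _]
      simp [integral_const_mul, hZ0]
    have hvar : Var[fun ω => L (fun i => Z i ω); P] = ∑ i, ∑ j, L (Pi.single i 1) *
        L (Pi.single j 1) * ∫ ω, Z i ω * Z j ω ∂P := by
      rw [variance_of_integral_eq_zero hG.aemeasurable hmean]
      simp_rw [hL, sq, Finset.sum_mul_sum]
      have hI : ∀ i j, Integrable (fun ω => L (Pi.single i 1) * Z i ω * (L (Pi.single j 1) * Z j ω)) P := by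
        intro i j
        refine (((hmem i).integrable_mul (hmem j)).const_mul
          (L (Pi.single i 1) * L (Pi.single j 1))).congr (ae_of_all _ fun ω => ?_)
        simp only [Pi.mul_apply]; ring
      rw [integral_finsetSum _ fun i _ => integrable_finsetSum _ fun j _ => hI i j]
      refine Finset.sum_congr rfl fun i _ => ?_
      rw [integral_finsetSum _ fun j _ => hI i j]
      refine Finset.sum_congr rfl fun j _ => ?_
      rw [← integral_const_mul]
      congr 1; ext ω; ring
    have h1 := hG.charFun_map_eq (t := 1)
    rw [charFunDual_apply, integral_map hZ.aemeasurable (by fun_prop)]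
    rw [charFun_apply_real, integral_map hG.aemeasurable (by fun_prop)] at h1
    simp only [Complex.ofReal_one, one_mul] at h1
    have h2 : ∀ y : ℝ, inner ℝ (1 : ℝ) y = y := fun y => by simp
    simp_rw [h2] at h1
    rw [h1, hvar, hmean]
    congr 1
    simp [neg_div]
  have i1 : IsProbabilityMeasure (P.map fun ω i => X i ω) := Measure.isProbabilityMeasure_map hX.aemeasurable
  have i2 : IsProbabilityMeasure (P.map fun ω i => Y i ω) := Measure.isProbabilityMeasure_map hY.aemeasurable
  refine Measure.ext_of_charFunDual (funext fun L => ?_)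
  rw [key hX hX0, key hY hY0]
  simp_rw [h]

theorem fbmCov_div (H : ℝ) {c s t : ℝ} (hc : 0 < c) (hs : 0 ≤ s) (ht : 0 ≤ t) :
    fbmCov H (s / c) (t / c) = c ^ (-(2 * H)) * fbmCov H s t := by
  rw [fbmCov, fbmCov, ← sub_div, abs_div, abs_of_pos hc, Real.div_rpow hs hc.le,
    Real.div_rpow ht hc.le, Real.div_rpow (abs_nonneg _) hc.le, Real.rpow_neg hc.le]
  field_simp

theorem IsGaussianProcess.hasGaussianLaw_fintype {ι : Type*} [Fintype ι] {X : ι → Ω → ℝ}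
    (hX : IsGaussianProcess X P) : HasGaussianLaw (fun ω i => X i ω) P := by
  let L : ({i // i ∈ (Finset.univ : Finset ι)} → ℝ) →L[ℝ] (ι → ℝ) :=
    ContinuousLinearMap.pi fun i => ContinuousLinearMap.proj ⟨i, Finset.mem_univ i⟩
  exact (hX.hasGaussianLaw Finset.univ).map_fun L

/-- By the scaling of R, the vectors (n^H B_{i/n}) and (B_i), 0 ≤ i ≤ n, have the same covariance
matrix. S_n and Z_n are the same measurable function F of these vectors. -/
theorem IsFBM.identDistrib_hermiteVariation {H : Ioo (0 : ℝ) 1} {B : ℝ≥0 → Ω → ℝ}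
    (hB : IsFBM H B P) (q : ℕ) {n : ℕ} (hn : 1 ≤ n) :
    IdentDistrib (S H q B n) (hermiteVariation H q B n) P P := by
  have hn0 : (0 : ℝ) < n := by exact_mod_cast hn
  have hid : IdentDistrib (fun ω (i : Fin (n + 1)) => (n : ℝ) ^ (H : ℝ) * B ((i : ℕ) / (n : ℝ≥0)) ω)
      (fun ω (i : Fin (n + 1)) => B ((i : ℕ) : ℝ≥0) ω) P P := by
    refine identDistrib_of_hasGaussianLaw
      (X := fun (i : Fin (n + 1)) ω => (n : ℝ) ^ (H : ℝ) * B ((i : ℕ) / (n : ℝ≥0)) ω)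
      (Y := fun (i : Fin (n + 1)) ω => B ((i : ℕ) : ℝ≥0) ω) ?_ ?_ ?_ ?_ ?_
    · exact IsGaussianProcess.hasGaussianLaw_fintype ((hB.isGaussianProcess.comp_right
        fun i : Fin (n + 1) => ((i : ℕ) / (n : ℝ≥0) : ℝ≥0)).smul fun _ => (n : ℝ) ^ (H : ℝ))
    · exact IsGaussianProcess.hasGaussianLaw_fintype
        (hB.isGaussianProcess.comp_right fun i : Fin (n + 1) => ((i : ℕ) : ℝ≥0))
    · intro i
      rw [integral_const_mul, hB.centered, mul_zero]
    · exact fun i => hB.centered _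
    · intro i j
      have e : ∀ ω, (n : ℝ) ^ (H : ℝ) * B ((i : ℕ) / (n : ℝ≥0)) ω *
          ((n : ℝ) ^ (H : ℝ) * B ((j : ℕ) / (n : ℝ≥0)) ω) =
          (n : ℝ) ^ (2 * (H : ℝ)) * (B ((i : ℕ) / (n : ℝ≥0)) ω * B ((j : ℕ) / (n : ℝ≥0)) ω) := by
        intro ω
        rw [two_mul, Real.rpow_add hn0]; ring
      simp_rw [e]
      rw [integral_const_mul, hB.covariance, hB.covariance]
      push_cast
      rw [fbmCov_div _ hn0 (by positivity) (by positivity), ← mul_assoc, ← Real.rpow_add hn0]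
      simp
  let F : (Fin (n + 1) → ℝ) → ℝ := fun v => (n : ℝ) ^ (q * (1 - (H : ℝ)) - 1) *
    ∑ k : Fin n, hermiteFun q (v k.succ - v k.castSucc)
  have hF : Measurable F := by
    have := measurable_hermiteFun q
    refine Measurable.const_mul (Finset.measurable_fun_sum _ fun k _ => this.comp ?_) _
    fun_prop
  convert hid.comp hF using 1
  · ext ω
    simp only [S, F, Function.comp_apply]
    rw [Finset.sum_range]
    congr 1
    refine Finset.sum_congr rfl fun k _ => ?_
    simp [mul_sub]
  · ext ω
    simp only [hermiteVariation, F, Function.comp_apply]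
    rw [Finset.sum_range, div_eq_inv_mul, ← Real.rpow_neg hn0.le]
    congr 1
    · congr 1; ring
    · refine Finset.sum_congr rfl fun k _ => ?_
      simp

end SelfSimilar

/-! ### The derivative of the kernel `K_H` -/

/-- The constant `c_H`. -/
def constC (H : ℝ) : ℝ :=
  √(H * (2 * H - 1) * Real.Gamma (3 / 2 - H) / (Real.Gamma (2 - 2 * H) * Real.Gamma (H - 1 / 2)))

/-- The explicit form `c_H y^{1/2-H} (u-y)^{H-3/2} u^{H-1/2}` of `∂₁K_H(u,y)`, for `0 < y < u`. -/
def dK (H u y : ℝ) : ℝ :=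
  if 0 < y ∧ y < u then constC H * y ^ (1 / 2 - H) * ((u - y) ^ (H - 3 / 2) * u ^ (H - 1 / 2)) else 0

theorem constC_nonneg (H : ℝ) : 0 ≤ constC H := Real.sqrt_nonneg _

theorem dK_of_lt {H u y : ℝ} (hy : 0 < y) (hu : y < u) :
    dK H u y = constC H * y ^ (1 / 2 - H) * ((u - y) ^ (H - 3 / 2) * u ^ (H - 1 / 2)) :=
  if_pos ⟨hy, hu⟩

theorem dK_of_le {H u y : ℝ} (hu : u ≤ y) : dK H u y = 0 := if_neg fun h => absurd h.2 hu.not_gt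

theorem dK_nonneg (H u y : ℝ) : 0 ≤ dK H u y := by
  rw [dK]
  split_ifs with h
  · have := constC_nonneg H
    have := Real.rpow_nonneg h.1.le (1 / 2 - H)
    have := Real.rpow_nonneg (sub_pos.2 h.2).le (H - 3 / 2)
    have := Real.rpow_nonneg (h.1.trans h.2).le (H - 1 / 2)
    positivity
  · exact le_rfl

theorem measurable_dK (H : ℝ) : Measurable fun p : ℝ × ℝ => dK H p.1 p.2 := by
  unfold dK
  refine Measurable.ite ?_ (by fun_prop) measurable_const
  exact (measurableSet_lt measurable_const measurable_snd).inter
    (measurableSet_lt measurable_snd measurable_fst)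

theorem integrableOn_rpow_mul_rpow {H s t : ℝ} (hH : 1 / 2 < H) (hs : 0 < s) (hst : s ≤ t) :
    IntervalIntegrable (fun u => (u - s) ^ (H - 3 / 2) * u ^ (H - 1 / 2)) volume s t := by
  refine IntervalIntegrable.mul_continuousOn ?_ ?_
  · have := (intervalIntegral.intervalIntegrable_rpow' (a := 0) (b := t - s)
      (r := H - 3 / 2) (by linarith)).comp_sub_right s
    simpa using this
  · intro u hu
    rw [uIcc_of_le hst] at hu
    exact (Real.continuousAt_rpow_const _ _ (Or.inl (hs.trans_le hu.1).ne')).continuousWithinAt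

/-- Above y this is the fundamental theorem of calculus; below y the kernel is locally zero. At u =
y the integrand is singular, as H - 3/2 < 0, so that point is left out. -/
theorem derivK_eq_dK {H u y : ℝ} (hH : 1 / 2 < H) (hy : 0 < y) (huy : u ≠ y) :
    derivK H u y = dK H u y := by
  rcases huy.lt_or_gt with h | h
  · rw [dK_of_le h.le, derivK]
    have : (fun r => kernelK H r y) =ᶠ[𝓝 u] fun _ => 0 := by
      filter_upwards [eventually_lt_nhds h] with r hr
      rw [kernelK, if_neg hr.not_gt]
    rw [this.deriv_eq, deriv_const]
  · rw [dK_of_lt hy h, derivK]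
    have : (fun r => kernelK H r y) =ᶠ[𝓝 u] fun r => constC H * y ^ (1 / 2 - H) *
        ∫ v in y..r, (v - y) ^ (H - 3 / 2) * v ^ (H - 1 / 2) := by
      filter_upwards [eventually_gt_nhds h] with r hr
      rw [kernelK, if_pos hr, constC]
    rw [this.deriv_eq]
    have hcont : ContinuousAt (fun v : ℝ => (v - y) ^ (H - 3 / 2) * v ^ (H - 1 / 2)) u := by
      refine ContinuousAt.mul ?_ ?_
      · exact ContinuousAt.rpow_const (by fun_prop) (Or.inl (sub_pos.2 h).ne')
      · exact ContinuousAt.rpow_const (by fun_prop) (Or.inl (hy.trans h).ne')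
    have hm : StronglyMeasurableAtFilter (fun v : ℝ => (v - y) ^ (H - 3 / 2) * v ^ (H - 1 / 2)) (𝓝 u) :=
      Measurable.stronglyMeasurable (by fun_prop) |>.stronglyMeasurableAtFilter
    have := intervalIntegral.integral_hasDerivAt_right
      (integrableOn_rpow_mul_rpow hH hy h.le) hm hcont
    exact (this.const_mul _).deriv

theorem intervalIntegrable_dK {H y : ℝ} (hH : 1 / 2 < H) (hy : 0 < y) (a b : ℝ) :
    IntervalIntegrable (fun u => dK H u y) volume a b := by
  have h1 : ∀ t, y ≤ t → IntervalIntegrable (fun u => dK H u y) volume y t := by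
    intro t ht
    refine ((integrableOn_rpow_mul_rpow hH hy ht).const_mul
      (constC H * y ^ (1 / 2 - H))).congr_ae ?_
    rw [uIoc_of_le ht]
    filter_upwards [ae_restrict_mem measurableSet_Ioc] with u hu
    rw [dK_of_lt hy hu.1]
  have h2 : ∀ t, t ≤ y → IntervalIntegrable (fun u => dK H u y) volume y t := by
    intro t ht
    refine (intervalIntegrable_const (c := (0 : ℝ))).congr_ae ?_
    rw [uIoc_of_ge ht]
    filter_upwards [ae_restrict_mem measurableSet_Ioc] with u hu
    rw [dK_of_le hu.2]
  have h3 : ∀ t, IntervalIntegrable (fun u => dK H u y) volume y t := fun t =>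
    (le_total y t).elim (h1 t) (h2 t)
  exact (h3 a).symm.trans (h3 b)

theorem kernelK_eq_integral {H s t : ℝ} (hs : 0 < s) (hst : s ≤ t) :
    kernelK H t s = ∫ u in s..t, dK H u s := by
  rcases hst.eq_or_lt with rfl | h
  · simp [kernelK]
  rw [kernelK, if_pos h, ← intervalIntegral.integral_const_mul]
  refine intervalIntegral.integral_congr_ae (ae_of_all _ fun u hu => ?_)
  rw [uIoc_of_le h.le] at hu
  rw [dK_of_lt hs hu.1, constC]

/-- For s ≤ t the difference term contributes -∫_t^1 ∂₁K_H(r,s) dr, which cuts K_H(1,s) = ∫_s^1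
∂₁K_H(r,s) dr down to ∫_s^t. For s > t everything vanishes. -/
theorem starFun_stepInd {H s : ℝ} (hH : 1 / 2 < H) (t : Icc (0 : ℝ) 1) (hs : 0 < s) (hs1 : s ≤ 1) :
    starFun H (stepInd t) s = ∫ u in (0 : ℝ)..t, dK H u s := by
  have hd : ∀ c : ℝ → ℝ, ∫ r in s..1, c r * derivK H r s = ∫ r in s..1, c r * dK H r s := by
    intro c
    refine intervalIntegral.integral_congr_ae (ae_of_all _ fun u hu => ?_)
    rw [uIoc_of_le hs1] at hu
    rw [derivK_eq_dK hH hs hu.1.ne']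
  have hzero : ∀ a b, a ≤ s → b ≤ s → ∫ u in a..b, dK H u s = 0 := by
    intro a b ha hb
    refine intervalIntegral.integral_zero_ae (ae_of_all _ fun u hu => ?_)
    exact dK_of_le (hu.2.trans (max_le ha hb))
  rw [starFun, hd]
  rcases le_or_gt s t with h | h
  · have h1 : stepInd t s = 1 := by simp [stepInd, hs.le, h]
    rw [h1, mul_one, kernelK_eq_integral hs hs1,
      ← intervalIntegral.integral_add_adjacent_intervals (intervalIntegrable_dK hH hs s t)
        (intervalIntegrable_dK hH hs t 1),
      ← intervalIntegral.integral_add_adjacent_intervals (intervalIntegrable_dK hH hs 0 s)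
        (intervalIntegrable_dK hH hs s t), hzero 0 s hs.le le_rfl]
    have e1 : ∫ r in s..t, (stepInd t r - 1) * dK H r s = 0 := by
      refine intervalIntegral.integral_zero_ae (ae_of_all _ fun u hu => ?_)
      rw [uIoc_of_le h] at hu
      simp [stepInd, (hs.trans hu.1).le, hu.2]
    have e2 : EqOn (fun r => (stepInd t r - 1) * dK H r s) (fun r => - dK H r s) (Ioc t 1) := by
      intro u hu
      simp [stepInd, hu.1.not_ge]
    have e3 : ∫ r in (t : ℝ)..1, (stepInd t r - 1) * dK H r s = - ∫ r in (t : ℝ)..1, dK H r s := by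
      rw [← intervalIntegral.integral_neg]
      refine intervalIntegral.integral_congr_ae (ae_of_all _ fun u hu => ?_)
      rw [uIoc_of_le t.2.2] at hu
      exact e2 hu
    have i1 : IntervalIntegrable (fun r => (stepInd t r - 1) * dK H r s) volume s t := by
      refine (intervalIntegrable_const (c := (0 : ℝ))).congr_ae ?_
      rw [uIoc_of_le h]
      filter_upwards [ae_restrict_mem measurableSet_Ioc] with u hu
      simp [stepInd, (hs.trans hu.1).le, hu.2]
    have i2 : IntervalIntegrable (fun r => (stepInd t r - 1) * dK H r s) volume t 1 := by
      refine (intervalIntegrable_dK hH hs t 1).neg.congr_ae ?_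
      rw [uIoc_of_le t.2.2]
      filter_upwards [ae_restrict_mem measurableSet_Ioc] with u hu
      exact (e2 hu).symm
    rw [← intervalIntegral.integral_add_adjacent_intervals i1 i2, e1, e3]
    ring
  · have h1 : stepInd t s = 0 := by simp [stepInd, h.not_ge]
    rw [h1, mul_zero, zero_add, hzero 0 t hs.le h.le]
    refine intervalIntegral.integral_zero_ae (ae_of_all _ fun u hu => ?_)
    rw [uIoc_of_le hs1] at hu
    simp [stepInd, (h.trans hu.1).not_ge]

/-! ### The covariance density -/

theorem lintegral_beta {a b : ℝ} (ha : 0 < a) (hb : 0 < b) :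
    ∫⁻ x in Ioo (0 : ℝ) 1, ENNReal.ofReal (x ^ (a - 1) * (1 - x) ^ (b - 1)) =
      ENNReal.ofReal (beta a b) := by
  have h := lintegral_betaPDF_eq_one ha hb
  rw [lintegral_betaPDF] at h
  have hb0 := beta_pos ha hb
  simp_rw [mul_assoc, ENNReal.ofReal_mul (one_div_pos.2 hb0).le] at h
  rw [lintegral_const_mul _ (by fun_prop)] at h
  rw [← one_mul (∫⁻ x in Ioo (0 : ℝ) 1, _), ← ENNReal.ofReal_one,
    show (1 : ℝ) = beta a b * (1 / beta a b) by field_simp, ENNReal.ofReal_mul hb0.le, mul_assoc]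
  rw [show (1 : ℝ) = beta a b * (1 / beta a b) by field_simp] at h
  simp only [show beta a b * (1 / beta a b) = 1 by field_simp] at h ⊢
  rw [h, mul_one]

/-- The density `H(2H-1)|u-v|^{2H-2}` of the covariance. -/
def covDensity (H u v : ℝ) : ℝ := H * (2 * H - 1) * |u - v| ^ (2 * H - 2)

theorem covDensity_comm (H u v : ℝ) : covDensity H u v = covDensity H v u := by
  rw [covDensity, covDensity, abs_sub_comm]

/-- This is the normalization for which c_H is chosen: the beta integral produced by the product of
two kernels becomes H(2H-1). -/
theorem constC_sq_mul_beta {H : ℝ} (hH : 1 / 2 < H) (hH1 : H < 1) :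
    constC H * constC H * beta (H - 1 / 2) (2 - 2 * H) = H * (2 * H - 1) := by
  have g1 := Real.Gamma_pos_of_pos (show 0 < 3 / 2 - H by linarith)
  have g2 := Real.Gamma_pos_of_pos (show 0 < 2 - 2 * H by linarith)
  have g3 := Real.Gamma_pos_of_pos (show 0 < H - 1 / 2 by linarith)
  have h1 : 0 < 2 * H - 1 := by linarith
  have h2 : 0 < H := by linarith
  rw [constC, Real.mul_self_sqrt (by positivity), beta,
    show H - 1 / 2 + (2 - 2 * H) = 3 / 2 - H by ring]
  generalize Real.Gamma (3 / 2 - H) = a at *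
  generalize Real.Gamma (2 - 2 * H) = b at *
  generalize Real.Gamma (H - 1 / 2) = d at *
  field_simp

/-- Under the Möbius substitution y = uv(1-x)/(v-ux), the quantities y, u - y, v - y and the
Jacobian are all monomials in u, v, x, 1-x, v-u, v-ux. Comparing exponents through logarithms, the
powers of u, v and v-ux cancel and a beta density in x remains. -/
theorem dK_substitution {H u v x : ℝ} (hu : 0 < u) (huv : u < v) (hx : x ∈ Ioo (0 : ℝ) 1) :
    |-(u * v * (v - u)) / (v - u * x) ^ 2| *
        (dK H u (u * v * (1 - x) / (v - u * x)) * dK H v (u * v * (1 - x) / (v - u * x))) =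
      constC H * constC H * (v - u) ^ (2 * H - 2) *
        (x ^ ((H - 1 / 2) - 1) * (1 - x) ^ ((2 - 2 * H) - 1)) := by
  have hv : 0 < v := hu.trans huv
  have hx0 := hx.1
  have hx1 : 0 < 1 - x := sub_pos.2 hx.2
  have hw : 0 < v - u := sub_pos.2 huv
  have hD : 0 < v - u * x := by nlinarith
  have ey : 0 < u * v * (1 - x) / (v - u * x) := by positivity
  have e1 : u - u * v * (1 - x) / (v - u * x) = u * x * (v - u) / (v - u * x) := by
    field_simp; ring
  have e2 : v - u * v * (1 - x) / (v - u * x) = v * (v - u) / (v - u * x) := by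
    field_simp; ring
  have e1p : 0 < u * x * (v - u) / (v - u * x) := by positivity
  have e2p : 0 < v * (v - u) / (v - u * x) := by positivity
  rw [dK_of_lt ey (by rw [← sub_pos, e1]; exact e1p), dK_of_lt ey (by rw [← sub_pos, e2]; exact e2p),
    e1, e2, neg_div, abs_neg, abs_of_pos (by positivity)]
  have ej : 0 < u * v * (v - u) / (v - u * x) ^ 2 := by positivity
  have ly : Real.log (u * v * (1 - x) / (v - u * x)) =
      Real.log u + Real.log v + Real.log (1 - x) - Real.log (v - u * x) := by
    rw [Real.log_div (by positivity) hD.ne', Real.log_mul (by positivity) hx1.ne',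
      Real.log_mul hu.ne' hv.ne']
  have l1 : Real.log (u * x * (v - u) / (v - u * x)) =
      Real.log u + Real.log x + Real.log (v - u) - Real.log (v - u * x) := by
    rw [Real.log_div (by positivity) hD.ne', Real.log_mul (by positivity) hw.ne',
      Real.log_mul hu.ne' hx0.ne']
  have l2 : Real.log (v * (v - u) / (v - u * x)) =
      Real.log v + Real.log (v - u) - Real.log (v - u * x) := by
    rw [Real.log_div (by positivity) hD.ne', Real.log_mul hv.ne' hw.ne']
  have lj : u * v * (v - u) / (v - u * x) ^ 2 = Real.exp
      (Real.log u + Real.log v + Real.log (v - u) - 2 * Real.log (v - u * x)) := by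
    rw [← Real.exp_log ej, Real.log_div (by positivity) (by positivity),
      Real.log_mul (by positivity) hw.ne', Real.log_mul hu.ne' hv.ne', Real.log_pow]
    push_cast; rfl
  rw [lj, Real.rpow_def_of_pos ey, Real.rpow_def_of_pos e1p, Real.rpow_def_of_pos e2p,
    Real.rpow_def_of_pos hu, Real.rpow_def_of_pos hv, Real.rpow_def_of_pos hw,
    Real.rpow_def_of_pos hx0, Real.rpow_def_of_pos hx1, ly, l1, l2]
  have : ∀ a b c d e f g : ℝ, Real.exp a * (constC H * Real.exp b * (Real.exp c * Real.exp d) *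
      (constC H * Real.exp e * (Real.exp f * Real.exp g))) =
      constC H * constC H * Real.exp (a + b + c + d + e + f + g) := by
    intros; simp only [Real.exp_add]; ring
  rw [this, mul_assoc (constC H * constC H), ← Real.exp_add, ← Real.exp_add]
  congr 2
  ring

theorem lintegral_dK_mul_dK_of_lt {H u v : ℝ} (hH : 1 / 2 < H) (hH1 : H < 1) (hu : 0 < u)
    (huv : u < v) :
    ∫⁻ y, ENNReal.ofReal (dK H u y) * ENNReal.ofReal (dK H v y) =
      ENNReal.ofReal (covDensity H u v) := by
  have hv : 0 < v := hu.trans huv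
  have hw : 0 < v - u := sub_pos.2 huv
  have hDpos : ∀ x ∈ Ioo (0 : ℝ) 1, 0 < v - u * x := by
    intro x hx; nlinarith [hx.1, hx.2]
  have himage : (fun x => u * v * (1 - x) / (v - u * x)) '' Ioo (0 : ℝ) 1 = Ioo 0 u := by
    ext y
    constructor
    · rintro ⟨x, hx, rfl⟩
      have hD := hDpos x hx
      have hx1 : 0 < 1 - x := sub_pos.2 hx.2
      refine ⟨by positivity, ?_⟩
      rw [div_lt_iff₀ hD]
      nlinarith [mul_pos (mul_pos hu hx.1) hw]
    · rintro ⟨hy0, hyu⟩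
      have hvy : 0 < v - y := by linarith
      have huy : 0 < u - y := by linarith
      -- The inverse Möbius map.
      refine ⟨v * (u - y) / (u * (v - y)), ⟨by positivity, ?_⟩, ?_⟩
      · rw [div_lt_one (by positivity)]; nlinarith
      · have h1 : v - u * (v * (u - y) / (u * (v - y))) = v * (v - u) / (v - y) := by
          field_simp; ring
        have h2 : 1 - v * (u - y) / (u * (v - y)) = y * (v - u) / (u * (v - y)) := by
          field_simp; ring
        simp only [h1, h2]
        field_simp
  have hinj : InjOn (fun x => u * v * (1 - x) / (v - u * x)) (Ioo (0 : ℝ) 1) := by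
    intro x hx x' hx' h
    have hD := hDpos x hx
    have hD' := hDpos x' hx'
    simp only at h
    rw [div_eq_div_iff hD.ne' hD'.ne'] at h
    have h3 : u * v * (v - u) * (x - x') = 0 := by linear_combination -h
    have h4 : u * v * (v - u) ≠ 0 := by positivity
    have := (mul_eq_zero.1 h3).resolve_left h4
    linarith
  have hderiv : ∀ x ∈ Ioo (0 : ℝ) 1, HasDerivWithinAt (fun x => u * v * (1 - x) / (v - u * x))
      (-(u * v * (v - u)) / (v - u * x) ^ 2) (Ioo (0 : ℝ) 1) x := by
    intro x hx
    have hD := hDpos x hx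
    have h1 : HasDerivAt (fun x => u * v * (1 - x)) (u * v * (-1)) x :=
      ((hasDerivAt_id x).const_sub 1).const_mul (u * v)
    have h2 : HasDerivAt (fun x => v - u * x) (-(u * 1)) x :=
      ((hasDerivAt_id x).const_mul u).const_sub v
    refine ((h1.fun_div h2 hD.ne').congr_deriv ?_).hasDerivWithinAt
    congr 1
    ring
  have hsupp : ∫⁻ y, ENNReal.ofReal (dK H u y) * ENNReal.ofReal (dK H v y) =
      ∫⁻ y in Ioo 0 u, ENNReal.ofReal (dK H u y) * ENNReal.ofReal (dK H v y) := by
    rw [← lintegral_indicator measurableSet_Ioo]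
    congr 1; ext y
    by_cases hy : y ∈ Ioo 0 u
    · rw [indicator_of_mem hy]
    · rw [indicator_of_notMem hy]
      have : dK H u y = 0 := if_neg hy
      simp [this]
  rw [hsupp, ← himage, lintegral_image_eq_lintegral_abs_deriv_mul measurableSet_Ioo hderiv hinj]
  have hcong : ∀ x ∈ Ioo (0 : ℝ) 1, ENNReal.ofReal |-(u * v * (v - u)) / (v - u * x) ^ 2| *
      (ENNReal.ofReal (dK H u (u * v * (1 - x) / (v - u * x))) *
        ENNReal.ofReal (dK H v (u * v * (1 - x) / (v - u * x)))) =
      ENNReal.ofReal (constC H * constC H * (v - u) ^ (2 * H - 2)) *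
        ENNReal.ofReal (x ^ ((H - 1 / 2) - 1) * (1 - x) ^ ((2 - 2 * H) - 1)) := by
    intro x hx
    have := constC_nonneg H
    have := Real.rpow_nonneg hw.le (2 * H - 2)
    rw [← ENNReal.ofReal_mul (dK_nonneg _ _ _), ← ENNReal.ofReal_mul (abs_nonneg _),
      dK_substitution hu huv hx, ENNReal.ofReal_mul (by positivity)]
  rw [setLIntegral_congr_fun measurableSet_Ioo hcong, lintegral_const_mul _ (by fun_prop),
    lintegral_beta (by linarith) (by linarith), ← ENNReal.ofReal_mul, covDensity, abs_sub_comm,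
    abs_of_pos hw, ← constC_sq_mul_beta hH hH1]
  · congr 1; ring
  · have := constC_nonneg H
    have := Real.rpow_nonneg hw.le (2 * H - 2)
    positivity

theorem lintegral_dK_mul_dK {H u v : ℝ} (hH : 1 / 2 < H) (hH1 : H < 1) (hu : u ∈ Ioc (0 : ℝ) 1)
    (hv : v ∈ Ioc (0 : ℝ) 1) (huv : u ≠ v) :
    ∫⁻ y, ENNReal.ofReal (dK H u y) * ENNReal.ofReal (dK H v y) ∂unitMeasure =
      ENNReal.ofReal (covDensity H u v) := by
  have hsupp : ∫⁻ y, ENNReal.ofReal (dK H u y) * ENNReal.ofReal (dK H v y) ∂unitMeasure =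
      ∫⁻ y, ENNReal.ofReal (dK H u y) * ENNReal.ofReal (dK H v y) := by
    rw [unitMeasure, ← lintegral_indicator measurableSet_Icc]
    congr 1; ext y
    by_cases hy : y ∈ Icc (0 : ℝ) 1
    · rw [indicator_of_mem hy]
    · rw [indicator_of_notMem hy]
      have : dK H u y = 0 := if_neg fun h => hy ⟨h.1.le, h.2.le.trans hu.2⟩
      simp [this]
  rw [hsupp]
  rcases huv.lt_or_gt with h | h
  · exact lintegral_dK_mul_dK_of_lt hH hH1 hu.1 h
  · rw [covDensity_comm, ← lintegral_dK_mul_dK_of_lt hH hH1 hv.1 h]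
    simp_rw [mul_comm]

/-! ### The isometry `K_H^*` -/

/-! ### Tonelli's theorem for products of parameter integrals -/

section Tonelli

variable {U V Y : Type*} [MeasurableSpace U] [MeasurableSpace V] [MeasurableSpace Y]

/-- Stated in `ℝ≥0∞` so that no integrability is needed beforehand; square integrability of the
kernels is then read off from the resulting double integrals. It is used both on [0,1] and on the
cube. -/
theorem lintegral_lintegral_mul_lintegral {μ : Measure U} {ν : Measure V} {κ : Measure Y}
    [SFinite μ] [SFinite ν] [SFinite κ] {f : U → Y → ℝ≥0∞} {g : V → Y → ℝ≥0∞}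
    (hf : Measurable (Function.uncurry f)) (hg : Measurable (Function.uncurry g)) :
    ∫⁻ y, (∫⁻ u, f u y ∂μ) * ∫⁻ v, g v y ∂ν ∂κ = ∫⁻ u, ∫⁻ v, ∫⁻ y, f u y * g v y ∂κ ∂ν ∂μ := by
  have h1 : ∀ y, (∫⁻ u, f u y ∂μ) * ∫⁻ v, g v y ∂ν = ∫⁻ u, ∫⁻ v, f u y * g v y ∂ν ∂μ := by
    intro y
    rw [lintegral_lintegral_mul]
    · exact (hf.comp (measurable_id.prodMk measurable_const)).aemeasurable
    · exact (hg.comp (measurable_id.prodMk measurable_const)).aemeasurable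
  have hm : Measurable fun p : (Y × U) × V => f p.1.2 p.1.1 * g p.2 p.1.1 :=
    (hf.comp (f := fun p : (Y × U) × V => (p.1.2, p.1.1)) (by fun_prop)).mul
      (hg.comp (f := fun p : (Y × U) × V => (p.2, p.1.1)) (by fun_prop))
  simp_rw [h1]
  rw [lintegral_lintegral_swap (hm.lintegral_prod_right').aemeasurable]
  congr 1; ext u
  refine lintegral_lintegral_swap (Measurable.aemeasurable ?_)
  exact hm.comp (f := fun p : Y × V => ((p.1, u), p.2)) (by fun_prop)

variable {μ : Measure Y} {f g : Y → ℝ≥0∞}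

theorem memLp_two_toReal (hf : AEMeasurable f μ) (h : ∫⁻ y, f y * f y ∂μ ≠ ∞) :
    MemLp (fun y => (f y).toReal) 2 μ := by
  rw [memLp_two_iff_integrable_sq hf.ennreal_toReal.aestronglyMeasurable]
  refine (integrable_toReal_of_lintegral_ne_top (hf.mul hf) h).congr (ae_of_all _ fun y => ?_)
  simp [sq]

theorem ae_lt_top_of_lintegral_mul_self (hf : AEMeasurable f μ) (h : ∫⁻ y, f y * f y ∂μ ≠ ∞) :
    ∀ᵐ y ∂μ, f y < ∞ := by
  filter_upwards [ae_lt_top' (hf.mul hf) h] with y hy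
  by_contra hc
  have : f y = ∞ := by simpa using hc
  simp [this] at hy

theorem integral_toReal_mul_toReal (hf : AEMeasurable f μ) (hg : AEMeasurable g μ)
    (hff : ∫⁻ y, f y * f y ∂μ ≠ ∞) (hgg : ∫⁻ y, g y * g y ∂μ ≠ ∞) :
    ∫ y, (f y).toReal * (g y).toReal ∂μ = (∫⁻ y, f y * g y ∂μ).toReal := by
  simp_rw [← ENNReal.toReal_mul]
  refine integral_toReal (hf.mul hg) ?_
  filter_upwards [ae_lt_top_of_lintegral_mul_self hf hff, ae_lt_top_of_lintegral_mul_self hg hgg]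
    with y h1 h2 using ENNReal.mul_lt_top h1 h2

end Tonelli

instance : IsFiniteMeasure unitMeasure := by unfold unitMeasure; infer_instance

/-- `∫_A ∂₁K_H(u,y) du`. -/
def kernelInt (H : ℝ) (A : Set ℝ) (y : ℝ) : ℝ≥0∞ := ∫⁻ u in A, ENNReal.ofReal (dK H u y)

theorem measurable_ofReal_dK (H : ℝ) :
    Measurable (Function.uncurry fun u y => ENNReal.ofReal (dK H u y)) :=
  (measurable_dK H).ennreal_ofReal

theorem measurable_kernelInt (H : ℝ) (A : Set ℝ) : Measurable (kernelInt H A) :=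
  (measurable_ofReal_dK H).lintegral_prod_left'

theorem measurable_covDensity (H : ℝ) : Measurable fun p : ℝ × ℝ => covDensity H p.1 p.2 := by
  unfold covDensity; fun_prop

theorem covDensity_nonneg {H : ℝ} (hH : 1 / 2 < H) (u v : ℝ) : 0 ≤ covDensity H u v := by
  have : 0 < 2 * H - 1 := by linarith
  have : 0 < H := by linarith
  rw [covDensity]
  positivity

theorem lintegral_kernelInt_mul {H : ℝ} (hH : 1 / 2 < H) (hH1 : H < 1) {A A' : Set ℝ}
    (hA : MeasurableSet A) (hA' : MeasurableSet A') (hA1 : A ⊆ Ioc 0 1) (hA1' : A' ⊆ Ioc 0 1) :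
    ∫⁻ y, kernelInt H A y * kernelInt H A' y ∂unitMeasure =
      ∫⁻ u in A, ∫⁻ v in A', ENNReal.ofReal (covDensity H u v) := by
  simp only [kernelInt]
  rw [lintegral_lintegral_mul_lintegral (measurable_ofReal_dK H) (measurable_ofReal_dK H)]
  refine setLIntegral_congr_fun hA fun u hu => ?_
  refine lintegral_congr_ae ?_
  -- The density formula is available only off the diagonal; the single point v = u is null.
  filter_upwards [ae_restrict_mem hA', ae_restrict_of_ae (Measure.ae_ne volume u)] with v hv hne
  exact lintegral_dK_mul_dK hH hH1 (hA1 hu) (hA1' hv) hne.symm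

theorem lintegral_rpow_Ioc {r b : ℝ} (hr : -1 < r) (hb : 0 ≤ b) :
    ∫⁻ x in Ioc 0 b, ENNReal.ofReal (x ^ r) = ENNReal.ofReal (b ^ (r + 1) / (r + 1)) := by
  have hi := intervalIntegral.intervalIntegrable_rpow' (a := 0) (b := b) hr
  rw [intervalIntegrable_iff_integrableOn_Ioc_of_le hb] at hi
  rw [← ofReal_integral_eq_lintegral_ofReal hi, ← intervalIntegral.integral_of_le hb,
    integral_rpow (Or.inl hr), Real.zero_rpow (by linarith), sub_zero]
  filter_upwards [ae_restrict_mem measurableSet_Ioc] with x hx using Real.rpow_nonneg hx.1.le _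

theorem lintegral_abs_sub_rpow {r u t : ℝ} (hr : -1 < r) (hu : 0 ≤ u) (hut : u ≤ t) :
    ∫⁻ v in Ioc 0 t, ENNReal.ofReal (|u - v| ^ r) =
      ENNReal.ofReal (u ^ (r + 1) / (r + 1)) + ENNReal.ofReal ((t - u) ^ (r + 1) / (r + 1)) := by
  have h1 : ∫⁻ v in Ioc 0 u, ENNReal.ofReal (|u - v| ^ r) = ENNReal.ofReal (u ^ (r + 1) / (r + 1)) := by
    rw [← lintegral_rpow_Ioc hr hu]
    have hmp := (Measure.measurePreserving_sub_left (volume : Measure ℝ) u)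
    have h2 := hmp.setLIntegral_comp_preimage (s := Ico 0 u) measurableSet_Ico
      (f := fun x => ENNReal.ofReal (|x| ^ r)) (by fun_prop)
    rw [show (fun v => u - v) ⁻¹' Ico 0 u = Ioc 0 u by ext v; simp [and_comm]] at h2
    rw [h2, setLIntegral_congr Ico_ae_eq_Ioc]
    refine setLIntegral_congr_fun measurableSet_Ioc fun x hx => ?_
    simp only [abs_of_pos hx.1]
  have h3 : ∫⁻ v in Ioc u t, ENNReal.ofReal (|u - v| ^ r) =
      ENNReal.ofReal ((t - u) ^ (r + 1) / (r + 1)) := by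
    rw [← lintegral_rpow_Ioc hr (sub_nonneg.2 hut)]
    have hmp := (measurePreserving_sub_right (volume : Measure ℝ) u)
    have h2 := hmp.setLIntegral_comp_preimage (s := Ioc 0 (t - u)) measurableSet_Ioc
      (f := fun x => ENNReal.ofReal (|x| ^ r)) (by fun_prop)
    rw [show (fun v => v - u) ⁻¹' Ioc 0 (t - u) = Ioc u t by ext v; simp] at h2
    simp_rw [abs_sub_comm u]
    rw [h2]
    refine setLIntegral_congr_fun measurableSet_Ioc fun x hx => ?_
    simp only [abs_of_pos hx.1]
  rw [← Ioc_union_Ioc_eq_Ioc hu hut, lintegral_union measurableSet_Ioc, h1, h3]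
  exact Ioc_disjoint_Ioc_of_le le_rfl

/-- Splitting the inner integral at v = u gives H u^{2H-1} + H (t-u)^{2H-1}, whose integral over
(0,s] is R(s,t). The condition H > 1/2 makes the diagonal singularity integrable. -/
theorem lintegral_covDensity_of_le {H s t : ℝ} (hH : 1 / 2 < H) (hs : 0 ≤ s) (hst : s ≤ t) :
    ∫⁻ u in Ioc 0 s, ∫⁻ v in Ioc 0 t, ENNReal.ofReal (covDensity H u v) =
      ENNReal.ofReal (fbmCov H s t) := by
  have hH0 : 0 < H := by linarith
  have h21 : 0 < 2 * H - 1 := by linarith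
  have hin : ∀ u ∈ Ioc 0 s, ∫⁻ v in Ioc 0 t, ENNReal.ofReal (covDensity H u v) =
      ENNReal.ofReal (H * u ^ (2 * H - 1) + H * (t - u) ^ (2 * H - 1)) := by
    intro u hu
    have htu : 0 ≤ t - u := by linarith [hu.2]
    simp only [covDensity]
    simp_rw [ENNReal.ofReal_mul (show 0 ≤ H * (2 * H - 1) by positivity)]
    rw [lintegral_const_mul _ (by fun_prop),
      lintegral_abs_sub_rpow (by linarith) hu.1.le (hu.2.trans hst)]
    have e : 2 * H - 2 + 1 = 2 * H - 1 := by ring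
    have p1 := Real.rpow_nonneg hu.1.le (2 * H - 1)
    have p2 := Real.rpow_nonneg htu (2 * H - 1)
    rw [e, ← ENNReal.ofReal_add (by positivity) (by positivity), ← ENNReal.ofReal_mul (by positivity)]
    congr 1
    generalize u ^ (2 * H - 1) = a
    generalize (t - u) ^ (2 * H - 1) = b
    rw [← add_div, mul_div_assoc', mul_assoc, mul_div_assoc, mul_div_cancel_left₀ _ h21.ne']
    ring
  rw [setLIntegral_congr_fun measurableSet_Ioc hin]
  have i1 : IntervalIntegrable (fun u : ℝ => u ^ (2 * H - 1)) volume 0 s :=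
    intervalIntegral.intervalIntegrable_rpow' (by linarith)
  have i2 : IntervalIntegrable (fun u : ℝ => (t - u) ^ (2 * H - 1)) volume 0 s := by
    have := (intervalIntegral.intervalIntegrable_rpow' (a := t) (b := t - s)
      (r := 2 * H - 1) (by linarith)).comp_sub_left t
    simpa using this
  have hi := (i1.const_mul H).add (i2.const_mul H)
  have hi' := hi
  rw [intervalIntegrable_iff_integrableOn_Ioc_of_le hs] at hi'
  rw [← ofReal_integral_eq_lintegral_ofReal hi']
  · congr 1
    rw [← intervalIntegral.integral_of_le hs,
      intervalIntegral.integral_add (i1.const_mul H) (i2.const_mul H),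
      intervalIntegral.integral_const_mul, intervalIntegral.integral_const_mul,
      intervalIntegral.integral_comp_sub_left (fun x : ℝ => x ^ (2 * H - 1)) t,
      integral_rpow (Or.inl (by linarith)), integral_rpow (Or.inl (by linarith)), fbmCov,
      abs_of_nonneg (sub_nonneg.2 hst)]
    have e : 2 * H - 1 + 1 = 2 * H := by ring
    rw [e, Real.zero_rpow (by linarith), sub_zero t]
    field_simp
    ring
  · filter_upwards [ae_restrict_mem measurableSet_Ioc] with u hu
    have htu : 0 ≤ t - u := by linarith [hu.2]
    have p1 := Real.rpow_nonneg hu.1.le (2 * H - 1)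
    have p2 := Real.rpow_nonneg htu (2 * H - 1)
    simp only [Pi.zero_apply]
    positivity

theorem lintegral_covDensity {H s t : ℝ} (hH : 1 / 2 < H) (hs : 0 ≤ s) (ht : 0 ≤ t) :
    ∫⁻ u in Ioc 0 s, ∫⁻ v in Ioc 0 t, ENNReal.ofReal (covDensity H u v) =
      ENNReal.ofReal (fbmCov H s t) := by
  rcases le_total s t with h | h
  · exact lintegral_covDensity_of_le hH hs h
  · rw [lintegral_lintegral_swap ((measurable_covDensity H).ennreal_ofReal).aemeasurable, fbmCov_comm,
      ← lintegral_covDensity_of_le hH ht h]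
    simp_rw [covDensity_comm H]

theorem fbmCov_nonneg {H s t : ℝ} (hH : 1 / 2 < H) (hs : 0 ≤ s) (ht : 0 ≤ t) :
    0 ≤ fbmCov H s t := by
  wlog hst : s ≤ t generalizing s t
  · rw [fbmCov_comm]; exact this ht hs (not_le.1 hst).le
  have := Real.rpow_nonneg hs (2 * H)
  have : (t - s) ^ (2 * H) ≤ t ^ (2 * H) :=
    Real.rpow_le_rpow (sub_nonneg.2 hst) (by linarith) (by linarith)
  rw [fbmCov, abs_of_nonneg (sub_nonneg.2 hst)]
  linarith

theorem Ioc_zero_subset (t : Icc (0 : ℝ) 1) : Ioc 0 (t : ℝ) ⊆ Ioc 0 1 :=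
  Ioc_subset_Ioc_right t.2.2

theorem lintegral_kernelInt_Ioc {H : ℝ} (hH : 1 / 2 < H) (hH1 : H < 1) (s t : Icc (0 : ℝ) 1) :
    ∫⁻ y, kernelInt H (Ioc 0 s) y * kernelInt H (Ioc 0 t) y ∂unitMeasure =
      ENNReal.ofReal (fbmCov H s t) := by
  rw [lintegral_kernelInt_mul hH hH1 measurableSet_Ioc measurableSet_Ioc (Ioc_zero_subset s)
    (Ioc_zero_subset t), lintegral_covDensity hH s.2.1 t.2.1]

theorem kernelInt_Ioc_toReal {H y : ℝ} {a b : ℝ} (hab : a ≤ b) :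
    (kernelInt H (Ioc a b) y).toReal = ∫ u in a..b, dK H u y := by
  rw [intervalIntegral.integral_of_le hab, kernelInt, integral_eq_lintegral_of_nonneg_ae]
  · exact ae_of_all _ fun u => dK_nonneg _ _ _
  · exact ((measurable_dK H).comp (f := fun u => (u, y)) (by fun_prop)).aestronglyMeasurable

theorem ae_unitMeasure_mem : ∀ᵐ y ∂unitMeasure, y ∈ Ioc (0 : ℝ) 1 := by
  rw [unitMeasure, ← Measure.restrict_congr_set Ioc_ae_eq_Icc]
  exact ae_restrict_mem measurableSet_Ioc

theorem starFun_ae_eq {H : ℝ} (hH : 1 / 2 < H) (t : Icc (0 : ℝ) 1) :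
    starFun H (stepInd t) =ᵐ[unitMeasure] fun y => (kernelInt H (Ioc 0 t) y).toReal := by
  filter_upwards [ae_unitMeasure_mem] with y hy
  rw [starFun_stepInd hH t hy.1 hy.2, kernelInt_Ioc_toReal t.2.1]

theorem memLp_kernelInt_Ioc {H : ℝ} (hH : 1 / 2 < H) (hH1 : H < 1) (t : Icc (0 : ℝ) 1) :
    MemLp (fun y => (kernelInt H (Ioc 0 t) y).toReal) 2 unitMeasure :=
  memLp_two_toReal (measurable_kernelInt _ _).aemeasurable (by
    rw [lintegral_kernelInt_Ioc hH hH1]; exact ENNReal.ofReal_ne_top)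

section Kstar

variable {H : Ioo (0 : ℝ) 1}

theorem inner_toL2_starFun (hH : 1 / 2 < (H : ℝ)) (s t : Icc (0 : ℝ) 1) :
    inner ℝ (toL2 unitMeasure (starFun H (stepInd s))) (toL2 unitMeasure (starFun H (stepInd t))) =
      1 * inner ℝ (ind H s) (ind H t) := by
  have hm := measurable_kernelInt (H : ℝ)
  have hf : ∀ t : Icc (0 : ℝ) 1, ∫⁻ y, kernelInt H (Ioc 0 t) y * kernelInt H (Ioc 0 t) y ∂unitMeasure ≠ ∞ := by
    intro t
    rw [lintegral_kernelInt_Ioc hH H.2.2]; exact ENNReal.ofReal_ne_top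
  rw [toL2_congr (starFun_ae_eq hH s), toL2_congr (starFun_ae_eq hH t),
    inner_toL2 (memLp_kernelInt_Ioc hH H.2.2 s) (memLp_kernelInt_Ioc hH H.2.2 t),
    integral_toReal_mul_toReal (hm _).aemeasurable (hm _).aemeasurable (hf s) (hf t),
    lintegral_kernelInt_Ioc hH H.2.2, ENNReal.toReal_ofReal (fbmCov_nonneg hH s.2.1 t.2.1), inner_ind,
    one_mul]

theorem isExtension_Kstar (hH : 1 / 2 < (H : ℝ)) :
    IsExtension (ind H) (fun t => toL2 unitMeasure (starFun H (stepInd t))) (Kstar H) :=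
  isExtension_extension (exists_isExtension zero_le_one (inner_toL2_starFun hH))

theorem inner_Kstar (hH : 1 / 2 < (H : ℝ)) (x y : FBMSpace H) :
    inner ℝ (Kstar H x) (Kstar H y) = inner ℝ x y := by
  rw [(isExtension_Kstar hH).inner_eq (inner_toL2_starFun hH), one_mul] <;>
  simp [topologicalClosure_span_ind]

theorem Kstar_ind (hH : 1 / 2 < (H : ℝ)) (t : Icc (0 : ℝ) 1) :
    Kstar H (ind H t) =ᵐ[unitMeasure] fun y => (kernelInt H (Ioc 0 t) y).toReal := by
  rw [(isExtension_Kstar hH).1 t]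
  simp only
  rw [toL2_congr (starFun_ae_eq hH t)]
  exact coeFn_toL2 (memLp_kernelInt_Ioc hH H.2.2 t)

end Kstar

/-! ### Surjectivity of `K_H^*` -/

/-- Lebesgue differentiation: almost everywhere f is the derivative of its primitive, which is
constantly zero. -/
theorem ae_eq_zero_of_intervalIntegral_eq_zero {f : ℝ → ℝ} (hf : Integrable f unitMeasure)
    (h : ∀ t ∈ Icc (0 : ℝ) 1, ∫ u in (0 : ℝ)..t, f u = 0) : f =ᵐ[unitMeasure] 0 := by
  have hf' : IntervalIntegrable f volume 0 1 := by
    rw [intervalIntegrable_iff_integrableOn_Ioc_of_le zero_le_one]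
    exact (show IntegrableOn f (Icc 0 1) volume from hf).mono_set Ioc_subset_Icc_self
  have h1 : ∀ᵐ x ∂unitMeasure, x ∈ Ioo (0 : ℝ) 1 := by
    rw [unitMeasure, ← Measure.restrict_congr_set Ioo_ae_eq_Icc]
    exact ae_restrict_mem measurableSet_Ioo
  filter_upwards [h1, ae_restrict_of_ae hf'.ae_hasDerivAt_integral] with x hx hd
  have h2 := hd (by rw [uIcc_of_le zero_le_one]; exact Ioo_subset_Icc_self hx) 0
    (by rw [uIcc_of_le zero_le_one]; simp)
  have h3 : (fun x => ∫ u in (0 : ℝ)..x, f u) =ᶠ[𝓝 x] fun _ => 0 := by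
    filter_upwards [Ioo_mem_nhds hx.1 hx.2] with t ht using h t (Ioo_subset_Icc_self ht)
  exact h2.unique ((hasDerivAt_const x (0 : ℝ)).congr_of_eventuallyEq h3)

/-- Fubini for a weight ψ whose integral against ∂₁K_H is m: since the kernel is nonnegative,
integrability on the product reduces to that of m·g, a product of two L² functions. It is applied to
indicators and to the Abel weight. -/
theorem integrable_and_integral_kernel_mul {H : ℝ} {ψ m : ℝ → ℝ}
    (hψm : Measurable ψ) (hψ : ∀ u, 0 ≤ ψ u) (hm : MemLp m 2 unitMeasure) (hm0 : ∀ y, 0 ≤ m y)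
    (h : ∀ᵐ y ∂unitMeasure, ∫⁻ u in Ioc 0 1, ENNReal.ofReal (ψ u * dK H u y) = ENNReal.ofReal (m y))
    (g : Lp ℝ 2 unitMeasure) :
    Integrable (fun p : ℝ × ℝ => ψ p.2 * dK H p.2 p.1 * g p.1)
        (unitMeasure.prod (volume.restrict (Ioc 0 1))) ∧
      ∫ y, m y * g y ∂unitMeasure =
        ∫ u in Ioc 0 1, ψ u * ∫ y, dK H u y * g y ∂unitMeasure := by
  have hdm : Measurable fun p : ℝ × ℝ => ψ p.2 * dK H p.2 p.1 :=
    (hψm.comp measurable_snd).mul ((measurable_dK H).comp measurable_swap)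
  have hpos : ∀ u y, 0 ≤ ψ u * dK H u y := fun u y => mul_nonneg (hψ u) (dK_nonneg _ _ _)
  have hdu : ∀ y, Measurable fun u => ψ u * dK H u y := fun y =>
    hdm.comp (f := fun u => (y, u)) (by fun_prop)
  have hint : ∀ᵐ y ∂unitMeasure, Integrable (fun u => ψ u * dK H u y) (volume.restrict (Ioc 0 1)) ∧
      ∫ u in Ioc 0 1, ψ u * dK H u y = m y := by
    filter_upwards [h] with y hy
    constructor
    · refine ⟨(hdu y).aestronglyMeasurable, ?_⟩
      rw [hasFiniteIntegral_iff_ofReal (ae_of_all _ fun u => hpos u y), hy]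
      exact ENNReal.ofReal_lt_top
    · rw [integral_eq_lintegral_of_nonneg_ae (ae_of_all _ fun u => hpos u y)
        (hdu y).aestronglyMeasurable, hy, ENNReal.toReal_ofReal (hm0 y)]
  have hI : Integrable (fun p : ℝ × ℝ => ψ p.2 * dK H p.2 p.1 * g p.1)
      (unitMeasure.prod (volume.restrict (Ioc 0 1))) := by
    have hae : AEStronglyMeasurable (fun p : ℝ × ℝ => ψ p.2 * dK H p.2 p.1 * g p.1)
        (unitMeasure.prod (volume.restrict (Ioc 0 1))) :=
      hdm.aestronglyMeasurable.mul (Lp.aestronglyMeasurable g).comp_fst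
    rw [integrable_prod_iff hae]
    constructor
    · filter_upwards [hint] with y hy
      exact hy.1.mul_const _
    · refine (hm.integrable_mul (Lp.memLp g)).norm.congr ?_
      filter_upwards [hint] with y hy
      simp only [norm_mul, Pi.mul_apply]
      rw [integral_mul_const, ← hy.2]
      congr 1
      rw [Real.norm_of_nonneg (integral_nonneg fun u => hpos u y)]
      congr 1; ext u
      rw [← norm_mul, Real.norm_of_nonneg (hpos u y)]
  refine ⟨hI, ?_⟩
  have e1 : ∫ y, m y * g y ∂unitMeasure =
      ∫ y, (∫ u in Ioc 0 1, ψ u * dK H u y * g y) ∂unitMeasure := by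
    refine integral_congr_ae ?_
    filter_upwards [hint] with y hy
    rw [integral_mul_const, hy.2]
  rw [e1, integral_integral_swap hI]
  congr 1; ext u
  simp_rw [mul_assoc, integral_const_mul]

/-- The exponents add up to -1, so rescaling (y,t) to (0,1) leaves no power of t - y. This
independence of y is what inverts the Abel transform. -/
theorem lintegral_beta_Ioo {a y t : ℝ} (ha : 0 < a) (ha1 : a < 1) (hyt : y < t) :
    ∫⁻ u in Ioo y t, ENNReal.ofReal ((u - y) ^ (a - 1) * (t - u) ^ (-a)) =
      ENNReal.ofReal (beta a (1 - a)) := by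
  have hw : 0 < t - y := sub_pos.2 hyt
  have himage : (fun x => y + (t - y) * x) '' Ioo (0 : ℝ) 1 = Ioo y t := by
    ext z
    constructor
    · rintro ⟨x, hx, rfl⟩
      constructor <;> nlinarith [hx.1, hx.2]
    · rintro ⟨h1, h2⟩
      refine ⟨(z - y) / (t - y), ⟨div_pos (by linarith) hw, by rw [div_lt_one hw]; linarith⟩, ?_⟩
      field_simp; ring
  rw [← himage, lintegral_image_eq_lintegral_abs_deriv_mul (f' := fun _ => t - y) measurableSet_Ioo,
    ← lintegral_beta ha (sub_pos.2 ha1)]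
  · refine setLIntegral_congr_fun measurableSet_Ioo fun x hx => ?_
    rw [← ENNReal.ofReal_mul (abs_nonneg _), abs_of_pos hw]
    congr 1
    have hx1 : 0 < 1 - x := sub_pos.2 hx.2
    rw [show y + (t - y) * x - y = (t - y) * x by ring,
      show t - (y + (t - y) * x) = (t - y) * (1 - x) by ring, Real.mul_rpow hw.le hx.1.le,
      Real.mul_rpow hw.le hx1.le, show 1 - a - 1 = -a by ring]
    have : (t - y) * ((t - y) ^ (a - 1) * (t - y) ^ (-a)) = 1 := by
      rw [← Real.rpow_add hw, show a - 1 + -a = -1 by ring, Real.rpow_neg_one, mul_inv_cancel₀ hw.ne']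
    linear_combination (x ^ (a - 1) * (1 - x) ^ (-a)) * this
  · intro x _
    have := ((hasDerivAt_id x).const_mul (t - y)).const_add y
    simpa using this.hasDerivWithinAt
  · intro x _ x' _ h
    simpa [hw.ne'] using h

/-- The weight inverting the Abel transform in `∂₁K_H`. -/
def abelWeight (H t u : ℝ) : ℝ :=
  (Ioo 0 t).indicator (fun u => (t - u) ^ (1 / 2 - H) * u ^ (1 / 2 - H)) u

/-- The factor u^{1/2-H} of the weight cancels u^{H-1/2} in the kernel. What remains in u is a beta
integral over (y,t) that does not depend on y, so only y^{1/2-H} survives. -/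
theorem lintegral_abelWeight_mul_dK {H t y : ℝ} (hH : 1 / 2 < H) (hH1 : H < 1) (ht : t ≤ 1)
    (hy : 0 < y) :
    ∫⁻ u in Ioc 0 1, ENNReal.ofReal (abelWeight H t u * dK H u y) =
      ENNReal.ofReal ((Ioo 0 t).indicator
        (fun y => constC H * beta (H - 1 / 2) (3 / 2 - H) * y ^ (1 / 2 - H)) y) := by
  have hc := constC_nonneg H
  by_cases hyt : y < t
  · have e1 : ∀ u, (Ioc (0 : ℝ) 1).indicator (fun u => ENNReal.ofReal (abelWeight H t u * dK H u y)) u =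
        (Ioo y t).indicator (fun u => ENNReal.ofReal (constC H * y ^ (1 / 2 - H)) *
          ENNReal.ofReal ((u - y) ^ ((H - 1 / 2) - 1) * (t - u) ^ (-(H - 1 / 2)))) u := by
      intro u
      by_cases hu : u ∈ Ioo y t
      · have hu0 : 0 < u := hy.trans hu.1
        have hu1 : u ∈ Ioc (0 : ℝ) 1 := ⟨hu0, hu.2.le.trans ht⟩
        have hu2 : u ∈ Ioo 0 t := ⟨hu0, hu.2⟩
        have := Real.rpow_nonneg hy.le (1 / 2 - H)
        rw [indicator_of_mem hu, indicator_of_mem hu1, abelWeight, indicator_of_mem hu2,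
          dK_of_lt hy hu.1, ← ENNReal.ofReal_mul (by positivity)]
        congr 1
        have e : u ^ (1 / 2 - H) * u ^ (H - 1 / 2) = 1 := by
          rw [← Real.rpow_add hu0]; simp
        rw [show (H - 1 / 2) - 1 = H - 3 / 2 by ring, show -(H - 1 / 2) = 1 / 2 - H by ring]
        linear_combination (constC H * y ^ (1 / 2 - H) * (u - y) ^ (H - 3 / 2) * (t - u) ^ (1 / 2 - H)) * e
      · rw [indicator_of_notMem hu]
        by_cases hu1 : u ∈ Ioc (0 : ℝ) 1
        · rw [indicator_of_mem hu1]
          by_cases huy : u ≤ y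
          · simp [dK_of_le huy]
          · have : u ∉ Ioo 0 t := fun h => hu ⟨not_le.1 huy, h.2⟩
            simp [abelWeight, indicator_of_notMem this]
        · rw [indicator_of_notMem hu1]
    rw [← lintegral_indicator measurableSet_Ioc]
    simp_rw [e1]
    rw [lintegral_indicator measurableSet_Ioo, lintegral_const_mul _ (by fun_prop),
      lintegral_beta_Ioo (by linarith) (by linarith) hyt, ← ENNReal.ofReal_mul]
    · rw [indicator_of_mem (show y ∈ Ioo 0 t from ⟨hy, hyt⟩), show 1 - (H - 1 / 2) = 3 / 2 - H by ring]
      congr 1; ring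
    · have := Real.rpow_nonneg hy.le (1 / 2 - H)
      positivity
  · rw [indicator_of_notMem (fun h => hyt h.2), ENNReal.ofReal_zero]
    refine (setLIntegral_congr_fun measurableSet_Ioc (g := fun _ => 0) fun u _ => ?_).trans (by simp)
    simp only
    by_cases hu : u ∈ Ioo 0 t
    · rw [dK_of_le (hu.2.le.trans (not_lt.1 hyt))]; simp
    · simp [abelWeight, indicator_of_notMem hu]

theorem memLp_rpow_unitMeasure {H : ℝ} (hH1 : H < 1) :
    MemLp (fun y : ℝ => y ^ (1 / 2 - H)) 2 unitMeasure := by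
  rw [memLp_two_iff_integrable_sq (by fun_prop)]
  have h : IntegrableOn (fun y : ℝ => y ^ (1 - 2 * H)) (Ioc 0 1) :=
    (intervalIntegrable_iff_integrableOn_Ioc_of_le zero_le_one).1
      (intervalIntegral.intervalIntegrable_rpow' (by linarith))
  rw [unitMeasure, ← Measure.restrict_congr_set Ioc_ae_eq_Icc]
  refine h.congr_fun (fun y hy => ?_) measurableSet_Ioc
  simp only
  rw [← Real.rpow_natCast, ← Real.rpow_mul hy.1.le]
  congr 1; push_cast; ring

theorem constC_pos {H : ℝ} (hH : 1 / 2 < H) (hH1 : H < 1) : 0 < constC H := by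
  refine lt_of_le_of_ne (constC_nonneg H) fun h => ?_
  have h1 := constC_sq_mul_beta hH hH1
  rw [← h] at h1
  have : 0 < H * (2 * H - 1) := mul_pos (by linarith) (by linarith)
  linarith

theorem intervalIntegral_eq_integral_indicator {t : ℝ} (ht : t ∈ Icc (0 : ℝ) 1) (f : ℝ → ℝ) :
    ∫ u in (0 : ℝ)..t, f u = ∫ u in Ioc 0 1, (Ioc 0 t).indicator 1 u * f u := by
  rw [intervalIntegral.integral_of_le ht.1]
  have e : (fun u => (Ioc 0 t).indicator 1 u * f u) = (Ioc 0 t).indicator f := by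
    ext u; by_cases hu : u ∈ Ioc 0 t <;> simp [hu]
  rw [e, setIntegral_indicator measurableSet_Ioc, inter_eq_self_of_subset_right
    (Ioc_subset_Ioc_right ht.2)]

theorem integral_unitMeasure_indicator {t : ℝ} (ht : t ∈ Icc (0 : ℝ) 1) (f : ℝ → ℝ) :
    ∫ y, (Icc 0 t).indicator f y ∂unitMeasure = ∫ y in (0 : ℝ)..t, f y := by
  rw [unitMeasure, setIntegral_indicator measurableSet_Icc,
    inter_eq_self_of_subset_right (Icc_subset_Icc_right ht.2), integral_Icc_eq_integral_Ioc,
    intervalIntegral.integral_of_le ht.1]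

/-- Injectivity of the adjoint of K_H^*. Put G(u) = ∫ ∂₁K_H(u,y) g(y) dy. The hypothesis says that
the primitive of G vanishes, so G = 0 almost everywhere. Integrating G against the Abel weight gives
∫_0^t y^{1/2-H} g(y) dy = 0 for all t, whence g = 0. -/
theorem eq_zero_of_integral_kernelInt_eq_zero {H : ℝ} (hH : 1 / 2 < H) (hH1 : H < 1)
    (g : Lp ℝ 2 unitMeasure)
    (h : ∀ t : Icc (0 : ℝ) 1, ∫ y, (kernelInt H (Ioc 0 t) y).toReal * g y ∂unitMeasure = 0) :
    g = 0 := by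
  have hψ0 : ∀ t u : ℝ, 0 ≤ (Ioc 0 t).indicator (1 : ℝ → ℝ) u := fun t u =>
    indicator_nonneg (fun _ _ => zero_le_one) _
  have hψm : ∀ t : ℝ, Measurable ((Ioc 0 t).indicator (1 : ℝ → ℝ)) := fun t =>
    measurable_one.indicator measurableSet_Ioc
  have hk : ∀ t : Icc (0 : ℝ) 1, ∀ᵐ y ∂unitMeasure,
      ∫⁻ u in Ioc 0 1, ENNReal.ofReal ((Ioc 0 (t : ℝ)).indicator 1 u * dK H u y) =
        ENNReal.ofReal (kernelInt H (Ioc 0 t) y).toReal := by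
    intro t
    have hff : ∫⁻ y, kernelInt H (Ioc 0 t) y * kernelInt H (Ioc 0 t) y ∂unitMeasure ≠ ∞ := by
      rw [lintegral_kernelInt_Ioc hH hH1]; exact ENNReal.ofReal_ne_top
    filter_upwards [ae_lt_top_of_lintegral_mul_self (measurable_kernelInt _ _).aemeasurable hff]
      with y hy
    rw [ENNReal.ofReal_toReal hy.ne, kernelInt]
    have e : (fun u => ENNReal.ofReal ((Ioc 0 (t : ℝ)).indicator 1 u * dK H u y)) =
        (Ioc 0 (t : ℝ)).indicator fun u => ENNReal.ofReal (dK H u y) := by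
      ext u; by_cases hu : u ∈ Ioc 0 (t : ℝ) <;> simp [hu]
    rw [e, setLIntegral_indicator measurableSet_Ioc, inter_eq_self_of_subset_left (Ioc_zero_subset t)]
  have key := fun t : Icc (0 : ℝ) 1 => integrable_and_integral_kernel_mul (hψm t) (hψ0 t)
    (memLp_kernelInt_Ioc hH hH1 t) (fun y => ENNReal.toReal_nonneg) (hk t) g
  set G : ℝ → ℝ := fun u => ∫ y, dK H u y * g y ∂unitMeasure with hG
  have hGint : Integrable G unitMeasure := by
    rw [unitMeasure, ← Measure.restrict_congr_set Ioc_ae_eq_Icc]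
    have h1 := (key ⟨1, by simp⟩).1.integral_prod_right
    refine h1.congr ?_
    filter_upwards [ae_restrict_mem measurableSet_Ioc] with u hu
    simp [hG, hu.1, hu.2]
  have hG0 : G =ᵐ[unitMeasure] 0 := by
    refine ae_eq_zero_of_intervalIntegral_eq_zero hGint fun t ht => ?_
    rw [intervalIntegral_eq_integral_indicator ht, ← (key ⟨t, ht⟩).2]
    exact h ⟨t, ht⟩
  have hB : 0 < beta (H - 1 / 2) (3 / 2 - H) := beta_pos (by linarith) (by linarith)
  have hc := constC_pos hH hH1
  have hgr : Integrable (fun y : ℝ => y ^ (1 / 2 - H) * g y) unitMeasure :=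
    (memLp_rpow_unitMeasure hH1).integrable_mul (Lp.memLp g)
  have hg0 : (fun y : ℝ => y ^ (1 / 2 - H) * g y) =ᵐ[unitMeasure] 0 := by
    refine ae_eq_zero_of_intervalIntegral_eq_zero hgr fun t ht => ?_
    set m : ℝ → ℝ := (Ioo 0 t).indicator
      (fun y => constC H * beta (H - 1 / 2) (3 / 2 - H) * y ^ (1 / 2 - H)) with hm
    have h1 := (integrable_and_integral_kernel_mul (H := H) (ψ := abelWeight H t) (m := m) ?_ ?_ ?_ ?_ ?_ g).2
    · have h2 : ∫ u in Ioc 0 1, abelWeight H t u * G u = 0 := by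
        rw [unitMeasure, ← Measure.restrict_congr_set Ioc_ae_eq_Icc] at hG0
        refine integral_eq_zero_of_ae ?_
        filter_upwards [hG0] with u hu
        rw [hu]; simp
      rw [h2] at h1
      have e : (fun y => m y * g y) =ᵐ[unitMeasure] (Icc 0 t).indicator (fun y => constC H *
          beta (H - 1 / 2) (3 / 2 - H) * (y ^ (1 / 2 - H) * g y)) := by
        filter_upwards [ae_unitMeasure_mem, ae_restrict_of_ae (Measure.ae_ne volume t)] with y hy0 hyt
        by_cases hy : y ∈ Ioo 0 t
        · simp only [hm, indicator_of_mem hy, indicator_of_mem (Ioo_subset_Icc_self hy)]; ring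
        · have hy' : y ∉ Icc 0 t := fun h => hy ⟨hy0.1, lt_of_le_of_ne h.2 hyt⟩
          simp [hm, indicator_of_notMem hy, indicator_of_notMem hy']
      rw [integral_congr_ae e, integral_unitMeasure_indicator ht,
        intervalIntegral.integral_const_mul] at h1
      exact (mul_eq_zero.1 h1).resolve_left (by positivity)
    · exact Measurable.indicator (by fun_prop) measurableSet_Ioo
    · intro u
      refine indicator_nonneg (fun u hu => ?_) u
      exact mul_nonneg (Real.rpow_nonneg (sub_pos.2 hu.2).le _) (Real.rpow_nonneg hu.1.le _)
    · exact ((memLp_rpow_unitMeasure hH1).const_mul _).indicator measurableSet_Ioo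
    · intro y
      refine indicator_nonneg (fun y hy => ?_) y
      have := Real.rpow_nonneg hy.1.le (1 / 2 - H)
      positivity
    · filter_upwards [ae_unitMeasure_mem] with y hy
      exact lintegral_abelWeight_mul_dK hH hH1 ht.2 hy.1
  rw [Lp.eq_zero_iff_ae_eq_zero]
  filter_upwards [hg0, ae_unitMeasure_mem] with y hy hy1
  exact (mul_eq_zero.1 hy).resolve_left (Real.rpow_pos_of_pos hy1.1 _).ne'

section

variable {H : Ioo (0 : ℝ) 1}

/-- `K_H^*` as a linear isometry. -/
def KstarIsometry (hH : 1 / 2 < (H : ℝ)) : FBMSpace H →ₗᵢ[ℝ] Lp ℝ 2 unitMeasure :=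
  (Kstar H).toLinearMap.isometryOfInner (inner_Kstar hH)

/-- The range of an isometry on a complete space is closed, so it is enough that its orthogonal
complement is trivial. -/
theorem Kstar_surjective (hH : 1 / 2 < (H : ℝ)) : Function.Surjective (Kstar H) := by
  have hcl : IsClosed ((Kstar H).range : Set (Lp ℝ 2 unitMeasure)) :=
    (KstarIsometry hH).isometry.isClosedEmbedding.isClosed_range
  have : CompleteSpace (Kstar H).range := hcl.completeSpace_coe
  refine LinearMap.range_eq_top.1 ?_
  refine (Submodule.orthogonal_eq_bot_iff (K := (Kstar H).range)).1 ?_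
  rw [Submodule.eq_bot_iff]
  intro g hg
  refine eq_zero_of_integral_kernelInt_eq_zero hH H.2.2 g fun t => ?_
  have h1 := (Submodule.mem_orthogonal _ _).1 hg (Kstar H (ind H t)) ⟨_, rfl⟩
  rw [L2.inner_def] at h1
  refine Eq.trans (integral_congr_ae ?_) h1
  filter_upwards [Kstar_ind hH t] with y hy
  rw [hy]
  simp [mul_comm]

/-- `K_H^*` as an isometric isomorphism. -/
def KstarEquiv (hH : 1 / 2 < (H : ℝ)) : FBMSpace H ≃ₗᵢ[ℝ] Lp ℝ 2 unitMeasure :=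
  LinearIsometryEquiv.ofSurjective (KstarIsometry hH) (Kstar_surjective hH)

theorem KstarEquiv_apply (hH : 1 / 2 < (H : ℝ)) (x : FBMSpace H) : KstarEquiv hH x = Kstar H x := rfl

theorem memLp_stepInd (t : Icc (0 : ℝ) 1) : MemLp (stepInd t) 2 unitMeasure :=
  (memLp_const (1 : ℝ)).indicator measurableSet_Icc

theorem orthogonal_span_stepInd :
    (Submodule.span ℝ (range fun t => toL2 unitMeasure (stepInd t)))ᗮ = ⊥ := by
  rw [Submodule.eq_bot_iff]
  intro g hg
  rw [Lp.eq_zero_iff_ae_eq_zero]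
  refine ae_eq_zero_of_intervalIntegral_eq_zero ((Lp.memLp g).integrable (by norm_num)) fun t ht => ?_
  have h1 := (Submodule.mem_orthogonal _ _).1 hg _ (Submodule.subset_span ⟨⟨t, ht⟩, rfl⟩)
  rw [L2.inner_def] at h1
  refine Eq.trans ?_ h1
  have e : (fun y => inner ℝ (toL2 unitMeasure (stepInd ⟨t, ht⟩) y) (g y)) =ᵐ[unitMeasure]
      (Icc 0 t).indicator g := by
    filter_upwards [coeFn_toL2 (memLp_stepInd ⟨t, ht⟩)] with y hy
    rw [hy]
    by_cases hy1 : y ∈ Icc 0 t <;> simp [stepInd, hy1]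
  rw [integral_congr_ae e, integral_unitMeasure_indicator ht]

variable {Ω : Type*} {mΩ : MeasurableSpace Ω} {P : Measure Ω} {B : ℝ≥0 → Ω → ℝ}

theorem wienerIntegral_eq (hH : 1 / 2 < (H : ℝ)) :
    wienerIntegral H P B =
      isonormal H P B ∘L ((KstarEquiv hH).symm : Lp ℝ 2 unitMeasure →L[ℝ] FBMSpace H) := by
  have hext : IsExtension (fun t : Icc (0 : ℝ) 1 => toL2 unitMeasure (stepInd t)) (wiener H P B)
      (isonormal H P B ∘L ((KstarEquiv hH).symm : Lp ℝ 2 unitMeasure →L[ℝ] FBMSpace H)) := by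
    refine ⟨fun t => ?_, fun x hx => ?_⟩
    · rw [wiener, ContinuousLinearMap.comp_apply]
      congr 1
      apply (KstarEquiv hH).injective
      -- `Function.invFun` yields a true preimage only because K_H^* is onto.
      rw [KstarEquiv_apply _ (Function.invFun _ _), Function.rightInverse_invFun (Kstar_surjective hH)]
      exact (KstarEquiv hH).apply_symm_apply _
    -- The indicators are total in L²([0,1]), so the condition on the complement is empty.
    · rw [orthogonal_span_stepInd] at hx
      rw [(Submodule.mem_bot ℝ).1 hx, map_zero]
  exact (isExtension_extension ⟨_, hext⟩).unique hext

theorem wienerIntegral_Kstar (hH : 1 / 2 < (H : ℝ)) (h : FBMSpace H) :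
    wienerIntegral H P B (Kstar H h) = isonormal H P B h := by
  rw [wienerIntegral_eq hH, ContinuousLinearMap.comp_apply]
  congr 1
  exact (KstarEquiv hH).symm_apply_apply h

theorem IsFBM.isIsonormal_wienerIntegral [IsProbabilityMeasure P] (hH : 1 / 2 < (H : ℝ))
    (hB : IsFBM H B P) : IsIsonormal (wienerIntegral H P B) := by
  intro g
  obtain ⟨h, rfl⟩ := Kstar_surjective hH g
  rw [wienerIntegral_Kstar hH, hB.isIsonormal]
  congr 2
  ext
  exact ((KstarIsometry hH).norm_map h).symm

end

/-! ### Tensor powers in `L²([0,1]^q)` -/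

theorem lintegral_pi_prod {E : Type*} [MeasurableSpace E] {μ : Measure E} [SigmaFinite μ] {n : ℕ}
    {f : Fin n → E → ℝ≥0∞} (hf : ∀ i, Measurable (f i)) :
    ∫⁻ x, ∏ i, f i (x i) ∂(Measure.pi fun _ : Fin n => μ) = ∏ i, ∫⁻ x, f i x ∂μ := by
  induction n with
  | zero => simp
  | succ n ih =>
    rw [← ((measurePreserving_piFinSuccAbove (fun _ : Fin (n + 1) => μ) 0).symm).lintegral_comp_emb
      (MeasurableEquiv.measurableEmbedding _)]
    simp_rw [MeasurableEquiv.piFinSuccAbove_symm_apply, Fin.insertNthEquiv,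
      Fin.prod_univ_succ, Fin.insertNth_zero, Equiv.coe_fn_mk, Fin.cons_succ, Fin.cons_zero]
    rw [← ih fun i => hf i.succ]
    refine lintegral_prod_mul (μ := μ) (ν := Measure.pi fun _ : Fin n => μ) (f := f 0)
      (g := fun y : Fin n → E => ∏ i, f i.succ (y i))
      (hf 0).aemeasurable (Finset.aemeasurable_fun_prod _ fun i _ => ?_)
    exact ((hf i.succ).comp (measurable_pi_apply i)).aemeasurable

theorem lintegral_pi_pow {E : Type*} [MeasurableSpace E] {μ : Measure E} [SigmaFinite μ] {n : ℕ}
    {f : E → ℝ≥0∞} (hf : Measurable f) :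
    ∫⁻ x, ∏ i, f (x i) ∂(Measure.pi fun _ : Fin n => μ) = (∫⁻ x, f x ∂μ) ^ n := by
  rw [lintegral_pi_prod fun _ => hf]
  simp

instance (q : ℕ) : IsFiniteMeasure (cubeMeasure q) := by unfold cubeMeasure; infer_instance

theorem ae_cubeMeasure {p : ℝ → Prop} (h : ∀ᵐ x ∂unitMeasure, p x) (q : ℕ) :
    ∀ᵐ y ∂cubeMeasure q, ∀ i, p (y i) := by
  rw [ae_all_iff]
  intro i
  exact (Measure.quasiMeasurePreserving_eval (fun _ : Fin q => unitMeasure) i).ae h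

theorem memLp_prod_coeFn (q : ℕ) (h : Lp ℝ 2 unitMeasure) :
    MemLp (fun y : Fin q → ℝ => ∏ i, h (y i)) 2 (cubeMeasure q) := by
  have hm : AEStronglyMeasurable (fun y : Fin q → ℝ => ∏ i, h (y i)) (cubeMeasure q) := by
    refine Finset.aestronglyMeasurable_fun_prod _ fun i _ => ?_
    exact (Lp.aestronglyMeasurable h).comp_quasiMeasurePreserving
      (Measure.quasiMeasurePreserving_eval (fun _ : Fin q => unitMeasure) i)
  rw [memLp_two_iff_integrable_sq hm]
  have h2 : Integrable (fun y => h y ^ 2) unitMeasure := (Lp.memLp h).integrable_sq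
  have := Integrable.fintype_prod (ι := Fin q) (f := fun _ y => h y ^ 2) (μ := fun _ => unitMeasure)
    fun _ => h2
  refine this.congr (ae_of_all _ fun y => ?_)
  simp only [Finset.prod_pow]

theorem inner_powL2 (q : ℕ) (g h : Lp ℝ 2 unitMeasure) :
    inner ℝ (powL2 q g) (powL2 q h) = (inner ℝ g h) ^ q := by
  rw [powL2, powL2, inner_toL2 (memLp_prod_coeFn q g) (memLp_prod_coeFn q h)]
  simp_rw [← Finset.prod_mul_distrib]
  rw [cubeMeasure, integral_fintype_prod_eq_pow (fun y => g y * h y), Fintype.card_fin, L2.inner_def]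
  congr 2; ext y
  simp [mul_comm]

/-! ### The kernels on the cube -/

/-- `∏_i ∫_A ∂₁K_H(u,y_i) du`. -/
def powInt (H : ℝ) (q : ℕ) (A : Set ℝ) (y : Fin q → ℝ) : ℝ≥0∞ := ∏ i, kernelInt H A (y i)

/-- `∫_A ∏_i ∂₁K_H(u,y_i) du`. -/
def diagInt (H : ℝ) (q : ℕ) (A : Set ℝ) (y : Fin q → ℝ) : ℝ≥0∞ :=
  ∫⁻ u in A, ∏ i, ENNReal.ofReal (dK H u (y i))

theorem measurable_powInt (H : ℝ) (q : ℕ) (A : Set ℝ) : Measurable (powInt H q A) :=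
  Finset.measurable_fun_prod _ fun i _ => (measurable_kernelInt H A).comp (measurable_pi_apply i)

theorem measurable_prod_dK (H : ℝ) (q : ℕ) :
    Measurable (Function.uncurry fun (u : ℝ) (y : Fin q → ℝ) => ∏ i, ENNReal.ofReal (dK H u (y i))) := by
  refine Finset.measurable_fun_prod _ fun i _ => ?_
  exact (measurable_ofReal_dK H).comp (f := fun p : ℝ × (Fin q → ℝ) => (p.1, p.2 i)) (by fun_prop)

theorem measurable_diagInt (H : ℝ) (q : ℕ) (A : Set ℝ) : Measurable (diagInt H q A) :=
  (measurable_prod_dK H q).lintegral_prod_left'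

section

variable {H : ℝ} {q : ℕ} {A A' : Set ℝ}

theorem measurable_dK_left (H u : ℝ) : Measurable fun y => ENNReal.ofReal (dK H u y) :=
  (measurable_ofReal_dK H).comp (f := fun y => (u, y)) (by fun_prop)

theorem lintegral_powInt_mul_powInt (hH : 1 / 2 < H) (hH1 : H < 1)
    (hA : MeasurableSet A) (hA' : MeasurableSet A') (hA1 : A ⊆ Ioc 0 1) (hA1' : A' ⊆ Ioc 0 1) :
    ∫⁻ y, powInt H q A y * powInt H q A' y ∂cubeMeasure q =
      (∫⁻ u in A, ∫⁻ v in A', ENNReal.ofReal (covDensity H u v)) ^ q := by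
  simp only [powInt, ← Finset.prod_mul_distrib]
  rw [cubeMeasure, lintegral_pi_pow (f := fun y => kernelInt H A y * kernelInt H A' y)
    ((measurable_kernelInt H A).mul (measurable_kernelInt H A')),
    lintegral_kernelInt_mul hH hH1 hA hA' hA1 hA1']

theorem lintegral_diagInt_mul_diagInt (hH : 1 / 2 < H) (hH1 : H < 1)
    (hA : MeasurableSet A) (hA' : MeasurableSet A') (hA1 : A ⊆ Ioc 0 1) (hA1' : A' ⊆ Ioc 0 1) :
    ∫⁻ y, diagInt H q A y * diagInt H q A' y ∂cubeMeasure q =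
      ∫⁻ u in A, ∫⁻ v in A', ENNReal.ofReal (covDensity H u v) ^ q := by
  simp only [diagInt]
  rw [lintegral_lintegral_mul_lintegral (measurable_prod_dK H q) (measurable_prod_dK H q)]
  refine setLIntegral_congr_fun hA fun u hu => ?_
  refine lintegral_congr_ae ?_
  filter_upwards [ae_restrict_mem hA', ae_restrict_of_ae (Measure.ae_ne volume u)] with v hv hne
  simp only [← Finset.prod_mul_distrib]
  rw [cubeMeasure, lintegral_pi_pow
    (f := fun y => ENNReal.ofReal (dK H u y) * ENNReal.ofReal (dK H v y))
    ((measurable_dK_left H u).mul (measurable_dK_left H v)),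
    lintegral_dK_mul_dK hH hH1 (hA1 hu) (hA1' hv) hne.symm]

/-- For fixed v the integrand is a product over the coordinates, each contributing ∫_A ρ(u,v) du
with ρ the covariance density; hence the power sits between the two integrals. -/
theorem lintegral_powInt_mul_diagInt (hH : 1 / 2 < H) (hH1 : H < 1)
    (hA : MeasurableSet A) (hA' : MeasurableSet A') (hA1 : A ⊆ Ioc 0 1) (hA1' : A' ⊆ Ioc 0 1) :
    ∫⁻ y, powInt H q A y * diagInt H q A' y ∂cubeMeasure q =
      ∫⁻ v in A', (∫⁻ u in A, ENNReal.ofReal (covDensity H u v)) ^ q := by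
  have h1 : ∀ y : Fin q → ℝ, powInt H q A y * diagInt H q A' y =
      ∫⁻ v in A', ∏ i, (kernelInt H A (y i) * ENNReal.ofReal (dK H v (y i))) := by
    intro y
    simp only [Finset.prod_mul_distrib]
    rw [lintegral_const_mul]
    · rfl
    · exact (measurable_prod_dK H q).comp (f := fun u => (u, y)) (by fun_prop)
  simp_rw [h1]
  have hm : Measurable (Function.uncurry fun (y : Fin q → ℝ) (v : ℝ) =>
      ∏ i, (kernelInt H A (y i) * ENNReal.ofReal (dK H v (y i)))) := by
    refine Finset.measurable_fun_prod _ fun i _ => Measurable.mul ?_ ?_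
    · exact (measurable_kernelInt H A).comp (f := fun p : (Fin q → ℝ) × ℝ => p.1 i) (by fun_prop)
    · exact (measurable_ofReal_dK H).comp (f := fun p : (Fin q → ℝ) × ℝ => (p.2, p.1 i)) (by fun_prop)
  rw [lintegral_lintegral_swap hm.aemeasurable]
  refine setLIntegral_congr_fun hA' fun v hv => ?_
  rw [cubeMeasure, lintegral_pi_pow (f := fun y => kernelInt H A y * ENNReal.ofReal (dK H v y))
    ((measurable_kernelInt H A).mul (measurable_dK_left H v))]
  congr 1
  have h2 : ∀ y, kernelInt H A y * ENNReal.ofReal (dK H v y) =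
      ∫⁻ u in A, ENNReal.ofReal (dK H u y) * ENNReal.ofReal (dK H v y) := by
    intro y
    rw [lintegral_mul_const]
    · rfl
    · exact (measurable_ofReal_dK H).comp (f := fun u => (u, y)) (by fun_prop)
  simp_rw [h2]
  have hm2 : Measurable (Function.uncurry fun (y u : ℝ) =>
      ENNReal.ofReal (dK H u y) * ENNReal.ofReal (dK H v y)) :=
    ((measurable_ofReal_dK H).comp measurable_swap).mul ((measurable_dK_left H v).comp measurable_fst)
  rw [lintegral_lintegral_swap hm2.aemeasurable]
  refine lintegral_congr_ae ?_
  filter_upwards [ae_restrict_mem hA, ae_restrict_of_ae (Measure.ae_ne volume v)] with u hu hne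
  exact lintegral_dK_mul_dK hH hH1 (hA1 hu) (hA1' hv) hne

/-! ### Bounds for the covariance integrals -/

theorem lintegral_abs_sub_rpow_le {r a b u : ℝ} (hr : -1 < r) (hu : u ∈ Ioc a b) :
    ∫⁻ v in Ioc a b, ENNReal.ofReal (|u - v| ^ r) ≤
      ENNReal.ofReal (2 * (b - a) ^ (r + 1) / (r + 1)) := by
  have hr1 : 0 < r + 1 := by linarith
  have hmp := measurePreserving_sub_right (volume : Measure ℝ) a
  have h2 := hmp.setLIntegral_comp_preimage (s := Ioc 0 (b - a)) measurableSet_Ioc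
    (f := fun x => ENNReal.ofReal (|(u - a) - x| ^ r)) (by fun_prop)
  rw [show (fun v => v - a) ⁻¹' Ioc 0 (b - a) = Ioc a b by ext v; simp] at h2
  simp only [sub_sub_sub_cancel_right] at h2
  rw [h2, lintegral_abs_sub_rpow hr (sub_nonneg.2 hu.1.le) (by linarith [hu.2]),
    ← ENNReal.ofReal_add]
  · refine ENNReal.ofReal_le_ofReal ?_
    rw [← add_div]
    have h3 : (u - a) ^ (r + 1) ≤ (b - a) ^ (r + 1) :=
      Real.rpow_le_rpow (sub_nonneg.2 hu.1.le) (by linarith [hu.2]) hr1.le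
    have h4 : (b - a - (u - a)) ^ (r + 1) ≤ (b - a) ^ (r + 1) :=
      Real.rpow_le_rpow (by linarith [hu.2]) (by linarith [hu.1]) hr1.le
    -- Each one-sided piece is bounded by the full length b - a, whence the factor 2.
    gcongr
    linarith
  · exact div_nonneg (Real.rpow_nonneg (sub_nonneg.2 hu.1.le) _) hr1.le
  · exact div_nonneg (Real.rpow_nonneg (by linarith [hu.2]) _) hr1.le

theorem lintegral_lintegral_abs_sub_rpow_le {r a b : ℝ} (hr : -1 < r) (hab : a ≤ b) :
    ∫⁻ u in Ioc a b, ∫⁻ v in Ioc a b, ENNReal.ofReal (|u - v| ^ r) ≤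
      ENNReal.ofReal (2 * (b - a) ^ (r + 1) / (r + 1) * (b - a)) := by
  have hr1 : 0 < r + 1 := by linarith
  have h0 : 0 ≤ 2 * (b - a) ^ (r + 1) / (r + 1) :=
    div_nonneg (mul_nonneg zero_le_two (Real.rpow_nonneg (sub_nonneg.2 hab) _)) hr1.le
  calc ∫⁻ u in Ioc a b, ∫⁻ v in Ioc a b, ENNReal.ofReal (|u - v| ^ r)
      ≤ ∫⁻ _ in Ioc a b, ENNReal.ofReal (2 * (b - a) ^ (r + 1) / (r + 1)) :=
        setLIntegral_mono measurable_const fun u hu => lintegral_abs_sub_rpow_le hr hu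
    _ = _ := by rw [setLIntegral_const, Real.volume_Ioc, ← ENNReal.ofReal_mul h0]

theorem covDensity_pow (u v : ℝ) :
    covDensity H u v ^ q = (H * (2 * H - 1)) ^ q * |u - v| ^ (-(q * (2 - 2 * H))) := by
  rw [covDensity, mul_pow, ← Real.rpow_natCast (|u - v| ^ (2 * H - 2)), ← Real.rpow_mul (abs_nonneg _)]
  congr 2
  ring

/-- The q-th power of the density is a multiple of |u-v|^{-q(2-2H)}, integrable across the diagonal
because this exponent exceeds -1. Here the lower bound on H is decisive. -/
theorem lintegral_covDensity_pow_le (hH : 1 / 2 < H) (hβ : q * (2 - 2 * H) < 1) {a b : ℝ} (hab : a ≤ b) :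
    ∫⁻ u in Ioc a b, ∫⁻ v in Ioc a b, ENNReal.ofReal (covDensity H u v) ^ q ≤
      ENNReal.ofReal ((H * (2 * H - 1)) ^ q * (2 * (b - a) ^ (1 - q * (2 - 2 * H)) /
        (1 - q * (2 - 2 * H)) * (b - a))) := by
  have hc : 0 ≤ (H * (2 * H - 1)) ^ q := pow_nonneg (mul_nonneg (by linarith) (by linarith)) _
  have e : ∀ u v, ENNReal.ofReal (covDensity H u v) ^ q =
      ENNReal.ofReal ((H * (2 * H - 1)) ^ q) * ENNReal.ofReal (|u - v| ^ (-(q * (2 - 2 * H)))) := by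
    intro u v
    rw [← ENNReal.ofReal_pow (covDensity_nonneg hH u v), covDensity_pow, ENNReal.ofReal_mul hc]
  simp_rw [e]
  simp_rw [lintegral_const_mul' _ _ ENNReal.ofReal_ne_top]
  rw [ENNReal.ofReal_mul hc]
  gcongr
  have := lintegral_lintegral_abs_sub_rpow_le (r := -(q * (2 - 2 * H))) (by linarith) hab
  rwa [show -(q * (2 - 2 * H)) + 1 = 1 - q * (2 - 2 * H) by ring] at this

end

/-! ### The rate of convergence -/

section Sums

/-- Every distance is attained at most once on each side of k. -/
theorem sum_dist_le {d : ℕ → ℝ} (hd : ∀ m, 0 ≤ d m) {n k : ℕ} (hk : k < n) :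
    ∑ l ∈ Finset.range n, d (Nat.dist k l) ≤ 2 * ∑ m ∈ Finset.range n, d m := by
  have key : ∀ p : ℕ → Prop, ∀ _ : DecidablePred p,
      (∀ l l', p l → p l' → Nat.dist k l = Nat.dist k l' → l = l') →
      ∑ l ∈ (Finset.range n).filter p, d (Nat.dist k l) ≤ ∑ m ∈ Finset.range n, d m := by
    intro p _ hp
    rw [← Finset.sum_image (f := d) (g := fun l => Nat.dist k l)]
    · refine Finset.sum_le_sum_of_subset_of_nonneg ?_ fun m _ _ => hd m
      intro m hm
      obtain ⟨l, hl, rfl⟩ := Finset.mem_image.1 hm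
      have := Finset.mem_range.1 (Finset.mem_filter.1 hl).1
      rw [Finset.mem_range, Nat.dist]
      omega
    · intro l hl l' hl' h
      exact hp l l' (Finset.mem_filter.1 hl).2 (Finset.mem_filter.1 hl').2 h
  rw [← Finset.sum_filter_add_sum_filter_not _ (fun l => l ≤ k), two_mul]
  refine add_le_add (key _ _ ?_) (key _ _ ?_)
  · intro l l' h1 h2 h
    simp only [Nat.dist] at h
    omega
  · intro l l' h1 h2 h
    simp only [Nat.dist] at h
    omega

/-- A bound for the Gram matrix of the normalized errors on cells at distance `m`. -/
def gramBound (C D β : ℝ) (m : ℕ) : ℝ :=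
  if m ≤ 1 then C else D * (((m : ℝ) - 1) ^ (-β) - ((m : ℝ) + 1) ^ (-β))

variable {C D β : ℝ}

theorem gramBound_nonneg (hC : 0 ≤ C) (hD : 0 ≤ D) (hβ : 0 ≤ β) (m : ℕ) : 0 ≤ gramBound C D β m := by
  rw [gramBound]
  split_ifs with h
  · exact hC
  · have hm : (2 : ℝ) ≤ m := by exact_mod_cast not_le.1 h
    refine mul_nonneg hD (sub_nonneg.2 ?_)
    exact Real.rpow_le_rpow_of_nonpos (by linarith) (by linarith) (by linarith)

theorem sum_gramBound_le (hC : 0 ≤ C) (hD : 0 ≤ D) (hβ : 0 ≤ β) (n : ℕ) :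
    ∑ m ∈ Finset.range n, gramBound C D β m ≤ 2 * C + 2 * D := by
  -- The differences skip one index, so the telescoping sum keeps two terms at each end.
  have key : ∀ N : ℕ, ∑ m ∈ Finset.range (N + 2), gramBound C D β m =
      2 * C + D * ((1 : ℝ) ^ (-β) + (2 : ℝ) ^ (-β) - ((N : ℝ) + 1) ^ (-β) - ((N : ℝ) + 2) ^ (-β)) := by
    intro N
    induction N with
    | zero => simp [Finset.sum_range_succ, gramBound]; ring
    | succ N ih =>
      rw [show N + 1 + 2 = (N + 2) + 1 by ring, Finset.sum_range_succ, ih, gramBound,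
        if_neg (by omega)]
      push_cast
      rw [show (N : ℝ) + 2 - 1 = N + 1 by ring, show (N : ℝ) + 2 + 1 = N + 3 by ring,
        show (N : ℝ) + 1 + 1 = N + 2 by ring, show (N : ℝ) + 1 + 2 = N + 3 by ring]
      ring
  calc ∑ m ∈ Finset.range n, gramBound C D β m ≤ ∑ m ∈ Finset.range (n + 2), gramBound C D β m :=
        Finset.sum_le_sum_of_subset_of_nonneg (Finset.range_mono (by omega))
          fun m _ _ => gramBound_nonneg hC hD hβ m
    _ ≤ _ := by
        rw [key, Real.one_rpow]
        have h1 : (0 : ℝ) ≤ ((n : ℝ) + 1) ^ (-β) := by positivity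
        have h2 : (0 : ℝ) ≤ ((n : ℝ) + 2) ^ (-β) := by positivity
        have h3 : (2 : ℝ) ^ (-β) ≤ 1 := Real.rpow_le_one_of_one_le_of_nonpos (by norm_num) (by linarith)
        nlinarith

/-- The squared norm is the sum of all Gram entries, so one-sided upper bounds on them suffice;
every row sum is bounded uniformly in n apart from the factor b. -/
theorem norm_sum_sq_le {F : Type*} [NormedAddCommGroup F] [InnerProductSpace ℝ F] {n : ℕ} {w : ℕ → F}
    {b : ℝ} (hb : 0 ≤ b) (hC : 0 ≤ C) (hD : 0 ≤ D) (hβ : 0 ≤ β)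
    (h : ∀ k < n, ∀ l < n, inner ℝ (w k) (w l) ≤ b * gramBound C D β (Nat.dist k l)) :
    ‖∑ k ∈ Finset.range n, w k‖ ^ 2 ≤ n * (b * (2 * (2 * C + 2 * D))) := by
  rw [← real_inner_self_eq_norm_sq, sum_inner]
  simp_rw [inner_sum]
  calc ∑ k ∈ Finset.range n, ∑ l ∈ Finset.range n, inner ℝ (w k) (w l)
      ≤ ∑ k ∈ Finset.range n, b * (2 * (2 * C + 2 * D)) := by
        refine Finset.sum_le_sum fun k hk => ?_
        calc ∑ l ∈ Finset.range n, inner ℝ (w k) (w l)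
            ≤ ∑ l ∈ Finset.range n, b * gramBound C D β (Nat.dist k l) :=
              Finset.sum_le_sum fun l hl => h k (Finset.mem_range.1 hk) l (Finset.mem_range.1 hl)
          _ ≤ _ := by
              rw [← Finset.mul_sum]
              refine mul_le_mul_of_nonneg_left ?_ hb
              refine (sum_dist_le (gramBound_nonneg hC hD hβ) (Finset.mem_range.1 hk)).trans ?_
              exact mul_le_mul_of_nonneg_left (sum_gramBound_le hC hD hβ n) zero_le_two
    _ = _ := by simp

end Sums

/-! ### The partition of (0,1] into cells of length 1/n -/

section Cells

/-- The interval `(k/n, (k+1)/n]`. -/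
def cell (n k : ℕ) : Set ℝ := Ioc ((k : ℝ) / n) (((k : ℝ) + 1) / n)

variable {n k l : ℕ}

theorem measurableSet_cell (n k : ℕ) : MeasurableSet (cell n k) := measurableSet_Ioc

theorem cell_subset (hk : k < n) : cell n k ⊆ Ioc 0 1 := by
  have hn : (0 : ℝ) < n := by exact_mod_cast (Nat.zero_le k).trans_lt hk
  refine Ioc_subset_Ioc (by positivity) ?_
  rw [div_le_one hn]
  exact_mod_cast hk

theorem volume_cell (n k : ℕ) : volume (cell n k) = ENNReal.ofReal (1 / n) := by
  rw [cell, Real.volume_Ioc]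
  congr 1
  ring

theorem cell_width (n k : ℕ) : ((k : ℝ) + 1) / n - (k : ℝ) / n = 1 / n := by ring

theorem cell_le (n k : ℕ) : (k : ℝ) / n ≤ ((k : ℝ) + 1) / n := by gcongr; linarith

theorem abs_sub_bounds_cell {u v : ℝ} (hn : 0 < n) (hu : u ∈ cell n k) (hv : v ∈ cell n l)
    (hkl : 2 ≤ Nat.dist k l) :
    ((Nat.dist k l : ℝ) - 1) * (1 / n) ≤ |u - v| ∧ |u - v| ≤ ((Nat.dist k l : ℝ) + 1) * (1 / n) := by
  wlog h : l ≤ k generalizing k l u v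
  · rw [abs_sub_comm, Nat.dist_comm] at *
    exact this hv hu hkl (not_le.1 h).le
  have hn0 : (0 : ℝ) < n := by exact_mod_cast hn
  have hd : (Nat.dist k l : ℝ) = k - l := by
    rw [Nat.dist_eq_sub_of_le_right h, Nat.cast_sub h]
  have hd2 : (2 : ℝ) ≤ k - l := by rw [← hd]; exact_mod_cast hkl
  rw [hd]
  have a1 := hu.1
  have a2 := hu.2
  have b1 := hv.1
  have b2 := hv.2
  have e1 : ((k : ℝ) - l - 1) * (1 / n) = k / n - (l + 1) / n := by ring
  have e2 : ((k : ℝ) - l + 1) * (1 / n) = (k + 1) / n - l / n := by ring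
  have h0 : 0 ≤ ((k : ℝ) - l - 1) * (1 / n) := mul_nonneg (by linarith) (by positivity)
  rw [abs_of_nonneg (by linarith), e1, e2]
  constructor <;> linarith

end Cells

/-! ### Gram matrix of the cell errors -/

section Bounds

variable {H : ℝ} {q n k l : ℕ} {A A' : Set ℝ}

theorem setLIntegral_le_of_forall_le {A : Set ℝ} {f : ℝ → ℝ≥0∞} {a w : ℝ} (ha : 0 ≤ a)
    (hw : volume A = ENNReal.ofReal w) (h : ∀ u ∈ A, f u ≤ ENNReal.ofReal a) :
    ∫⁻ u in A, f u ≤ ENNReal.ofReal (a * w) := by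
  calc ∫⁻ u in A, f u ≤ ∫⁻ _ in A, ENNReal.ofReal a := setLIntegral_mono measurable_const h
    _ = _ := by rw [setLIntegral_const, hw, ENNReal.ofReal_mul ha]

theorem le_setLIntegral_of_forall_le {A : Set ℝ} {f : ℝ → ℝ≥0∞} {a w : ℝ} (ha : 0 ≤ a)
    (hA : MeasurableSet A)
    (hw : volume A = ENNReal.ofReal w) (h : ∀ u ∈ A, ENNReal.ofReal a ≤ f u) :
    ENNReal.ofReal (a * w) ≤ ∫⁻ u in A, f u := by
  calc ENNReal.ofReal (a * w) = ∫⁻ _ in A, ENNReal.ofReal a := by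
        rw [setLIntegral_const, hw, ENNReal.ofReal_mul ha]
    _ ≤ _ := setLIntegral_mono' hA h

/-- The class of `∏_i ∫_A ∂₁K_H(u,y_i) du` in `L²([0,1]^q)`. -/
def powVec (H : ℝ) (q : ℕ) (A : Set ℝ) : Lp ℝ 2 (cubeMeasure q) :=
  toL2 (cubeMeasure q) fun y => (powInt H q A y).toReal

/-- The class of `∫_A ∏_i ∂₁K_H(u,y_i) du` in `L²([0,1]^q)`. -/
def diagVec (H : ℝ) (q : ℕ) (A : Set ℝ) : Lp ℝ 2 (cubeMeasure q) :=
  toL2 (cubeMeasure q) fun y => (diagInt H q A y).toReal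

theorem lintegral_covDensity_sq_ne_top (hH : 1 / 2 < H) {a b : ℝ} (hab : a ≤ b) :
    ∫⁻ u in Ioc a b, ∫⁻ v in Ioc a b, ENNReal.ofReal (covDensity H u v) ≠ ∞ := by
  have h := lintegral_covDensity_pow_le (q := 1) hH (by norm_num; linarith) hab
  simp only [pow_one] at h
  exact ne_top_of_le_ne_top ENNReal.ofReal_ne_top h

theorem lintegral_powInt_sq_ne_top (hH : 1 / 2 < H) (hH1 : H < 1) (hk : k < n) :
    ∫⁻ y, powInt H q (cell n k) y * powInt H q (cell n k) y ∂cubeMeasure q ≠ ∞ := by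
  rw [lintegral_powInt_mul_powInt hH hH1 (measurableSet_cell n k) (measurableSet_cell n k)
    (cell_subset hk) (cell_subset hk)]
  exact ENNReal.pow_ne_top (lintegral_covDensity_sq_ne_top hH (cell_le n k))

theorem lintegral_diagInt_sq_ne_top (hH : 1 / 2 < H) (hH1 : H < 1) (hβ : q * (2 - 2 * H) < 1)
    {a b : ℝ} (hab : a ≤ b) (h : Ioc a b ⊆ Ioc 0 1) :
    ∫⁻ y, diagInt H q (Ioc a b) y * diagInt H q (Ioc a b) y ∂cubeMeasure q ≠ ∞ := by
  rw [lintegral_diagInt_mul_diagInt hH hH1 measurableSet_Ioc measurableSet_Ioc h h]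
  exact ne_top_of_le_ne_top ENNReal.ofReal_ne_top (lintegral_covDensity_pow_le hH hβ hab)

theorem memLp_powInt (hH : 1 / 2 < H) (hH1 : H < 1) (hk : k < n) :
    MemLp (fun y => (powInt H q (cell n k) y).toReal) 2 (cubeMeasure q) :=
  memLp_two_toReal (measurable_powInt _ _ _).aemeasurable (lintegral_powInt_sq_ne_top hH hH1 hk)

theorem memLp_diagInt (hH : 1 / 2 < H) (hH1 : H < 1) (hβ : q * (2 - 2 * H) < 1)
    {a b : ℝ} (hab : a ≤ b) (h : Ioc a b ⊆ Ioc 0 1) :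
    MemLp (fun y => (diagInt H q (Ioc a b) y).toReal) 2 (cubeMeasure q) :=
  memLp_two_toReal (measurable_diagInt _ _ _).aemeasurable
    (lintegral_diagInt_sq_ne_top hH hH1 hβ hab h)

theorem lintegral_diagInt_cell_sq_ne_top (hH : 1 / 2 < H) (hH1 : H < 1) (hβ : q * (2 - 2 * H) < 1)
    (hk : k < n) :
    ∫⁻ y, diagInt H q (cell n k) y * diagInt H q (cell n k) y ∂cubeMeasure q ≠ ∞ :=
  lintegral_diagInt_sq_ne_top hH hH1 hβ (cell_le n k) (cell_subset hk)

theorem memLp_diagInt_cell (hH : 1 / 2 < H) (hH1 : H < 1) (hβ : q * (2 - 2 * H) < 1)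
    (hk : k < n) : MemLp (fun y => (diagInt H q (cell n k) y).toReal) 2 (cubeMeasure q) :=
  memLp_diagInt hH hH1 hβ (cell_le n k) (cell_subset hk)

theorem inner_powVec_powVec (hH : 1 / 2 < H) (hH1 : H < 1) (hk : k < n) (hl : l < n) :
    inner ℝ (powVec H q (cell n k)) (powVec H q (cell n l)) =
      ((∫⁻ u in cell n k, ∫⁻ v in cell n l, ENNReal.ofReal (covDensity H u v)) ^ q).toReal := by
  rw [powVec, powVec, inner_toL2 (memLp_powInt hH hH1 hk) (memLp_powInt hH hH1 hl),
    integral_toReal_mul_toReal (measurable_powInt _ _ _).aemeasurable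
      (measurable_powInt _ _ _).aemeasurable (lintegral_powInt_sq_ne_top hH hH1 hk)
      (lintegral_powInt_sq_ne_top hH hH1 hl),
    lintegral_powInt_mul_powInt hH hH1 (measurableSet_cell n k) (measurableSet_cell n l)
      (cell_subset hk) (cell_subset hl)]

theorem inner_powVec_diagVec (hH : 1 / 2 < H) (hH1 : H < 1) (hβ : q * (2 - 2 * H) < 1)
    (hk : k < n) (hl : l < n) :
    inner ℝ (powVec H q (cell n k)) (diagVec H q (cell n l)) =
      (∫⁻ v in cell n l, (∫⁻ u in cell n k, ENNReal.ofReal (covDensity H u v)) ^ q).toReal := by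
  rw [powVec, diagVec, inner_toL2 (memLp_powInt hH hH1 hk)
      (memLp_diagInt_cell hH hH1 hβ hl),
    integral_toReal_mul_toReal (measurable_powInt _ _ _).aemeasurable
      (measurable_diagInt _ _ _).aemeasurable (lintegral_powInt_sq_ne_top hH hH1 hk)
      (lintegral_diagInt_cell_sq_ne_top hH hH1 hβ hl),
    lintegral_powInt_mul_diagInt hH hH1 (measurableSet_cell n k) (measurableSet_cell n l)
      (cell_subset hk) (cell_subset hl)]

theorem inner_diagVec_diagVec (hH : 1 / 2 < H) (hH1 : H < 1) (hβ : q * (2 - 2 * H) < 1)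
    (hk : k < n) (hl : l < n) :
    inner ℝ (diagVec H q (cell n k)) (diagVec H q (cell n l)) =
      (∫⁻ u in cell n k, ∫⁻ v in cell n l, ENNReal.ofReal (covDensity H u v) ^ q).toReal := by
  rw [diagVec, diagVec, inner_toL2 (memLp_diagInt_cell hH hH1 hβ hk)
      (memLp_diagInt_cell hH hH1 hβ hl),
    integral_toReal_mul_toReal (measurable_diagInt _ _ _).aemeasurable
      (measurable_diagInt _ _ _).aemeasurable
      (lintegral_diagInt_cell_sq_ne_top hH hH1 hβ hk)
      (lintegral_diagInt_cell_sq_ne_top hH hH1 hβ hl),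
    lintegral_diagInt_mul_diagInt hH hH1 (measurableSet_cell n k) (measurableSet_cell n l)
      (cell_subset hk) (cell_subset hl)]

/-- The contribution of the cell `(k/n,(k+1)/n]` to the approximation error. -/
def cellError (H : ℝ) (q n k : ℕ) : Lp ℝ 2 (cubeMeasure q) :=
  (n : ℝ) ^ (q - 1) • powVec H q (cell n k) - diagVec H q (cell n k)

/-- With the factor n^{q-1}, all four terms of the inner product would have modulus ρ^q n^{-2} if
the covariance density were a constant ρ on the pair of cells. In general the two terms with a plus
sign are at most hi^q n^{-2}, and the two cross terms, with a minus sign, at least lo^q n^{-2}. -/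
theorem inner_cellError_le_of_bounds (hH : 1 / 2 < H) (hH1 : H < 1) (hβ : q * (2 - 2 * H) < 1)
    (hq : q ≠ 0) (hk : k < n) (hl : l < n) {lo hi : ℝ} (hlo : 0 ≤ lo) (hhi : 0 ≤ hi)
    (h : ∀ u ∈ cell n k, ∀ v ∈ cell n l, lo ≤ covDensity H u v ∧ covDensity H u v ≤ hi) :
    inner ℝ (cellError H q n k) (cellError H q n l) ≤
      2 * (1 / (n : ℝ)) ^ 2 * (hi ^ q - lo ^ q) := by
  have hn : (n : ℝ) ≠ 0 := by
    have : 0 < n := (Nat.zero_le k).trans_lt hk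
    positivity
  set w : ℝ := 1 / n with hw
  have hw0 : 0 ≤ w := by positivity
  have hnw : (n : ℝ) * w = 1 := by rw [hw]; field_simp
  obtain ⟨p, rfl⟩ := Nat.exists_eq_add_one_of_ne_zero hq
  have b1 : inner ℝ (powVec H (p + 1) (cell n k)) (powVec H (p + 1) (cell n l)) ≤
      (hi * w * w) ^ (p + 1) := by
    rw [inner_powVec_powVec hH hH1 hk hl, ENNReal.toReal_pow]
    refine pow_le_pow_left₀ ENNReal.toReal_nonneg ?_ _
    refine ENNReal.toReal_le_of_le_ofReal (by positivity) ?_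
    refine setLIntegral_le_of_forall_le (by positivity) (volume_cell n k) fun u hu => ?_
    exact setLIntegral_le_of_forall_le hhi (volume_cell n l) fun v hv =>
      ENNReal.ofReal_le_ofReal (h u hu v hv).2
  have b2 : inner ℝ (diagVec H (p + 1) (cell n k)) (diagVec H (p + 1) (cell n l)) ≤
      hi ^ (p + 1) * w * w := by
    rw [inner_diagVec_diagVec hH hH1 hβ hk hl]
    refine ENNReal.toReal_le_of_le_ofReal (by positivity) ?_
    refine setLIntegral_le_of_forall_le (by positivity) (volume_cell n k) fun u hu => ?_
    refine setLIntegral_le_of_forall_le (by positivity) (volume_cell n l) fun v hv => ?_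
    rw [ENNReal.ofReal_pow hhi]
    exact pow_le_pow_left₀ zero_le (ENNReal.ofReal_le_ofReal (h u hu v hv).2) _
  have b3 : ∀ k l, k < n → l < n →
      (∀ u ∈ cell n k, ∀ v ∈ cell n l, lo ≤ covDensity H u v ∧ covDensity H u v ≤ hi) →
      (lo * w) ^ (p + 1) * w ≤
        inner ℝ (powVec H (p + 1) (cell n k)) (diagVec H (p + 1) (cell n l)) := by
    intro k l hk hl h
    rw [inner_powVec_diagVec hH hH1 hβ hk hl]
    have hle : ∀ v ∈ cell n l, ∫⁻ u in cell n k, ENNReal.ofReal (covDensity H u v) ≤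
        ENNReal.ofReal (hi * w) := fun v hv =>
      setLIntegral_le_of_forall_le hhi (volume_cell n k) fun u hu =>
        ENNReal.ofReal_le_ofReal (h u hu v hv).2
    -- Finiteness is needed for a lower bound, since `ENNReal.toReal` sends ∞ to 0.
    have hfin : ∫⁻ v in cell n l, (∫⁻ u in cell n k, ENNReal.ofReal (covDensity H u v)) ^ (p + 1) ≤
        ENNReal.ofReal ((hi * w) ^ (p + 1) * w) := by
      refine setLIntegral_le_of_forall_le (by positivity) (volume_cell n l) fun v hv => ?_
      rw [ENNReal.ofReal_pow (by positivity)]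
      exact pow_le_pow_left₀ zero_le (hle v hv) _
    rw [← ENNReal.ofReal_le_iff_le_toReal (ne_top_of_le_ne_top ENNReal.ofReal_ne_top hfin)]
    refine le_setLIntegral_of_forall_le (by positivity) (measurableSet_cell n l) (volume_cell n l)
      fun v hv => ?_
    rw [ENNReal.ofReal_pow (by positivity)]
    refine pow_le_pow_left₀ zero_le ?_ _
    exact le_setLIntegral_of_forall_le hlo (measurableSet_cell n k) (volume_cell n k) fun u hu =>
      ENNReal.ofReal_le_ofReal (h u hu v hv).1
  have c1 := b3 k l hk hl h
  have c2 := b3 l k hl hk fun u hu v hv => by rw [covDensity_comm]; exact h v hv u hu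
  have hnp : (0 : ℝ) ≤ (n : ℝ) ^ p := by positivity
  have hnwp : (n : ℝ) ^ p * w ^ p = 1 := by rw [← mul_pow, hnw, one_pow]
  rw [cellError, cellError, Nat.add_sub_cancel]
  simp only [inner_sub_left, inner_sub_right, real_inner_smul_left, real_inner_smul_right]
  rw [real_inner_comm] at c2
  have d1 := mul_le_mul_of_nonneg_left b1 (mul_nonneg hnp hnp)
  have d2 := mul_le_mul_of_nonneg_left c1 hnp
  have d3 := mul_le_mul_of_nonneg_left c2 hnp
  have e1 : (n : ℝ) ^ p * (n : ℝ) ^ p * (hi * w * w) ^ (p + 1) = hi ^ (p + 1) * w ^ 2 := by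
    calc _ = hi ^ (p + 1) * w ^ 2 * ((n : ℝ) ^ p * w ^ p) * ((n : ℝ) ^ p * w ^ p) := by ring
      _ = _ := by rw [hnwp]; ring
  have e2 : (n : ℝ) ^ p * ((lo * w) ^ (p + 1) * w) = lo ^ (p + 1) * w ^ 2 := by
    calc _ = lo ^ (p + 1) * w ^ 2 * ((n : ℝ) ^ p * w ^ p) := by ring
      _ = _ := by rw [hnwp]; ring
  rw [e1] at d1
  rw [e2] at d2 d3
  linarith

/-- For a single cell no cancellation is needed: the cross term is nonnegative and is dropped. Both
squared norms scale like n^{-(2-q(2-2H))}; for the tensor power this is n^{2(q-1)} · n^{-2qH}. -/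
theorem norm_cellError_sq_le (hH : 1 / 2 < H) (hH1 : H < 1) (hβ : q * (2 - 2 * H) < 1)
    (hq : q ≠ 0) (hk : k < n) :
    ‖cellError H q n k‖ ^ 2 ≤ (1 / (n : ℝ)) ^ (2 - q * (2 - 2 * H)) *
      ((2 * H) ^ q + (H * (2 * H - 1)) ^ q * (2 / (1 - q * (2 - 2 * H)))) := by
  have hn : (0 : ℝ) < n := by
    have : 0 < n := (Nat.zero_le k).trans_lt hk
    positivity
  have hw0 : 0 < 1 / (n : ℝ) := by positivity
  have hH0 : 0 < H := by linarith
  have h21 : 0 < 2 * H - 1 := by linarith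
  have hb1 : 0 < 1 - q * (2 - 2 * H) := by linarith
  have p1 : inner ℝ (powVec H q (cell n k)) (powVec H q (cell n k)) ≤
      (2 * H * (1 / (n : ℝ)) ^ (2 * H)) ^ q := by
    rw [inner_powVec_powVec hH hH1 hk hk, ENNReal.toReal_pow]
    refine pow_le_pow_left₀ ENNReal.toReal_nonneg ?_ _
    refine ENNReal.toReal_le_of_le_ofReal (by positivity) ?_
    have h := lintegral_covDensity_pow_le (q := 1) hH (by norm_num; linarith) (cell_le n k)
    simp only [pow_one, cell_width] at h
    refine h.trans_eq ?_
    congr 1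
    have e : (1 / (n : ℝ)) ^ (2 * H) = (1 / (n : ℝ)) ^ (2 * H - 1) * (1 / n) := by
      rw [← Real.rpow_add_one hw0.ne', sub_add_cancel]
    rw [e, Nat.cast_one, show 1 - 1 * (2 - 2 * H) = 2 * H - 1 by ring]
    generalize (1 / (n : ℝ)) ^ (2 * H - 1) = a
    have : H * 2 - 1 ≠ 0 := by linarith
    field_simp
  have p2 : inner ℝ (diagVec H q (cell n k)) (diagVec H q (cell n k)) ≤
      (H * (2 * H - 1)) ^ q * (2 * (1 / (n : ℝ)) ^ (1 - q * (2 - 2 * H)) /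
        (1 - q * (2 - 2 * H)) * (1 / n)) := by
    rw [inner_diagVec_diagVec hH hH1 hβ hk hk]
    refine ENNReal.toReal_le_of_le_ofReal (by positivity) ?_
    have h := lintegral_covDensity_pow_le hH hβ (cell_le n k)
    rwa [cell_width] at h
  have p3 : 0 ≤ inner ℝ (powVec H q (cell n k)) (diagVec H q (cell n k)) := by
    rw [inner_powVec_diagVec hH hH1 hβ hk hk]
    exact ENNReal.toReal_nonneg
  rw [← real_inner_self_eq_norm_sq, cellError]
  simp only [inner_sub_left, inner_sub_right, real_inner_smul_left, real_inner_smul_right]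
  rw [real_inner_comm (powVec H q (cell n k)) (diagVec H q (cell n k))]
  have hnp : (0 : ℝ) ≤ (n : ℝ) ^ (q - 1) := by positivity
  have d1 := mul_le_mul_of_nonneg_left p1 (mul_nonneg hnp hnp)
  have d3 := mul_nonneg hnp p3
  have e1 : (n : ℝ) ^ (q - 1) * (n : ℝ) ^ (q - 1) * (2 * H * (1 / (n : ℝ)) ^ (2 * H)) ^ q =
      (1 / (n : ℝ)) ^ (2 - q * (2 - 2 * H)) * (2 * H) ^ q := by
    have : (n : ℝ) ^ (q - 1) = (1 / (n : ℝ)) ^ (1 - q : ℝ) := by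
      rw [← Real.rpow_natCast, Nat.cast_sub (Nat.one_le_iff_ne_zero.2 hq), one_div,
        Real.inv_rpow hn.le, ← Real.rpow_neg hn.le]
      congr 1
      push_cast; ring
    rw [this, mul_pow, ← Real.rpow_natCast (_ ^ (2 * H)), ← Real.rpow_mul hw0.le,
      ← Real.rpow_add hw0, mul_left_comm, ← Real.rpow_add hw0, mul_comm]
    congr 2
    ring
  have e2 : (1 / (n : ℝ)) ^ (1 - q * (2 - 2 * H)) * (1 / n) =
      (1 / (n : ℝ)) ^ (2 - q * (2 - 2 * H)) := by
    rw [show 2 - q * (2 - 2 * H) = (1 - q * (2 - 2 * H)) + 1 by ring, Real.rpow_add hw0, Real.rpow_one]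
  have e3 : (H * (2 * H - 1)) ^ q * (2 * (1 / (n : ℝ)) ^ (1 - q * (2 - 2 * H)) /
        (1 - q * (2 - 2 * H)) * (1 / n)) =
      (1 / (n : ℝ)) ^ (2 - q * (2 - 2 * H)) * ((H * (2 * H - 1)) ^ q * (2 / (1 - q * (2 - 2 * H)))) := by
    rw [← e2]; ring
  rw [e1] at d1
  rw [e3] at p2
  linarith

/-- The constant in the Gram bound for neighbouring cells. -/
def nearConst (H : ℝ) (q : ℕ) : ℝ :=
  (2 * H) ^ q + (H * (2 * H - 1)) ^ q * (2 / (1 - q * (2 - 2 * H)))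

theorem inner_cellError_le (hH : 1 / 2 < H) (hH1 : H < 1) (hβ : q * (2 - 2 * H) < 1)
    (hq : q ≠ 0) (hk : k < n) (hl : l < n) :
    inner ℝ (cellError H q n k) (cellError H q n l) ≤ (1 / (n : ℝ)) ^ (2 - q * (2 - 2 * H)) *
      gramBound (nearConst H q) (2 * (H * (2 * H - 1)) ^ q) (q * (2 - 2 * H)) (Nat.dist k l) := by
  have hn1 : 0 < n := (Nat.zero_le k).trans_lt hk
  have hn : (0 : ℝ) < n := by positivity
  have hw0 : 0 < 1 / (n : ℝ) := by positivity
  have hH0 : 0 < H := by linarith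
  have h21 : 0 < 2 * H - 1 := by linarith
  rw [gramBound]
  split_ifs with h
  · have h1 := norm_cellError_sq_le hH hH1 hβ hq hk
    have h2 := norm_cellError_sq_le hH hH1 hβ hq hl
    refine (real_inner_le_norm _ _).trans ?_
    rw [nearConst]
    -- After Cauchy-Schwarz, 2ab ≤ a² + b² reduces to the two bounds for single cells.
    nlinarith [sq_nonneg (‖cellError H q n k‖ - ‖cellError H q n l‖)]
  · have hd : 2 ≤ Nat.dist k l := by omega
    have hd' : (2 : ℝ) ≤ Nat.dist k l := by exact_mod_cast hd
    set m : ℝ := (Nat.dist k l : ℝ) with hm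
    have hcov : ∀ x, 0 < x → (H * (2 * H - 1) * (x * (1 / n)) ^ (2 * H - 2)) ^ q =
        (H * (2 * H - 1)) ^ q * ((1 / (n : ℝ)) ^ (-(q * (2 - 2 * H))) * x ^ (-(q * (2 - 2 * H)))) := by
      intro x hx
      rw [mul_pow, ← Real.rpow_natCast ((x * (1 / n)) ^ (2 * H - 2)),
        ← Real.rpow_mul (by positivity), show (2 * H - 2) * (q : ℝ) = -(q * (2 - 2 * H)) by ring,
        Real.mul_rpow hx.le hw0.le, mul_comm (x ^ _)]
    -- Points of cells at index distance m are between (m-1)/n and (m+1)/n apart. The density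
    -- decreases with distance, so the farther bound gives the lower value.
    have key := inner_cellError_le_of_bounds (lo := H * (2 * H - 1) * ((m + 1) * (1 / n)) ^ (2 * H - 2))
      (hi := H * (2 * H - 1) * ((m - 1) * (1 / n)) ^ (2 * H - 2)) hH hH1 hβ hq hk hl
      (mul_nonneg (by positivity) (Real.rpow_nonneg (mul_nonneg (by linarith) hw0.le) _))
      (mul_nonneg (by positivity) (Real.rpow_nonneg (mul_nonneg (by linarith) hw0.le) _)) ?_
    · rw [hcov _ (by linarith), hcov _ (by linarith)] at key
      refine key.trans_eq ?_
      rw [show 2 - q * (2 - 2 * H) = 2 + -(q * (2 - 2 * H)) by ring, Real.rpow_add hw0, Real.rpow_two]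
      ring
    · intro u hu v hv
      obtain ⟨g1, g2⟩ := abs_sub_bounds_cell hn1 hu hv hd
      have hpos : 0 < (m - 1) * (1 / (n : ℝ)) := mul_pos (by linarith) hw0
      constructor
      · exact mul_le_mul_of_nonneg_left
          (Real.rpow_le_rpow_of_nonpos (hpos.trans_le g1) g2 (by linarith)) (by positivity)
      · exact mul_le_mul_of_nonneg_left
          (Real.rpow_le_rpow_of_nonpos hpos g1 (by linarith)) (by positivity)

theorem norm_sum_cellError_sq_le (hH : 1 / 2 < H) (hH1 : H < 1) (hβ : q * (2 - 2 * H) < 1)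
    (hq : q ≠ 0) (hn : 1 ≤ n) :
    ‖∑ k ∈ Finset.range n, cellError H q n k‖ ^ 2 ≤
      2 * (2 * nearConst H q + 2 * (2 * (H * (2 * H - 1)) ^ q)) *
        (n : ℝ) ^ (2 * (q : ℝ) - 1 - 2 * q * H) := by
  have hn0 : (0 : ℝ) < n := by exact_mod_cast hn
  have hH0 : 0 < H := by linarith
  have h21 : 0 < 2 * H - 1 := by linarith
  have hb1 : 0 < 1 - q * (2 - 2 * H) := by linarith
  have hb0 : 0 ≤ (q : ℝ) * (2 - 2 * H) := mul_nonneg (by positivity) (by linarith)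
  have h := norm_sum_sq_le (n := n) (w := cellError H q n) (b := (1 / (n : ℝ)) ^ (2 - q * (2 - 2 * H)))
    (C := nearConst H q) (D := 2 * (H * (2 * H - 1)) ^ q) (β := q * (2 - 2 * H)) (by positivity)
    (by unfold nearConst; positivity) (by positivity) hb0
    fun k hk l hl => inner_cellError_le hH hH1 hβ hq hk hl
  refine h.trans_eq ?_
  -- n rows, each of size n^{-(2-q(2-2H))}, give the rate.
  have e : (n : ℝ) * (1 / (n : ℝ)) ^ (2 - q * (2 - 2 * H)) = (n : ℝ) ^ (2 * (q : ℝ) - 1 - 2 * q * H) := by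
    rw [one_div, Real.inv_rpow hn0.le, ← Real.rpow_neg hn0.le]
    nth_rewrite 1 [← Real.rpow_one (n : ℝ)]
    rw [← Real.rpow_add hn0]
    congr 1; ring
  rw [← mul_assoc, e]
  ring

end Bounds

/-! ### The kernel of the Hermite random variable -/

section Kernel

variable {H : ℝ} {q n k : ℕ}

theorem diagInt_toReal (H : ℝ) (q : ℕ) (A : Set ℝ) (y : Fin q → ℝ) :
    (diagInt H q A y).toReal = ∫ u in A, ∏ i, dK H u (y i) := by
  rw [integral_eq_lintegral_of_nonneg_ae, diagInt]
  · simp_rw [ENNReal.ofReal_prod_of_nonneg fun i _ => dK_nonneg H _ (y i)]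
  · exact ae_of_all _ fun u => Finset.prod_nonneg fun i _ => dK_nonneg _ _ _
  · refine (Finset.measurable_fun_prod _ fun i _ => ?_).aestronglyMeasurable
    exact (measurable_dK H).comp (f := fun u => (u, y i)) (by fun_prop)

/-- Below the largest coordinate one factor of the product vanishes, so the integral may start at 0
instead of the maximum. This makes the kernel additive in the domain of u. The null set where some
coordinate is 0 is discarded. -/
theorem hermiteKernel_ae_eq (hH : 1 / 2 < H) (hq : q ≠ 0) :
    hermiteKernel H q =ᵐ[cubeMeasure q] fun y => (diagInt H q (Ioc 0 1) y).toReal := by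
  have : Nonempty (Fin q) := Fin.pos_iff_nonempty.1 (Nat.pos_of_ne_zero hq)
  filter_upwards [ae_cubeMeasure ae_unitMeasure_mem q] with y hy
  obtain ⟨j, hj⟩ := exists_eq_ciSup_of_finite (f := y)
  have hle : ∀ i, y i ≤ ⨆ i, y i := fun i => le_ciSup (finite_range y).bddAbove i
  rw [hermiteKernel, indicator_of_mem (by exact fun i => Ioc_subset_Icc_self (hy i)),
    diagInt_toReal, intervalIntegral.integral_of_le (hj ▸ (hy j).2),
    setIntegral_eq_of_subset_of_forall_sdiff_eq_zero (s := Ioc (⨆ i, y i) 1) (t := Ioc 0 1)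
      measurableSet_Ioc (Ioc_subset_Ioc_left (hj ▸ (hy j).1.le))]
  · refine setIntegral_congr_fun measurableSet_Ioc fun u hu => ?_
    exact Finset.prod_congr rfl fun i _ => derivK_eq_dK hH (hy i).1 ((hle i).trans_lt hu.1).ne'
  · intro u hu
    have hus : u ≤ ⨆ i, y i := not_lt.1 fun h => hu.2 ⟨h, hu.1.2⟩
    exact Finset.prod_eq_zero (Finset.mem_univ j) (dK_of_le (hj ▸ hus))

theorem memLp_hermiteKernel (hH : 1 / 2 < H) (hH1 : H < 1) (hβ : q * (2 - 2 * H) < 1) (hq : q ≠ 0) :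
    MemLp (hermiteKernel H q) 2 (cubeMeasure q) :=
  (memLp_diagInt hH hH1 hβ zero_le_one subset_rfl).ae_eq (hermiteKernel_ae_eq hH hq).symm

theorem toL2_hermiteKernel (hH : 1 / 2 < H) (hq : q ≠ 0) :
    toL2 (cubeMeasure q) (hermiteKernel H q) = diagVec H q (Ioc 0 1) :=
  toL2_congr (hermiteKernel_ae_eq hH hq)

theorem diagVec_Ioc_add_Ioc (hH : 1 / 2 < H) (hH1 : H < 1) (hβ : q * (2 - 2 * H) < 1) {a b c : ℝ}
    (ha : 0 ≤ a) (hab : a ≤ b) (hbc : b ≤ c) (hc : c ≤ 1) :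
    diagVec H q (Ioc a b) + diagVec H q (Ioc b c) = diagVec H q (Ioc a c) := by
  have s1 : Ioc a b ⊆ Ioc 0 1 := Ioc_subset_Ioc ha (hbc.trans hc)
  have s2 : Ioc b c ⊆ Ioc 0 1 := Ioc_subset_Ioc (ha.trans hab) hc
  have s3 : Ioc a c ⊆ Ioc 0 1 := Ioc_subset_Ioc ha hc
  refine Lp.ext ?_
  filter_upwards [Lp.coeFn_add (diagVec H q (Ioc a b)) (diagVec H q (Ioc b c)),
    coeFn_toL2 (memLp_diagInt hH hH1 hβ hab s1), coeFn_toL2 (memLp_diagInt hH hH1 hβ hbc s2),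
    coeFn_toL2 (memLp_diagInt hH hH1 hβ (hab.trans hbc) s3),
    -- `ENNReal.toReal` is additive only on finite values; square integrability makes them finite
    -- almost everywhere.
    ae_lt_top_of_lintegral_mul_self (measurable_diagInt _ _ _).aemeasurable
      (lintegral_diagInt_sq_ne_top hH hH1 hβ hab s1),
    ae_lt_top_of_lintegral_mul_self (measurable_diagInt _ _ _).aemeasurable
      (lintegral_diagInt_sq_ne_top hH hH1 hβ hbc s2)] with y h h1 h2 h3 f1 f2
  rw [h, Pi.add_apply, diagVec, diagVec, diagVec, h1, h2, h3, ← ENNReal.toReal_add f1.ne f2.ne]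
  congr 1
  rw [diagInt, diagInt, diagInt, ← Ioc_union_Ioc_eq_Ioc hab hbc,
    lintegral_union measurableSet_Ioc (Ioc_disjoint_Ioc_of_le le_rfl)]

theorem sum_diagVec_cell (hH : 1 / 2 < H) (hH1 : H < 1) (hβ : q * (2 - 2 * H) < 1) (hn : 1 ≤ n) :
    ∑ k ∈ Finset.range n, diagVec H q (cell n k) = diagVec H q (Ioc 0 1) := by
  have hn0 : (0 : ℝ) < n := by exact_mod_cast hn
  have key : ∀ m ≤ n, ∑ k ∈ Finset.range m, diagVec H q (cell n k) =
      diagVec H q (Ioc 0 ((m : ℝ) / n)) := by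
    intro m
    induction m with
    | zero =>
      intro _
      simp only [Finset.range_zero, Finset.sum_empty, Nat.cast_zero, zero_div, Ioc_self, diagVec,
        diagInt, Measure.restrict_empty, lintegral_zero_measure, ENNReal.toReal_zero]
      rw [toL2, dif_pos MemLp.zero']
      rfl
    | succ m ih =>
      intro hm
      rw [Finset.sum_range_succ, ih (by omega), cell, diagVec_Ioc_add_Ioc hH hH1 hβ le_rfl
        (by positivity) (cell_le n m), Nat.cast_succ]
      rw [div_le_one hn0]
      exact_mod_cast hm
  rw [key n le_rfl, div_self hn0.ne']

end Kernel

/-! ### Normalized increments and the kernels f_n -/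

section Increments

variable {H : Ioo (0 : ℝ) 1} {q n k : ℕ}

/-- The indicator of `[k/n,(k+1)/n]` in the Hilbert space of fractional Brownian motion. -/
def incr (H : Ioo (0 : ℝ) 1) (n k : ℕ) : FBMSpace H :=
  ind H (projIcc 0 1 zero_le_one (((k : ℝ) + 1) / n)) - ind H (projIcc 0 1 zero_le_one ((k : ℝ) / n))

theorem coe_projIcc_of_mem {x : ℝ} (hx : x ∈ Icc (0 : ℝ) 1) :
    (projIcc (0 : ℝ) 1 zero_le_one x : ℝ) = x := by
  rw [projIcc_of_mem _ hx]

theorem div_mem_Icc (hk : k ≤ n) : (k : ℝ) / n ∈ Icc (0 : ℝ) 1 :=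
  ⟨by positivity, div_le_one_of_le₀ (by exact_mod_cast hk) (by positivity)⟩

theorem succ_div_mem_Icc (hk : k < n) : ((k : ℝ) + 1) / n ∈ Icc (0 : ℝ) 1 := by
  exact_mod_cast div_mem_Icc (Nat.succ_le_of_lt hk)

theorem norm_ind_sub_ind_sq (s t : Icc (0 : ℝ) 1) :
    ‖ind H t - ind H s‖ ^ 2 = |(t : ℝ) - s| ^ (2 * (H : ℝ)) := by
  have h0 : (0 : ℝ) ^ (2 * (H : ℝ)) = 0 := Real.zero_rpow (by linarith [H.2.1])
  rw [norm_sub_sq_real, ← real_inner_self_eq_norm_sq, ← real_inner_self_eq_norm_sq, inner_ind,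
    inner_ind, inner_ind, fbmCov, fbmCov, fbmCov, sub_self, sub_self, abs_zero, h0, abs_sub_comm]
  ring

theorem norm_incr (hk : k < n) : ‖incr H n k‖ = ((n : ℝ) ^ (H : ℝ))⁻¹ := by
  have hn : (0 : ℝ) < n := by exact_mod_cast (Nat.zero_le k).trans_lt hk
  rw [← sq_eq_sq₀ (norm_nonneg _) (by positivity), incr, norm_ind_sub_ind_sq,
    coe_projIcc_of_mem (succ_div_mem_Icc hk), coe_projIcc_of_mem (div_mem_Icc hk.le), cell_width,
    abs_of_pos (by positivity), one_div, Real.inv_rpow hn.le, inv_pow, ← Real.rpow_natCast,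
    ← Real.rpow_mul hn.le]
  congr 2
  push_cast; ring

/-- K_H^* sends the indicator of a cell to a difference of primitives of ∂₁K_H, that is, to the
integral over the cell. -/
theorem powL2_Kstar_incr (hH : 1 / 2 < (H : ℝ)) (hk : k < n) :
    powL2 q (Kstar H (incr H n k)) = powVec H q (cell n k) := by
  have h : Kstar H (incr H n k) =ᵐ[unitMeasure] fun y => (kernelInt H (cell n k) y).toReal := by
    rw [incr, map_sub]
    filter_upwards [Lp.coeFn_sub (Kstar H (ind H (projIcc 0 1 zero_le_one (((k : ℝ) + 1) / n))))
      (Kstar H (ind H (projIcc 0 1 zero_le_one ((k : ℝ) / n)))), Kstar_ind hH _, Kstar_ind hH _,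
      ae_unitMeasure_mem] with y e e1 e2 hy
    have m1 := succ_div_mem_Icc hk
    have m2 := div_mem_Icc hk.le
    rw [e, Pi.sub_apply, e1, e2, coe_projIcc_of_mem m1, coe_projIcc_of_mem m2, cell,
      kernelInt_Ioc_toReal m1.1, kernelInt_Ioc_toReal m2.1, kernelInt_Ioc_toReal (cell_le n k),
      intervalIntegral.integral_interval_sub_left] <;>
    exact intervalIntegrable_dK hH hy.1 _ _
  refine toL2_congr ?_
  filter_upwards [ae_cubeMeasure h q] with y hy
  simp only [powInt, ENNReal.toReal_prod, hy]

theorem kernelSeq_eq (H : Ioo (0 : ℝ) 1) (q n : ℕ) :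
    kernelSeq H q n = (n : ℝ) ^ (q - 1) • ∑ k ∈ Finset.range n, tpow q (incr H n k) := rfl

theorem tpow_mem_symTensorPower (h : FBMSpace H) : tpow q h ∈ symTensorPower (FBMSpace H) q :=
  Submodule.le_topologicalClosure _ (Submodule.subset_span ⟨h, rfl⟩)

theorem kernelSeq_mem (H : Ioo (0 : ℝ) 1) (q n : ℕ) :
    kernelSeq H q n ∈ symTensorPower (FBMSpace H) q :=
  Submodule.smul_mem _ _ (Submodule.sum_mem _ fun _ _ => tpow_mem_symTensorPower _)

end Increments

/-! ### Transfer to `L²([0,1]^q)` -/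

section Transfer

variable {H : Ioo (0 : ℝ) 1} {q : ℕ}

theorem inner_powL2_Kstar (hH : 1 / 2 < (H : ℝ)) (q : ℕ) (g h : FBMSpace H) :
    inner ℝ (powL2 q (Kstar H g)) (powL2 q (Kstar H h)) = 1 * inner ℝ (tpow q g) (tpow q h) := by
  rw [inner_powL2, inner_tpow, inner_Kstar hH, one_mul]

/-- The map `h^{⊗q} ↦ (K_H^* h)^{⊗q}`, isometric on symmetric tensors. -/
def transfer (H : Ioo (0 : ℝ) 1) (q : ℕ) :
    TensorPower (FBMSpace H) q →L[ℝ] Lp ℝ 2 (cubeMeasure q) :=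
  extension (tpow q) fun h => powL2 q (Kstar H h)

theorem isExtension_transfer (hH : 1 / 2 < (H : ℝ)) (q : ℕ) :
    IsExtension (tpow q) (fun h => powL2 q (Kstar H h)) (transfer H q) :=
  isExtension_extension (exists_isExtension zero_le_one (inner_powL2_Kstar hH q))

theorem transfer_tpow (hH : 1 / 2 < (H : ℝ)) (h : FBMSpace H) :
    transfer H q (tpow q h) = powL2 q (Kstar H h) :=
  (isExtension_transfer hH q).1 h

theorem norm_transfer (hH : 1 / 2 < (H : ℝ)) {x : TensorPower (FBMSpace H) q}
    (hx : x ∈ symTensorPower (FBMSpace H) q) : ‖transfer H q x‖ = ‖x‖ := by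
  have h := (isExtension_transfer hH q).inner_eq (inner_powL2_Kstar hH q) hx hx
  rw [one_mul, real_inner_self_eq_norm_sq, real_inner_self_eq_norm_sq] at h
  exact (sq_eq_sq₀ (norm_nonneg _) (norm_nonneg _)).1 h

theorem transfer_kernelSeq_sub (hH : 1 / 2 < (H : ℝ)) (hβ : q * (2 - 2 * (H : ℝ)) < 1) (hq : q ≠ 0)
    {n : ℕ} (hn : 1 ≤ n) :
    transfer H q (kernelSeq H q n) - toL2 (cubeMeasure q) (hermiteKernel H q) =
      ∑ k ∈ Finset.range n, cellError H q n k := by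
  rw [toL2_hermiteKernel hH hq, ← sum_diagVec_cell hH H.2.2 hβ hn, kernelSeq_eq, map_smul, map_sum,
    Finset.smul_sum, ← Finset.sum_sub_distrib]
  refine Finset.sum_congr rfl fun k hk => ?_
  rw [transfer_tpow hH, powL2_Kstar_incr hH (Finset.mem_range.1 hk), cellError]

theorem exists_norm_transfer_kernelSeq_sub_sq_le (hH : 1 / 2 < (H : ℝ))
    (hβ : q * (2 - 2 * (H : ℝ)) < 1) (hq : q ≠ 0) :
    ∃ C : ℝ, ∀ n : ℕ, 1 ≤ n →
      ‖transfer H q (kernelSeq H q n) - toL2 (cubeMeasure q) (hermiteKernel H q)‖ ^ 2 ≤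
        C * (n : ℝ) ^ (2 * (q : ℝ) - 1 - 2 * q * H) :=
  ⟨_, fun _ hn => by
    rw [transfer_kernelSeq_sub hH hβ hq hn]
    exact norm_sum_cellError_sq_le hH H.2.2 hβ hq hn⟩

theorem tendsto_transfer_kernelSeq (hH : 1 / 2 < (H : ℝ)) (hβ : q * (2 - 2 * (H : ℝ)) < 1)
    (hq : q ≠ 0) :
    Tendsto (fun n => transfer H q (kernelSeq H q n)) atTop
      (𝓝 (toL2 (cubeMeasure q) (hermiteKernel H q))) := by
  obtain ⟨C, hC⟩ := exists_norm_transfer_kernelSeq_sub_sq_le hH hβ hq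
  rw [tendsto_iff_norm_sub_tendsto_zero]
  -- The exponent is q(2-2H) - 1 < 0.
  have h1 : Tendsto (fun n : ℕ => C * (n : ℝ) ^ (2 * (q : ℝ) - 1 - 2 * q * H)) atTop (𝓝 0) := by
    have h := (tendsto_rpow_neg_atTop (y := 1 - q * (2 - 2 * (H : ℝ))) (by linarith)).comp
      tendsto_natCast_atTop_atTop
    have h' := h.const_mul C
    rw [mul_zero] at h'
    refine h'.congr fun n => ?_
    simp only [Function.comp]
    congr 2
    ring
  have h2 : Tendsto (fun n : ℕ => ‖transfer H q (kernelSeq H q n) -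
      toL2 (cubeMeasure q) (hermiteKernel H q)‖ ^ 2) atTop (𝓝 0) :=
    squeeze_zero' (Eventually.of_forall fun n => sq_nonneg _)
      ((eventually_ge_atTop 1).mono fun n hn => hC n hn) h1
  simpa using h2.sqrt

/-- The images converge, and the transfer map is isometric on symmetric tensors, so the kernels are
themselves Cauchy. Thus a preimage of L_1 is obtained as a limit, without knowing the range of the
transfer map. -/
theorem exists_limit_kernelSeq (hH : 1 / 2 < (H : ℝ)) (hβ : q * (2 - 2 * (H : ℝ)) < 1)
    (hq : q ≠ 0) :
    ∃ f ∈ symTensorPower (FBMSpace H) q, Tendsto (kernelSeq H q) atTop (𝓝 f) ∧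
      transfer H q f = toL2 (cubeMeasure q) (hermiteKernel H q) := by
  have ht := tendsto_transfer_kernelSeq hH hβ hq
  have hc : CauchySeq (kernelSeq H q) := by
    have h := ht.cauchySeq
    rw [Metric.cauchySeq_iff] at h ⊢
    intro ε hε
    obtain ⟨N, hN⟩ := h ε hε
    refine ⟨N, fun m hm n hn => ?_⟩
    have := hN m hm n hn
    rwa [dist_eq_norm, ← map_sub, norm_transfer hH
      (Submodule.sub_mem _ (kernelSeq_mem _ _ _) (kernelSeq_mem _ _ _)), ← dist_eq_norm] at this
  obtain ⟨f, hf⟩ := cauchySeq_tendsto_of_complete hc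
  refine ⟨f, ?_, hf, tendsto_nhds_unique (((transfer H q).continuous.tendsto f).comp hf) ht⟩
  exact (Submodule.isClosed_topologicalClosure _).mem_of_tendsto hf
    (Eventually.of_forall fun n => kernelSeq_mem H q n)

end Transfer

/-! ### Multiple integrals of the kernels -/

section Integrals

variable {Ω : Type*} {mΩ : MeasurableSpace Ω} {P : Measure Ω} {H : Ioo (0 : ℝ) 1}
  {B : ℝ≥0 → Ω → ℝ} {q : ℕ}

theorem coeFn_finset_sum {ι : Type*} (s : Finset ι) (f : ι → Lp ℝ 2 P) :
    (∑ i ∈ s, f i : Lp ℝ 2 P) =ᵐ[P] fun ω => ∑ i ∈ s, f i ω := by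
  classical
  induction s using Finset.induction_on with
  | empty =>
    simp only [Finset.sum_empty]
    exact Lp.coeFn_zero ℝ 2 P
  | insert i s hi ih =>
    rw [Finset.sum_insert hi]
    filter_upwards [Lp.coeFn_add (f i) (∑ j ∈ s, f j), ih] with ω h1 h2
    rw [h1, Pi.add_apply, h2, Finset.sum_insert hi]

theorem IsFBM.isonormal_incr (hB : IsFBM H B P) {n k : ℕ} (hk : k < n) :
    isonormal H P B (incr H n k) =ᵐ[P]
      fun ω => B (((k : ℝ≥0) + 1) / n) ω - B ((k : ℝ≥0) / n) ω := by
  have t1 : timeNN (projIcc 0 1 zero_le_one (((k : ℝ) + 1) / n)) = ((k : ℝ≥0) + 1) / n := by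
    ext
    rw [coe_timeNN, coe_projIcc_of_mem (succ_div_mem_Icc hk)]
    push_cast; rfl
  have t2 : timeNN (projIcc 0 1 zero_le_one ((k : ℝ) / n)) = (k : ℝ≥0) / n := by
    ext
    rw [coe_timeNN, coe_projIcc_of_mem (div_mem_Icc hk.le)]
    push_cast; rfl
  rw [incr, map_sub]
  filter_upwards [Lp.coeFn_sub (isonormal H P B (ind H (projIcc 0 1 zero_le_one (((k : ℝ) + 1) / n))))
    (isonormal H P B (ind H (projIcc 0 1 zero_le_one ((k : ℝ) / n)))),
    hB.isonormal_ind _, hB.isonormal_ind _] with ω e e1 e2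
  rw [e, Pi.sub_apply, e1, e2, t1, t2]

variable [IsProbabilityMeasure P]

/-- Since W(K_H^* h) = B(h) and K_H^* preserves norms, both sides equal ‖h‖^q H_q(B(h)/‖h‖) when h ≠
0, and both vanish when h = 0. -/
theorem IsFBM.fbmIntegral_tpow (hB : IsFBM H B P) (hH : 1 / 2 < (H : ℝ)) (hq : q ≠ 0)
    (h : FBMSpace H) :
    fbmIntegral H q P B (tpow q h) = wienerMultipleIntegral H q P B (powL2 q (Kstar H h)) := by
  by_cases h0 : h = 0
  · have e1 : tpow q h = 0 := by
      have := pow_smul_of_inner (inner_tpow (FBMSpace H) q) 0 h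
      rwa [zero_smul, zero_pow hq, zero_smul, ← h0] at this
    have e2 : powL2 q (Kstar H h) = 0 := by
      rw [← transfer_tpow hH, e1, map_zero]
    rw [e1, e2, map_zero, map_zero]
  · have hr : 0 < ‖h‖ := norm_pos_iff.2 h0
    have hK : ‖Kstar H h‖ = ‖h‖ := (KstarIsometry hH).norm_map h
    refine Lp.ext ?_
    refine (hB.isIsonormal.multipleIntegral_pow (inner_tpow (FBMSpace H) q) hr rfl).trans ?_
    refine EventuallyEq.trans ?_ ((hB.isIsonormal_wienerIntegral hH).multipleIntegral_pow
      (inner_powL2 q) hr hK).symm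
    rw [wienerIntegral_Kstar hH]

theorem IsFBM.fbmIntegral_eq (hB : IsFBM H B P) (hH : 1 / 2 < (H : ℝ)) (hq : q ≠ 0)
    {f : TensorPower (FBMSpace H) q} (hf : f ∈ symTensorPower (FBMSpace H) q) :
    fbmIntegral H q P B f = wienerMultipleIntegral H q P B (transfer H q f) := by
  have hle : symTensorPower (FBMSpace H) q ≤
      (fbmIntegral H q P B - wienerMultipleIntegral H q P B ∘L transfer H q).ker := by
    refine Submodule.topologicalClosure_minimal _ (Submodule.span_le.2 ?_)
      (ContinuousLinearMap.isClosed_ker _)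
    rintro _ ⟨h, rfl⟩
    simp [hB.fbmIntegral_tpow hH hq h, transfer_tpow hH]
  simpa [sub_eq_zero] using hle hf

/-- A cell indicator has norm n^{-H}, so the integral of its q-th power is n^{-qH} H_q(n^H ΔB), with
ΔB the increment of B over the cell; the prefactor is n^{q-1} n^{-qH} = n^{q(1-H)-1}. -/
theorem IsFBM.S_ae_eq (hB : IsFBM H B P) (hq : q ≠ 0) {n : ℕ} (hn : 1 ≤ n) :
    S H q B n =ᵐ[P] fbmIntegral H q P B (kernelSeq H q n) := by
  have hn0 : (0 : ℝ) < n := by exact_mod_cast hn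
  have hk : ∀ᵐ ω ∂P, ∀ k ∈ Finset.range n, fbmIntegral H q P B (tpow q (incr H n k)) ω =
      (((n : ℝ) ^ (H : ℝ))⁻¹) ^ q * hermiteFun q
        ((n : ℝ) ^ (H : ℝ) * (B (((k : ℝ≥0) + 1) / n) ω - B ((k : ℝ≥0) / n) ω)) := by
    rw [eventually_all_finset]
    intro k hk
    rw [Finset.mem_range] at hk
    filter_upwards [hB.isIsonormal.multipleIntegral_pow (inner_tpow (FBMSpace H) q)
      (by positivity) (norm_incr hk), hB.isonormal_incr hk] with ω e1 e2
    rw [fbmIntegral, e1, e2, inv_inv]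
  rw [kernelSeq_eq, map_smul, map_sum]
  filter_upwards [hk, Lp.coeFn_smul ((n : ℝ) ^ (q - 1))
      (∑ k ∈ Finset.range n, fbmIntegral H q P B (tpow q (incr H n k))),
    coeFn_finset_sum (Finset.range n) fun k => fbmIntegral H q P B (tpow q (incr H n k))]
    with ω e1 e2 e3
  rw [e2, Pi.smul_apply, e3, Finset.sum_congr rfl e1, ← Finset.mul_sum, smul_eq_mul, ← mul_assoc, S]
  congr 1
  rw [← Real.rpow_natCast, ← Real.rpow_natCast, ← Real.rpow_neg hn0.le, ← Real.rpow_mul hn0.le,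
    ← Real.rpow_add hn0, Nat.cast_sub (Nat.one_le_iff_ne_zero.2 hq)]
  congr 1
  push_cast; ring

theorem IsFBM.integral_sub_sq (hB : IsFBM H B P) (hq : q ≠ 0) {f g : TensorPower (FBMSpace H) q}
    (hf : f ∈ symTensorPower (FBMSpace H) q) (hg : g ∈ symTensorPower (FBMSpace H) q) :
    ∫ ω, |fbmIntegral H q P B f ω - fbmIntegral H q P B g ω| ^ 2 ∂P = symNorm q (f - g) ^ 2 := by
  have hfg : f - g ∈ symTensorPower (FBMSpace H) q := Submodule.sub_mem _ hf hg
  have h := hB.isIsonormal.inner_multipleIntegral hq (inner_tpow (FBMSpace H) q) hfg hfg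
  rw [symNorm, mul_pow, Real.sq_sqrt (by positivity), ← real_inner_self_eq_norm_sq, ← h, L2.inner_def]
  refine integral_congr_ae ?_
  have e := Lp.coeFn_sub (fbmIntegral H q P B f) (fbmIntegral H q P B g)
  rw [← map_sub] at e
  filter_upwards [e] with ω hω
  change _ = inner ℝ (fbmIntegral H q P B (f - g) ω) (fbmIntegral H q P B (f - g) ω)
  rw [hω, Pi.sub_apply, sq_abs, real_inner_self_eq_norm_sq, Real.norm_eq_abs, sq_abs]

end Integrals

end

end FBM

/-! ### Assembly of the theorem -/

theorem proposition3p1 {Ω : Type*} [MeasurableSpace Ω] (P : Measure Ω) [IsProbabilityMeasure P]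
    (q : ℕ) (hq : 2 ≤ q) (H : Ioo (0 : ℝ) 1) (hH : 1 - 1 / (2 * (q : ℝ)) < (H : ℝ))
    (B : ℝ≥0 → Ω → ℝ) (hB : FBM.IsFBM H B P) :
    -- the multiple integrals with respect to `B` and `W` and the kernel `L_1` are well defined
    FBM.IsMultipleIntegral q (FBM.tpow q) (FBM.isonormal H P B) (FBM.fbmIntegral H q P B) ∧
    FBM.IsMultipleIntegral q (FBM.powL2 q) (FBM.wienerIntegral H P B)
      (FBM.wienerMultipleIntegral H q P B) ∧
    MemLp (FBM.hermiteKernel H q) 2 (FBM.cubeMeasure q) ∧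
    -- `S_n = I_q(f_n)` is a copy of `Z_n`
    (∀ n : ℕ, 1 ≤ n →
      FBM.kernelSeq H q n ∈ FBM.symTensorPower (FBM.FBMSpace H) q ∧
      FBM.S H q B n =ᵐ[P] FBM.fbmIntegral H q P B (FBM.kernelSeq H q n) ∧
      IdentDistrib (FBM.S H q B n) (FBM.hermiteVariation H q B n) P P) ∧
    -- `f_n` converges, and the rate of convergence
    ∃ f ∈ FBM.symTensorPower (FBM.FBMSpace H) q,
      Tendsto (FBM.kernelSeq H q) atTop (𝓝 f) ∧
      FBM.hermiteRV H q P B = FBM.fbmIntegral H q P B f ∧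
      (∀ n : ℕ, 1 ≤ n →
        ∫ ω, |FBM.S H q B n ω - FBM.hermiteRV H q P B ω| ^ 2 ∂P =
          ∫ ω, |FBM.fbmIntegral H q P B (FBM.kernelSeq H q n) ω -
            FBM.fbmIntegral H q P B f ω| ^ 2 ∂P ∧
        ∫ ω, |FBM.fbmIntegral H q P B (FBM.kernelSeq H q n) ω -
            FBM.fbmIntegral H q P B f ω| ^ 2 ∂P =
          FBM.symNorm q (FBM.kernelSeq H q n - f) ^ 2) ∧
      (fun n : ℕ => FBM.symNorm q (FBM.kernelSeq H q n - f) ^ 2) =O[atTop]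
        fun n : ℕ => (n : ℝ) ^ (2 * (q : ℝ) - 1 - 2 * (q : ℝ) * (H : ℝ)) := by
  have hq0 : q ≠ 0 := by omega
  have hq2 : (2 : ℝ) ≤ q := by exact_mod_cast hq
  -- The lower bound on H in the form used throughout: integrability of |u-v|^{-q(2-2H)}.
  have hβ : q * (2 - 2 * (H : ℝ)) < 1 := by
    have h1 : 1 - (H : ℝ) < 1 / (2 * q) := by linarith
    rw [lt_div_iff₀ (by positivity)] at h1
    linarith
  have hH2 : 1 / 2 < (H : ℝ) := by nlinarith [H.2.2]
  obtain ⟨f, hf, hlim, hfL⟩ := FBM.exists_limit_kernelSeq hH2 hβ hq0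
  have hZ : FBM.hermiteRV H q P B = FBM.fbmIntegral H q P B f := by
    rw [hB.fbmIntegral_eq hH2 hq0 hf, hfL, FBM.hermiteRV]
  refine ⟨hB.isIsonormal.isMultipleIntegral (FBM.inner_tpow _ q),
    (hB.isIsonormal_wienerIntegral hH2).isMultipleIntegral (FBM.inner_powL2 q),
    FBM.memLp_hermiteKernel hH2 H.2.2 hβ hq0,
    fun n hn => ⟨FBM.kernelSeq_mem H q n, hB.S_ae_eq hq0 hn, hB.identDistrib_hermiteVariation q hn⟩,
    f, hf, hlim, hZ, fun n hn => ⟨?_, hB.integral_sub_sq hq0 (FBM.kernelSeq_mem H q n) hf⟩, ?_⟩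
  · refine integral_congr_ae ?_
    filter_upwards [hB.S_ae_eq hq0 hn] with ω hω
    rw [hω, hZ]
  · obtain ⟨C, hC⟩ := FBM.exists_norm_transfer_kernelSeq_sub_sq_le hH2 hβ hq0
    -- C bounds the error in L²([0,1]^q), and q! comes from the norm on the symmetric power.
    refine IsBigO.of_bound (q.factorial * C) ((eventually_ge_atTop 1).mono fun n hn => ?_)
    have h := hC n hn
    rw [← hfL, ← map_sub, FBM.norm_transfer hH2
      (Submodule.sub_mem _ (FBM.kernelSeq_mem H q n) hf)] at h
    rw [FBM.symNorm, mul_pow, Real.sq_sqrt (by positivity), Real.norm_of_nonneg (by positivity),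
      Real.norm_of_nonneg (by positivity), mul_assoc]
    gcongr
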